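/- All manifolds and maps are $C^\infty$. Let $(E,[\![\cdot,\cdot]\!],\rho)$ be a Lie algebroid of rank $m$ over a (finite-dimensional, Hausdorff, second countable) manifold $Q$, let $\pi:E^*\times\mathbb R\to Q$ be the projection, and let $\mathcal T^E(E^*\times\mathbb R)\to E^*\times\mathbb R$ be the prolongation of $E$ over $\pi$: its fibre over $p$ is $$\{(a,v)\in E_{\pi(p)}\times T_p(E^*\times\mathbb R)\;:\;\rho(a)=T\pi(v)\},$$ its anchor is $(a,v)\mapsto v$, and, in terms of a local frame $e_\alpha$ of $E$, the bracket of the sections $(z^\alpha e_\alpha,X)$ and $(w^\beta e_\beta,Y)$ is $$\bigl((X(w^\gamma)-Y(z^\gamma))\,e_\gamma+z^\alpha w^\beta[\![e_\alpha,e_\beta]\!],\ [X,Y]\bigr).$$ Let $\eta$ be the $1$-section of $\mathcal T^E(E^*\times\mathbb R)$ given by $\eta_{(b,s)}(a,v)=ds(v)-b(a)$. For a Lie algebroid $A$ write $d^A$ for its exterior differential; in particular $d^E f(a)=\rho(a)f$ for a function $f$ on $Q$. A Lie algebroid $A$ of rank $2k+1$ with a $1$-section $\eta$ is called contact if $\eta\wedge(d^A\eta)^k\ne0$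 everywhere. A Lie subalgebroid $(j,i)$ of $A\to M$ is a Lie algebroid $B\to N$ with a Lie algebroid morphism $j:B\to A$ over $i:N\to M$ (that is, a vector bundle morphism with $d^B\circ(j,i)^*=(j,i)^*\circ d^A$ on $l$-sections, for all $l$) such that $j$ is injective on fibres and $i$ is an injective immersion; it is called Legendrian (in a contact Lie algebroid of rank $2k+1$) if its fibres have dimension $k$ and $\eta_{i(x)}$ vanishes on $j(B_x)$ for all $x\in N$. Then $(\mathcal T^E(E^*\times\mathbb R),\eta)$ is a contact Lie algebroid of rank $2m+1$, and: 1. For each $q\in Q$, let $TE_q^*\times\mathbb R\to E_q^*\times\mathbb R$ be the Lie algebroid with fibre $T_bE_q^*$ over $(b,s)$, anchor $v\mapsto(v,0)$ and bracket the Lie bracket of vector fields on $E_q^*$ for fixed $s$. The maps $i_q:E_q^*\times\mathbb R\to E^*\times\mathbb R$ (inclusion) and $j_q:TE_q^*\times\mathbb R\to\mathcal T^E(E^*\times\mathbb R)$, $j_q(v_b,s)=(0_q,v_{(b,s)})$, where $v_{(b,s)}$ is the image of $v_b$ under the tangent map of the inclusion $E^*_q\to E^*\times\mathbb R$, $b'\mapsto(b',s)$,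 form a Legendrian Lie subalgebroid of $(\mathcal T^E(E^*\times\mathbb R),\eta)$. 2. Let $\gamma$ be a section of $\pi:E^*\times\mathbb R\to Q$, and let $$F_\gamma=\{(a,T\gamma(\rho(a)))\;:\;a\in E\}\to\gamma(Q)$$ carry the Lie algebroid structure transported from $E$ along the isomorphism $a\mapsto(a,T\gamma(\rho(a)))$ over $\gamma:Q\to\gamma(Q)$. With the inclusions $j_\gamma:F_\gamma\to\mathcal T^E(E^*\times\mathbb R)$ and $i_\gamma:\gamma(Q)\to E^*\times\mathbb R$ it is a Lie subalgebroid of $\mathcal T^E(E^*\times\mathbb R)$. It is Legendrian if and only if $\gamma$ is locally the $1$-jet of a function, i.e. every point of $Q$ has an open neighbourhood $U$ and a smooth function $f:U\to\mathbb R$ with $\gamma=(d^Ef,f)$ on $U$. -/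

import Mathlib

open scoped Manifold ContDiff Topology Bundle
open Bundle Set

set_option linter.unusedSectionVars false

noncomputable section

namespace LieAlg

/-! ### Lie algebroids -/

section General

variable {EM : Type*} [NormedAddCommGroup EM] [NormedSpace ℝ EM]
  {HM : Type*} [TopologicalSpace HM] (IM : ModelWithCorners ℝ EM HM)
  {M : Type*} [TopologicalSpace M] [ChartedSpace HM M]
  (V : M → Type*) [∀ x, AddCommGroup (V x)] [∀ x, Module ℝ (V x)]

/-- The raw data of a Lie algebroid with fibres `V x`, `x : M`: which sections are smooth at which
points (this is the smooth vector bundle structure, see `IsSmoothBundle`), an anchor, and a bracket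
of sections.  The bracket is a total function whose values matter on smooth sections only. -/
structure AlgebroidData where
  smoothAt : (∀ x, V x) → M → Prop
  anchor : ∀ x, V x →ₗ[ℝ] TangentSpace IM x
  bracket : (∀ x, V x) → (∀ x, V x) → ∀ x, V x

variable {IM V}

namespace AlgebroidData

variable (A : AlgebroidData IM V)

/-- Globally defined smooth sections. -/
def IsSmooth (σ : ∀ x, V x) : Prop := ∀ x, A.smoothAt σ x

/-- The derivative `ρ(v) f` of a function along the anchor of a vector `v ∈ V x`. -/
def deriv (f : M → ℝ) (x : M) (v : V x) : ℝ :=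
  mfderiv IM 𝓘(ℝ, ℝ) f x (A.anchor x v)

/-- `V` is a smooth vector bundle of rank `r`: near each point there are `r` sections which form a
basis of each fibre, and the smooth sections are those with smooth coefficients in this basis. -/
def IsSmoothBundle (r : ℕ) : Prop :=
  ∀ x₀ : M, ∃ U ∈ 𝓝 x₀, ∃ e : Fin r → ∀ x, V x, ∀ x ∈ U,
    (LinearIndependent ℝ (fun i => e i x) ∧ Submodule.span ℝ (range fun i => e i x) = ⊤) ∧
    ∀ σ : ∀ x, V x, A.smoothAt σ x ↔
      ∃ c : Fin r → M → ℝ, (∀ i, ContMDiffAt IM 𝓘(ℝ, ℝ) ∞ (c i) x) ∧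
        ∀ᶠ y in 𝓝 x, σ y = ∑ i, c i y • e i y

/-- A Lie algebroid of rank `r`: a smooth vector bundle of rank `r`, a smooth anchor, and a Lie
bracket on the smooth sections that satisfies the Leibniz rule. -/
structure IsLieAlgebroid [IsManifold IM ∞ M] (r : ℕ) : Prop where
  bundle : A.IsSmoothBundle r
  anchor_smooth : ∀ σ, A.IsSmooth σ →
    ContMDiff IM IM.tangent ∞ (fun x => (⟨x, A.anchor x (σ x)⟩ : TangentBundle IM M))
  bracket_smooth : ∀ σ τ, A.IsSmooth σ → A.IsSmooth τ → A.IsSmooth (A.bracket σ τ)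
  bracket_add : ∀ σ τ₁ τ₂, A.IsSmooth σ → A.IsSmooth τ₁ → A.IsSmooth τ₂ →
    A.bracket σ (τ₁ + τ₂) = A.bracket σ τ₁ + A.bracket σ τ₂
  bracket_smul : ∀ (c : ℝ) σ τ, A.IsSmooth σ → A.IsSmooth τ →
    A.bracket σ (c • τ) = c • A.bracket σ τ
  bracket_antisymm : ∀ σ τ, A.IsSmooth σ → A.IsSmooth τ → A.bracket σ τ = -A.bracket τ σ
  jacobi : ∀ σ τ υ, A.IsSmooth σ → A.IsSmooth τ → A.IsSmooth υ →
    A.bracket σ (A.bracket τ υ) + A.bracket τ (A.bracket υ σ) + A.bracket υ (A.bracket σ τ) = 0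
  leibniz : ∀ (f : M → ℝ) σ τ, ContMDiff IM 𝓘(ℝ, ℝ) ∞ f → A.IsSmooth σ → A.IsSmooth τ →
    A.bracket σ (fun x => f x • τ x) =
      fun x => f x • A.bracket σ τ x + A.deriv f x (σ x) • τ x

/-- Smooth `k`-sections, i.e. smooth sections of `⋀ᵏ V*`. -/
def IsSmoothForm {k : ℕ} (μ : ∀ x, V x [⋀^Fin k]→ₗ[ℝ] ℝ) : Prop :=
  ∀ σ : Fin k → ∀ x, V x, (∀ i, A.IsSmooth (σ i)) →
    ContMDiff IM 𝓘(ℝ, ℝ) ∞ (fun x => μ x (fun i => σ i x))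

/-- The second sum in the formula for the exterior differential,
`∑_{i<j} (-1)^(i+j) μ([σ_i, σ_j], σ_0, …, σ̂_i, …, σ̂_j, …, σ_k)`; here `j = i.succAbove l`. -/
def extDiffBracketPart : {k : ℕ} → (∀ x, V x [⋀^Fin k]→ₗ[ℝ] ℝ) →
    (Fin (k + 1) → ∀ x, V x) → M → ℝ
  | 0, _, _, _ => 0
  | k + 1, μ, σ, x => ∑ i : Fin (k + 2), ∑ l : Fin (k + 1),
      if i < i.succAbove l then
        (-1 : ℝ) ^ ((i : ℕ) + (i.succAbove l : ℕ)) *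
          μ x (Matrix.vecCons (A.bracket (σ i) (σ (i.succAbove l)) x)
            (fun t : Fin k => σ (i.succAbove (l.succAbove t)) x))
      else 0

/-- The exterior differential: `(d μ)(σ_0, …, σ_k)` at the point `x`, for smooth sections `σ_i`. -/
def extDiff {k : ℕ} (μ : ∀ x, V x [⋀^Fin k]→ₗ[ℝ] ℝ) (σ : Fin (k + 1) → ∀ x, V x) (x : M) : ℝ :=
  (∑ i : Fin (k + 1), (-1 : ℝ) ^ (i : ℕ) *
      A.deriv (fun y => μ y (fun t => σ (i.succAbove t) y)) x (σ i x)) +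
    A.extDiffBracketPart μ σ x

/-- A `1`-section given by linear forms on the fibres, as an alternating form of degree `1`. -/
def oneForm (η : ∀ x, V x →ₗ[ℝ] ℝ) (x : M) : V x [⋀^Fin 1]→ₗ[ℝ] ℝ :=
  AlternatingMap.ofSubsingleton ℝ (V x) ℝ (0 : Fin 1) (η x)

/-- The value of `η ∧ (d η)^k` at `x` on the smooth sections `σ_0, …, σ_{2k}`. -/
def contactVolume (k : ℕ) (η : ∀ x, V x →ₗ[ℝ] ℝ) (σ : Fin (2 * k + 1) → ∀ x, V x) (x : M) : ℝ :=
  ((2 : ℝ) ^ k)⁻¹ * ∑ s : Equiv.Perm (Fin (2 * k + 1)), ((Equiv.Perm.sign s : ℤ) : ℝ) *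
    (η x (σ (s 0) x) * ∏ i : Fin k,
      A.extDiff (oneForm η)
        ![σ (s ⟨2 * i + 1, by omega⟩), σ (s ⟨2 * i + 2, by omega⟩)] x)

/-- A contact Lie algebroid of rank `2k+1` with contact section `η`: a Lie algebroid with a smooth
`1`-section `η` such that `η ∧ (d η)^k ≠ 0` everywhere. -/
structure IsContact [IsManifold IM ∞ M] (k : ℕ) (η : ∀ x, V x →ₗ[ℝ] ℝ) : Prop where
  lieAlgebroid : A.IsLieAlgebroid (2 * k + 1)
  smooth : A.IsSmoothForm (oneForm η)
  volume_ne_zero : ∀ x, ∃ σ : Fin (2 * k + 1) → ∀ x, V x,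
    (∀ i, A.IsSmooth (σ i)) ∧ A.contactVolume k η σ x ≠ 0

end AlgebroidData

/-! ### Lie subalgebroids -/

variable {EN : Type*} [NormedAddCommGroup EN] [NormedSpace ℝ EN]
  {HN : Type*} [TopologicalSpace HN] {IN : ModelWithCorners ℝ EN HN}
  {N : Type*} [TopologicalSpace N] [ChartedSpace HN N]
  {W : N → Type*} [∀ x, AddCommGroup (W x)] [∀ x, Module ℝ (W x)]

/-- The pull-back `(j, i)^* μ` of a `k`-section. -/
def pullback (i : N → M) (j : ∀ x, W x →ₗ[ℝ] V (i x)) {k : ℕ}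
    (μ : ∀ x, V x [⋀^Fin k]→ₗ[ℝ] ℝ) (x : N) : W x [⋀^Fin k]→ₗ[ℝ] ℝ :=
  (μ (i x)).compLinearMap (j x)

/-- `(j, i)` is a morphism of Lie algebroids from `B` to `A`: a smooth morphism of vector bundles
(that is, `i` is smooth and pulling back along `(j, i)` preserves smoothness of `1`-sections) such
that `d^B ((j, i)^* μ) = (j, i)^* (d^A μ)` for all smooth `k`-sections `μ` and all `k`.
The last equality of `(k+1)`-sections is tested on arbitrary vectors at each point `x`, as the
values at `x` of smooth sections `σ` of `B`; `τ` are smooth sections of `A` which extend the images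
of these vectors. -/
structure IsMorphism [IsManifold IM ∞ M] [IsManifold IN ∞ N]
    (B : AlgebroidData IN W) (A : AlgebroidData IM V)
    (i : N → M) (j : ∀ x, W x →ₗ[ℝ] V (i x)) : Prop where
  base_smooth : ContMDiff IN IM ∞ i
  fibre_smooth : ∀ μ : ∀ x, V x [⋀^Fin 1]→ₗ[ℝ] ℝ, A.IsSmoothForm μ →
    B.IsSmoothForm (pullback i j μ)
  extDiff_comm : ∀ (k : ℕ) (μ : ∀ x, V x [⋀^Fin k]→ₗ[ℝ] ℝ), A.IsSmoothForm μ →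
    ∀ (σ : Fin (k + 1) → ∀ x, W x) (τ : Fin (k + 1) → ∀ x, V x),
      (∀ l, B.IsSmooth (σ l)) → (∀ l, A.IsSmooth (τ l)) →
      ∀ x : N, (∀ l, τ l (i x) = j x (σ l x)) →
        B.extDiff (pullback i j μ) σ x = A.extDiff μ τ (i x)

/-- `(j, i)` is a Lie subalgebroid `B` (of rank `r`) of `A` (of rank `s`). -/
structure IsLieSubalgebroid [IsManifold IM ∞ M] [IsManifold IN ∞ N] (r s : ℕ)
    (B : AlgebroidData IN W) (A : AlgebroidData IM V)
    (i : N → M) (j : ∀ x, W x →ₗ[ℝ] V (i x)) : Prop where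
  source : B.IsLieAlgebroid r
  target : A.IsLieAlgebroid s
  morphism : IsMorphism B A i j
  fibre_injective : ∀ x, Function.Injective (j x)
  base_injective : Function.Injective i
  base_immersion : ∀ x, Function.Injective (mfderiv IN IM i x)

/-- `(j, i)` is a Legendrian Lie subalgebroid of the contact Lie algebroid `(A, η)` of rank
`2k+1`. -/
structure IsLegendrian [IsManifold IM ∞ M] [IsManifold IN ∞ N] (k : ℕ)
    (B : AlgebroidData IN W) (A : AlgebroidData IM V) (η : ∀ x, V x →ₗ[ℝ] ℝ)
    (i : N → M) (j : ∀ x, W x →ₗ[ℝ] V (i x)) : Prop where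
  contact : A.IsContact k η
  subalgebroid : ∃ r, IsLieSubalgebroid r (2 * k + 1) B A i j
  dim_fibre : ∀ x, Module.finrank ℝ (W x) = k
  vanishing : ∀ x (a : W x), η (i x) (j x a) = 0

end General

/-! ### Algebroids on a vector bundle, and the prolongation over a fibration -/

section Bundle

variable {EB : Type*} [NormedAddCommGroup EB] [NormedSpace ℝ EB]
  {Q : Type*} [TopologicalSpace Q] [ChartedSpace EB Q]
  (F : Type*) [NormedAddCommGroup F] [NormedSpace ℝ F]
  {E : Q → Type*} [TopologicalSpace (TotalSpace F E)]
  [∀ q, AddCommGroup (E q)] [∀ q, Module ℝ (E q)] [∀ q, TopologicalSpace (E q)]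
  [FiberBundle F E]
  (ρ : ∀ q, E q →L[ℝ] TangentSpace 𝓘(ℝ, EB) q)
  (br : (∀ q, E q) → (∀ q, E q) → ∀ q, E q)

/-- The data of an algebroid on a vector bundle `E → Q` with anchor `ρ` and bracket `br`. -/
def ofBundle : AlgebroidData 𝓘(ℝ, EB) E where
  smoothAt σ q := ContMDiffAt 𝓘(ℝ, EB) (𝓘(ℝ, EB).prod 𝓘(ℝ, F)) ∞
    (fun q => (⟨q, σ q⟩ : TotalSpace F E)) q
  anchor q := (ρ q).toLinearMap
  bracket := br

/-- The exterior differential `d^E f` of a function on the base, a section of `E*`. -/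
def dE (f : Q → ℝ) (q : Q) : E q →L[ℝ] ℝ :=
  ContinuousLinearMap.comp (mfderiv 𝓘(ℝ, EB) 𝓘(ℝ, ℝ) f q) (ρ q)

variable {EP : Type*} [NormedAddCommGroup EP] [NormedSpace ℝ EP]
  {HP : Type*} [TopologicalSpace HP] (IP : ModelWithCorners ℝ EP HP)
  {P : Type*} [TopologicalSpace P] [ChartedSpace HP P] (pr : P → Q)

/-- The fibre `𝒯^E_p P = {(a, v) ∈ E_{pr p} × T_p P | ρ(a) = T pr (v)}` of the prolongation. -/
def prolongFibre (p : P) : Submodule ℝ (E (pr p) × TangentSpace IP p) where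
  carrier := {z | ρ (pr p) z.1 = mfderiv IP 𝓘(ℝ, EB) pr p z.2}
  add_mem' {y z} hy hz := by
    simp only [mem_ofPred_eq, Prod.fst_add, Prod.snd_add, map_add] at *
    rw [hy, hz]
  zero_mem' := by simp
  smul_mem' c z hz := by
    simp only [mem_ofPred_eq, Prod.smul_fst, Prod.smul_snd, map_smul] at *
    rw [hz]

/-- The derivative `v(f)` of a function along a tangent vector. -/
def dirDeriv (f : P → ℝ) (p : P) (v : TangentSpace IP p) : ℝ := mfderiv IP 𝓘(ℝ, ℝ) f p v

/-- `e` is a family of smooth global sections of `E` which is a frame near `q₀`, and `z`, `w` are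
the coordinates of the `E`-components of `Z`, `W` with respect to this frame near `p`. -/
structure IsFrameExpansion (Z W : ∀ p, prolongFibre ρ IP pr p) (p : P)
    (e : Fin (Module.finrank ℝ F) → ∀ q, E q)
    (z w : Fin (Module.finrank ℝ F) → P → ℝ) : Prop where
  smooth : ∀ i, (ofBundle F ρ br).IsSmooth (e i)
  basis : ∀ᶠ q in 𝓝 (pr p), LinearIndependent ℝ (fun i => e i q) ∧
    Submodule.span ℝ (range fun i => e i q) = ⊤
  left : ∀ᶠ p' in 𝓝 p, (Z p').1.1 = ∑ i, z i p' • e i (pr p')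
  right : ∀ᶠ p' in 𝓝 p, (W p').1.1 = ∑ i, w i p' • e i (pr p')

open Classical in
/-- The `E`-component of the bracket `[[Z, W]]` of sections of the prolongation at `p`: if
`Z = (z^α e_α, X)` and `W = (w^β e_β, Y)` near `p`, it is
`(X(w^γ) - Y(z^γ)) e_γ + z^α w^β [[e_α, e_β]]` (which does not depend on the frame). -/
def prolongBracketFst (Z W : ∀ p, prolongFibre ρ IP pr p) (p : P) : E (pr p) :=
  if h : ∃ e z w, IsFrameExpansion F ρ br IP pr Z W p e z w then
    let e := h.choose
    let z := h.choose_spec.choose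
    let w := h.choose_spec.choose_spec.choose
    (∑ c, (dirDeriv IP (w c) p (Z p).1.2 - dirDeriv IP (z c) p (W p).1.2) • e c (pr p))
      + ∑ a, ∑ b, (z a p * w b p) • br (e a) (e b) (pr p)
  else 0

open Classical in
/-- The prolongation `𝒯^E P` of `(E, ρ, br)` over `pr : P → Q`: smooth sections are the pairs of
a smooth section of `E` along `pr` and a smooth vector field on `P`, the anchor is the second
projection, and the bracket is the one with `[[X_α, X_β]] = C^γ_{αβ} X_γ`, `[[X_α, V_l]] = 0` and
`[[V_l, V_m]] = 0` on the sections `X_α = (e_α, ρ^i_α ∂/∂q^i)`, `V_l = (0, ∂/∂u^l)` induced by a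
frame of `E` and fibred coordinates of `P`: its component in `TP` is the bracket of the vector
fields.  (For smooth sections of a Lie algebroid over a fibration, the membership test in the
definition of the bracket succeeds.) -/
def prolongation [IsManifold IP ∞ P] : AlgebroidData IP (fun p => prolongFibre ρ IP pr p) where
  smoothAt Z p :=
    ContMDiffAt IP (𝓘(ℝ, EB).prod 𝓘(ℝ, F)) ∞
      (fun p => (⟨pr p, (Z p).1.1⟩ : TotalSpace F E)) p ∧
    ContMDiffAt IP IP.tangent ∞ (fun p => (⟨p, (Z p).1.2⟩ : TangentBundle IP P)) p
  anchor p := (LinearMap.snd ℝ (E (pr p)) (TangentSpace IP p)).comp (prolongFibre ρ IP pr p).subtype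
  bracket Z W p :=
    if h : (prolongBracketFst F ρ br IP pr Z W p,
        VectorField.mlieBracket IP (fun p => (Z p).1.2) (fun p => (W p).1.2) p)
          ∈ prolongFibre ρ IP pr p
    then ⟨_, h⟩ else 0

end Bundle

/-! ### The fibre of a vector bundle as a manifold -/

section Fibre

variable {Q : Type*} [TopologicalSpace Q] (F : Type*) [NormedAddCommGroup F] [NormedSpace ℝ F]
  (E : Q → Type*) [TopologicalSpace (TotalSpace F E)]
  [∀ q, AddCommGroup (E q)] [∀ q, Module ℝ (E q)] [∀ q, TopologicalSpace (E q)]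
  [FiberBundle F E] [VectorBundle ℝ F E]

/-- The fibre `E_q`, as a manifold whose single chart is a linear isomorphism with the model
fibre `F`. -/
@[nolint unusedArguments]
def FibreManifold (_F : Type*) {Q : Type*} (E : Q → Type*) (q : Q) : Type _ := E q

instance (q : Q) : TopologicalSpace (FibreManifold F E q) := inferInstanceAs (TopologicalSpace (E q))

/-- The linear isomorphism of `E_q` with the model fibre, as a homeomorphism. -/
def fibreHomeo (q : Q) : FibreManifold F E q ≃ₜ F :=
  ((trivializationAt F E q).continuousLinearEquivAt ℝ q
    (mem_baseSet_trivializationAt F E q)).toHomeomorph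

instance (q : Q) : ChartedSpace F (FibreManifold F E q) :=
  (fibreHomeo F E q).toOpenPartialHomeomorph.singletonChartedSpace rfl

instance (q : Q) : IsManifold 𝓘(ℝ, F) ∞ (FibreManifold F E q) :=
  (fibreHomeo F E q).toOpenPartialHomeomorph.isManifold_singleton rfl

end Fibre

/-! ### The contact Hamiltonian prolongation -/

section Phase

variable {EB : Type*} [NormedAddCommGroup EB] [NormedSpace ℝ EB]
  {Q : Type*} [TopologicalSpace Q] [ChartedSpace EB Q] [IsManifold 𝓘(ℝ, EB) ∞ Q]
  (F : Type*) [NormedAddCommGroup F] [NormedSpace ℝ F]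
  (E : Q → Type*) [TopologicalSpace (TotalSpace F E)]
  [∀ q, AddCommGroup (E q)] [∀ q, Module ℝ (E q)] [∀ q, TopologicalSpace (E q)]
  [FiberBundle F E] [VectorBundle ℝ F E] [ContMDiffVectorBundle ∞ F E 𝓘(ℝ, EB)]

/-- The fibres of the dual bundle `E*`. -/
abbrev Dual (q : Q) : Type _ := E q →L[ℝ] Bundle.Trivial Q ℝ q

/-- The manifold `E* × ℝ`. -/
abbrev Phase : Type _ := TotalSpace (F →L[ℝ] ℝ) (Dual E) × ℝ

/-- The model with corners of `E* × ℝ`. -/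
abbrev phaseModel (EB F : Type*) [NormedAddCommGroup EB] [NormedSpace ℝ EB]
    [NormedAddCommGroup F] [NormedSpace ℝ F] :
    ModelWithCorners ℝ ((EB × (F →L[ℝ] ℝ)) × ℝ)
      (ModelProd (ModelProd EB (F →L[ℝ] ℝ)) ℝ) :=
  (𝓘(ℝ, EB).prod 𝓘(ℝ, F →L[ℝ] ℝ)).prod 𝓘(ℝ, ℝ)

/-- The projection `π : E* × ℝ → Q`. -/
abbrev phaseProj (p : Phase F E) : Q := p.1.proj

lemma phaseProj_mdifferentiable :
    MDifferentiable (phaseModel EB F) 𝓘(ℝ, EB) (phaseProj F E) :=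
  ((Bundle.contMDiff_proj (n := ∞) (IB := 𝓘(ℝ, EB)) (F := F →L[ℝ] ℝ) (Dual E)).comp
    contMDiff_fst).mdifferentiable (by simp)

variable {E}
variable (ρ : ∀ q, E q →L[ℝ] TangentSpace 𝓘(ℝ, EB) q)
  (br : (∀ q, E q) → (∀ q, E q) → ∀ q, E q)

/-- The fibres of `𝒯^E (E* × ℝ)`. -/
abbrev HamFibre (p : Phase F E) : Type _ := prolongFibre ρ (phaseModel EB F) (phaseProj F E) p

/-- The Lie algebroid `𝒯^E (E* × ℝ)`. -/
def hamProlongation : AlgebroidData (phaseModel EB F) (HamFibre F ρ) :=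
  prolongation F ρ br (phaseModel EB F) (phaseProj F E)

/-- The Liouville section, `Θ_{(b, s)} (a, v) = b(a)`. -/
def liouville (p : Phase F E) : HamFibre F ρ p →ₗ[ℝ] ℝ where
  toFun Z := p.1.2 Z.1.1
  map_add' Y Z := by simp
  map_smul' c Z := by simp

/-- The section `𝒱^s`, i.e. `(a, v) ↦ ds(v)` with `s` the coordinate of `ℝ`. -/
def dsForm (p : Phase F E) : HamFibre F ρ p →ₗ[ℝ] ℝ :=
  let ds : TangentSpace (phaseModel EB F) p →L[ℝ] ℝ :=
    mfderiv (phaseModel EB F) 𝓘(ℝ, ℝ) (fun p : Phase F E => p.2) p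
  ds.toLinearMap.comp ((LinearMap.snd ℝ (E (phaseProj F E p))
    (TangentSpace (phaseModel EB F) p)).comp
      (prolongFibre ρ (phaseModel EB F) (phaseProj F E) p).subtype)

/-- The contact section `η = 𝒱^s - Θ`. -/
def contactForm (p : Phase F E) : HamFibre F ρ p →ₗ[ℝ] ℝ := dsForm F ρ p - liouville F ρ p

/-! ### The Lie algebroid `T E*_q × ℝ → E*_q × ℝ` -/

/-- The manifold `E*_q`. -/
abbrev DualFibre (q : Q) : Type _ := FibreManifold (F →L[ℝ] ℝ) (Dual E) q

variable (E)

/-- The Lie algebroid `T E*_q × ℝ` over `E*_q × ℝ`: the fibre over `(b, s)` is `T_b E*_q`, the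
anchor is `v ↦ (v, 0)`, and the bracket is the bracket of vector fields on `E*_q` for fixed `s`. -/
def fibreAlgebroid (q : Q) :
    AlgebroidData (𝓘(ℝ, F →L[ℝ] ℝ).prod 𝓘(ℝ, ℝ))
      (fun x : DualFibre F (E := E) q × ℝ => TangentSpace 𝓘(ℝ, F →L[ℝ] ℝ) x.1) where
  smoothAt v x :=
    ContMDiffAt (𝓘(ℝ, F →L[ℝ] ℝ).prod 𝓘(ℝ, ℝ)) 𝓘(ℝ, F →L[ℝ] ℝ).tangent ∞
      (fun y => (⟨y.1, v y⟩ : TangentBundle 𝓘(ℝ, F →L[ℝ] ℝ) (DualFibre F (E := E) q))) x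
  anchor x := (mfderiv 𝓘(ℝ, F →L[ℝ] ℝ) (𝓘(ℝ, F →L[ℝ] ℝ).prod 𝓘(ℝ, ℝ))
    (fun b : DualFibre F (E := E) q => (b, x.2)) x.1).toLinearMap
  bracket v w x := VectorField.mlieBracket 𝓘(ℝ, F →L[ℝ] ℝ)
    (fun b : DualFibre F (E := E) q => v (b, x.2)) (fun b => w (b, x.2)) x.1

variable {E}

/-- The inclusion `i_q : E*_q × ℝ → E* × ℝ`. -/
def fibreIncl (q : Q) (x : DualFibre F (E := E) q × ℝ) : Phase F E := (⟨q, x.1⟩, x.2)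

/-- The map `j_q (v_b, s) = (0_q, v_{(b, s)})`, where `v_{(b, s)}` is the image of `v_b` under the
tangent map of `b ↦ (b, s)`, `E*_q → E* × ℝ`. -/
def fibreInclBundle (q : Q) (x : DualFibre F (E := E) q × ℝ) :
    TangentSpace 𝓘(ℝ, F →L[ℝ] ℝ) x.1 →ₗ[ℝ] HamFibre F ρ (fibreIncl F q x) :=
  let T : TangentSpace 𝓘(ℝ, F →L[ℝ] ℝ) x.1 →L[ℝ]
      TangentSpace (phaseModel EB F) (fibreIncl F q x) :=
    mfderiv 𝓘(ℝ, F →L[ℝ] ℝ) (phaseModel EB F) (fun b => fibreIncl F q (b, x.2)) x.1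
  LinearMap.codRestrict (prolongFibre ρ (phaseModel EB F) (phaseProj F E) (fibreIncl F q x))
    (LinearMap.prod 0 T.toLinearMap) (by
      intro v
      change ρ q 0 = mfderiv (phaseModel EB F) 𝓘(ℝ, EB) (phaseProj F E) (fibreIncl F q x) (T v)
      rw [ContinuousLinearMap.map_zero]
      by_cases h : MDifferentiableAt 𝓘(ℝ, F →L[ℝ] ℝ) (phaseModel EB F)
          (fun b : DualFibre F (E := E) q => fibreIncl F q (b, x.2)) x.1
      · have h1 := mfderiv_comp x.1 (phaseProj_mdifferentiable (EB := EB) F E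
          (fibreIncl F q x)) h
        have h2 : (phaseProj F E) ∘ (fun b : DualFibre F (E := E) q => fibreIncl F q (b, x.2))
            = fun _ => q := rfl
        rw [h2, mfderiv_const] at h1
        exact DFunLike.congr_fun h1 v
      · have hT : T = 0 := mfderiv_zero_of_not_mdifferentiableAt h
        rw [hT]
        exact (ContinuousLinearMap.map_zero _).symm)

/-! ### The Lie algebroid `F_γ → γ(Q)` of a section `γ` of `E* × ℝ` -/

variable (E) (EB)

/-- A smooth section `γ = (γ₀, γₛ)` of `π : E* × ℝ → Q`. -/
structure PhaseSection where
  fst : ∀ q, Dual E q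
  snd : Q → ℝ
  smooth : ContMDiff 𝓘(ℝ, EB) (phaseModel EB F) ∞
    (fun q => ((⟨q, fst q⟩, snd q) : Phase F E))

variable {F E} {EB}

namespace PhaseSection

variable (γ : PhaseSection EB F E)

/-- The section as a map `Q → E* × ℝ`. -/
def map (q : Q) : Phase F E := (⟨q, γ.fst q⟩, γ.snd q)

/-- The image `γ(Q)`. -/
def Image : Type _ := range γ.map

instance : TopologicalSpace γ.Image := inferInstanceAs (TopologicalSpace (range γ.map))

/-- The map `γ : Q → γ(Q)`. -/
def toImage (q : Q) : γ.Image := ⟨γ.map q, q, rfl⟩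

/-- The inclusion `i_γ : γ(Q) → E* × ℝ`. -/
def incl (x : γ.Image) : Phase F E := x.1

/-- The restriction of `π` to `γ(Q)`, the inverse of `γ : Q → γ(Q)`. -/
def base (x : γ.Image) : Q := phaseProj F E (γ.incl x)

/-- The homeomorphism `γ(Q) ≃ Q`. -/
def imageHomeo : γ.Image ≃ₜ Q where
  toFun := γ.base
  invFun := γ.toImage
  left_inv := by rintro ⟨_, q, rfl⟩; rfl
  right_inv _ := rfl
  continuous_toFun := (FiberBundle.continuous_proj (F →L[ℝ] ℝ) (Dual E)).comp
    (continuous_fst.comp continuous_subtype_val)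
  continuous_invFun := γ.smooth.continuous.subtype_mk _

/-- The smooth structure of the submanifold `γ(Q)`: the one for which `γ : Q → γ(Q)` is a
diffeomorphism. -/
instance : ChartedSpace EB γ.Image where
  atlas := (fun e => γ.imageHomeo.toOpenPartialHomeomorph ≫ₕ e) '' atlas EB Q
  chartAt x := γ.imageHomeo.toOpenPartialHomeomorph ≫ₕ chartAt EB (γ.base x)
  mem_chart_source x := by
    rw [OpenPartialHomeomorph.trans_source]
    exact ⟨mem_univ _, mem_chart_source EB (γ.base x)⟩
  chart_mem_atlas x := mem_image_of_mem _ (chart_mem_atlas EB _)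

instance : IsManifold 𝓘(ℝ, EB) ∞ γ.Image where
  compatible := by
    rintro _ _ ⟨e, he, rfl⟩ ⟨e', he', rfl⟩
    have h := (contDiffGroupoid ∞ 𝓘(ℝ, EB)).compatible he he'
    refine StructureGroupoid.mem_of_eqOnSource _ h ?_
    rw [OpenPartialHomeomorph.trans_symm_eq_symm_trans_symm, OpenPartialHomeomorph.trans_assoc]
    refine OpenPartialHomeomorph.EqOnSource.trans' (Setoid.refl _) ?_
    rw [← OpenPartialHomeomorph.trans_assoc]
    have : γ.imageHomeo.toOpenPartialHomeomorph.symm ≫ₕ γ.imageHomeo.toOpenPartialHomeomorph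
        = OpenPartialHomeomorph.refl Q := by
      rw [← Homeomorph.symm_toOpenPartialHomeomorph, ← Homeomorph.trans_toOpenPartialHomeomorph]
      simp
    rw [this, OpenPartialHomeomorph.refl_trans]

/-- The tangent map `T_q γ : T_q Q → T_{γ(q)} (E* × ℝ)`, for a point `x = γ(q)` of `γ(Q)`. -/
def tangent (x : γ.Image) :
    TangentSpace 𝓘(ℝ, EB) (γ.base x) →L[ℝ] TangentSpace (phaseModel EB F) (γ.incl x) :=
  mfderiv 𝓘(ℝ, EB) (phaseModel EB F) γ.map (γ.base x)

/-- The tangent map at `q` of the diffeomorphism `γ : Q → γ(Q)`, for a point `x = γ(q)`. -/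
def tangentImage (x : γ.Image) :
    TangentSpace 𝓘(ℝ, EB) (γ.base x) →L[ℝ] TangentSpace 𝓘(ℝ, EB) x :=
  mfderiv 𝓘(ℝ, EB) 𝓘(ℝ, EB) γ.toImage (γ.base x)

lemma tangent_mem (x : γ.Image) (a : E (γ.base x)) :
    ((a, γ.tangent x (ρ _ a)) : E (γ.base x) × TangentSpace (phaseModel EB F) (γ.incl x)) ∈
      prolongFibre ρ (phaseModel EB F) (phaseProj F E) (γ.incl x) := by
  obtain ⟨_, q, rfl⟩ := x
  change ρ q a = mfderiv (phaseModel EB F) 𝓘(ℝ, EB) (phaseProj F E) (γ.map q)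
    (mfderiv 𝓘(ℝ, EB) (phaseModel EB F) γ.map q (ρ q a))
  have h1 := mfderiv_comp q (phaseProj_mdifferentiable (EB := EB) F E (γ.map q))
    (γ.smooth.mdifferentiable (by simp) q)
  have h2 : (phaseProj F E) ∘ γ.map = id := rfl
  rw [h2, mfderiv_id] at h1
  exact DFunLike.congr_fun h1 (ρ q a)

/-- The fibre `{(a, T γ (ρ(a)))}` of `F_γ` at a point of `γ(Q)`. -/
def fibre (x : γ.Image) :
    Submodule ℝ (E (γ.base x) × TangentSpace (phaseModel EB F) (γ.incl x)) where
  carrier := {z | z.2 = γ.tangent x (ρ _ z.1)}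
  add_mem' {y z} hy hz := by
    simp only [mem_ofPred_eq, Prod.fst_add, Prod.snd_add, ContinuousLinearMap.map_add] at *
    rw [hy, hz]
  zero_mem' := by
    simp only [mem_ofPred_eq, Prod.fst_zero, Prod.snd_zero, ContinuousLinearMap.map_zero]
  smul_mem' c z hz := by
    simp only [mem_ofPred_eq, Prod.smul_fst, Prod.smul_snd, ContinuousLinearMap.map_smul] at *
    rw [hz]

/-- The Lie algebroid `F_γ` over `γ(Q)`, with the structure transported from `E` along the
isomorphism `a ↦ (a, T γ (ρ(a)))` over `γ : Q → γ(Q)`. -/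
def algebroid : AlgebroidData 𝓘(ℝ, EB) (fun x : γ.Image => γ.fibre ρ x) where
  smoothAt σ x :=
    ContMDiffAt 𝓘(ℝ, EB) (𝓘(ℝ, EB).prod 𝓘(ℝ, F)) ∞
      (fun x => (⟨γ.base x, (σ x).1.1⟩ : TotalSpace F E)) x ∧
    ContMDiffAt 𝓘(ℝ, EB) (phaseModel EB F).tangent ∞
      (fun x => (⟨γ.incl x, (σ x).1.2⟩ : TangentBundle (phaseModel EB F) (Phase F E))) x
  anchor x := ((γ.tangentImage x).toLinearMap.comp (ρ (γ.base x)).toLinearMap).comp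
    ((LinearMap.fst ℝ _ _).comp (γ.fibre ρ x).subtype)
  bracket σ τ x :=
    let c : ∀ q, E q := br (fun q => (σ (γ.toImage q)).1.1) (fun q => (τ (γ.toImage q)).1.1)
    ⟨(c (γ.base x), γ.tangent x (ρ _ (c (γ.base x)))), rfl⟩

/-- The inclusion `j_γ : F_γ → 𝒯^E (E* × ℝ)`. -/
def inclBundle (x : γ.Image) : γ.fibre ρ x →ₗ[ℝ] HamFibre F ρ (γ.incl x) :=
  Submodule.inclusion (by
    rintro ⟨a, v⟩ (rfl : v = γ.tangent x (ρ _ a))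
    exact γ.tangent_mem ρ x a)

/-- `γ` is locally the `1`-jet `j¹ f = (d^E f, f)` of a smooth function `f` on the base. -/
def IsLocallyJet : Prop :=
  ∀ q : Q, ∃ U : Set Q, IsOpen U ∧ q ∈ U ∧ ∃ f : Q → ℝ,
    ContMDiffOn 𝓘(ℝ, EB) 𝓘(ℝ, ℝ) ∞ f U ∧
    ∀ x ∈ U, γ.map x = (⟨x, dE ρ f x⟩, f x)

end PhaseSection

end Phase

end LieAlg

end

open scoped Manifold ContDiff Topology Bundle
open Bundle Set

set_option linter.unusedSectionVars false

noncomputable section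

namespace LieAlg

/-! ### Calculus of vector-valued derivatives on manifolds. -/

section Calculus

variable {EM : Type*} [NormedAddCommGroup EM] [NormedSpace ℝ EM]
  {HM : Type*} [TopologicalSpace HM] {IM : ModelWithCorners ℝ EM HM}
  {M : Type*} [TopologicalSpace M] [ChartedSpace HM M]
  {EN : Type*} [NormedAddCommGroup EN] [NormedSpace ℝ EN]
  {HN : Type*} [TopologicalSpace HN] {IN : ModelWithCorners ℝ EN HN}
  {N : Type*} [TopologicalSpace N] [ChartedSpace HN N]
  {G : Type*} [NormedAddCommGroup G] [NormedSpace ℝ G]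
  {G' : Type*} [NormedAddCommGroup G'] [NormedSpace ℝ G']
  {G'' : Type*} [NormedAddCommGroup G''] [NormedSpace ℝ G'']

/-! Brackets are operations on global sections, but the Leibniz rule and cutoff functions make them
local. Near a point a Lie algebroid is therefore an anchor matrix `R` together with structure
functions `C` (`exists_isLocalForm`), subject to antisymmetry of `C`, compatibility of `R` with `C`,
and a Jacobi identity. The compatibility is not an axiom: it follows from Jacobi and Leibniz, since
expanding the Jacobi identity for `σ, τ, fυ` leaves only the anchor identity applied to `f`
(`anchor_bracket`).

In these coordinates a section of a prolongation is a pair `(z, X)` with `T pr (X) = R z`, and the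
bracket of `(z, X)` and `(w, Y)` is `(X(w) - Y(z) + C(z, w), [X, Y])` (`prolongCoord_bracket`). No
frame is left in this expression, so the axioms reduce to those of vector fields and to the
identities for `C` (`prolongation_isLieAlgebroid`).

On `E* × ℝ`, with fibre coordinates `(ξ, s)`, the contact section is `ds - ξ(z)`. If `ζ` and `ω` are
the `ξ`-components of two tangent vectors with `E`-coordinates `z` and `w`, then `dη` pairs them to
`-ζ(w) + ω(z) + ξ(C(z, w))` (`extDiff_contactForm`). There is a basis at each point made of one
vector on which `η` is `1` and `m` pairs in the kernel of `η` on which `dη` is the standard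
symplectic form. On that basis every permutation contributes a nonnegative term to `η ∧ (dη)^m`, and
the identity contributes a positive one (`sum_sign_mul_pos`).

For morphisms, Cartan's formula shows by induction on the degree that the exterior differential is
tensorial (`extDiff_congr`). The test sections of the target may thus be replaced by sections which
are related along the base map to those of the source on a whole neighbourhood, and for such
sections the two differentials agree term by term as soon as anchors and brackets are related
(`isMorphism_of_related`). Related brackets come from relatedness of vector fields in the tangent
component, and from the coordinate formula in the `E`-component.

The Legendrian conditions are then pointwise. Vectors of `TE*_q × ℝ` have no `E`-component and no
`s`-component, so `η` vanishes on them. On `F_γ` the value of `η` at the image of `a` is `d^E γ_s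
(a) - γ_0 (a)`, where `γ = (γ_0, γ_s)`; it vanishes exactly when `γ_0 = d^E γ_s`, and a function
whose jet is `γ` can only be `γ_s`. -/

lemma _root_.Filter.EventuallyEq.mvfderiv_eq {f g : M → G} {x : M} (h : f =ᶠ[𝓝 x] g) :
    mvfderiv IM f x = mvfderiv IM g x := by
  have := h.mfderiv_eq (I := IM) (I' := 𝓘(ℝ, G))
  ext v
  exact DFunLike.congr_fun this v

lemma mvfderiv_comp' {g : N → G} {f : M → N} {x : M}
    (hg : MDifferentiableAt IN 𝓘(ℝ, G) g (f x)) (hf : MDifferentiableAt IM IN f x)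
    (v : TangentSpace IM x) :
    mvfderiv IM (fun y => g (f y)) x v = mvfderiv IN g (f x) (mfderiv IM IN f x v) :=
  mfderiv_comp_apply x hg hf v

lemma mvfderiv_clm_comp (L : G →L[ℝ] G') {f : M → G} {x : M}
    (hf : MDifferentiableAt IM 𝓘(ℝ, G) f x) (v : TangentSpace IM x) :
    mvfderiv IM (fun y => L (f y)) x v = L (mvfderiv IM f x v) := by
  have h := mvfderiv_comp' (g := fun z => L z) (f := f) (L.mdifferentiableAt) hf v
  refine h.trans ?_
  change mfderiv 𝓘(ℝ, G) 𝓘(ℝ, G') L (f x) _ = _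
  rw [mfderiv_eq_fderiv, L.fderiv]
  rfl

/-- One product rule for all the pairings needed: scalar multiplication with `B = lsmul`, and
evaluation of operator-valued functions with `B` the identity. -/
lemma mvfderiv_bilin (B : G →L[ℝ] G' →L[ℝ] G'') {f : M → G} {g : M → G'} {x : M}
    (hf : MDifferentiableAt IM 𝓘(ℝ, G) f x) (hg : MDifferentiableAt IM 𝓘(ℝ, G') g x)
    (v : TangentSpace IM x) :
    mvfderiv IM (fun y => B (f y) (g y)) x v =
      B (mvfderiv IM f x v) (g x) + B (f x) (mvfderiv IM g x v) := by
  have hB := B.isBoundedBilinearMap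
  have h1 : MDifferentiableAt 𝓘(ℝ, G × G') 𝓘(ℝ, G'') (fun z : G × G' => B z.1 z.2)
      (f x, g x) := (hB.differentiableAt _).mdifferentiableAt
  have h2 := hf.prodMk_space hg
  have h := mvfderiv_comp' (g := fun z : G × G' => B z.1 z.2) (f := fun y => (f y, g y)) h1 h2 v
  refine h.trans ?_
  have h3 : mfderiv IM 𝓘(ℝ, G × G') (fun y => (f y, g y)) x =
      (mfderiv IM 𝓘(ℝ, G) f x).prod (mfderiv IM 𝓘(ℝ, G') g x) :=
    HasMFDerivAt.mfderiv ⟨hf.continuousAt.prodMk hg.continuousAt,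
      hf.hasMFDerivAt.2.prodMk hg.hasMFDerivAt.2⟩
  rw [h3]
  change mfderiv 𝓘(ℝ, G × G') 𝓘(ℝ, G'') (fun z : G × G' => B z.1 z.2) (f x, g x) _ = _
  rw [mfderiv_eq_fderiv, hB.fderiv]
  exact add_comm _ _

lemma _root_.MDifferentiableAt.fun_finsetSum {ι : Type*} {s : Finset ι} {f : ι → M → G} {x : M}
    (hf : ∀ i ∈ s, MDifferentiableAt IM 𝓘(ℝ, G) (f i) x) :
    MDifferentiableAt IM 𝓘(ℝ, G) (fun y => ∑ i ∈ s, f i y) x := by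
  classical
  induction s using Finset.induction_on with
  | empty => simpa using mdifferentiableAt_const
  | insert a s ha ih =>
    simp only [Finset.sum_insert ha]
    exact (hf a (Finset.mem_insert_self a s)).add
      (ih fun i hi => hf i (Finset.mem_insert_of_mem hi))

lemma mvfderiv_sum {ι : Type*} (s : Finset ι) {f : ι → M → G} {x : M}
    (hf : ∀ i ∈ s, MDifferentiableAt IM 𝓘(ℝ, G) (f i) x) (v : TangentSpace IM x) :
    mvfderiv IM (fun y => ∑ i ∈ s, f i y) x v = ∑ i ∈ s, mvfderiv IM (f i) x v := by
  classical
  induction s using Finset.induction_on with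
  | empty => simp [mvfderiv_const]
  | insert a s ha ih =>
    simp only [Finset.sum_insert ha]
    rw [← ih fun i hi => hf i (Finset.mem_insert_of_mem hi)]
    rw [mvfderiv_fun_add (hf a (Finset.mem_insert_self a s))]
    · rfl
    · exact MDifferentiableAt.fun_finsetSum fun i hi => hf i (Finset.mem_insert_of_mem hi)

/-- The image of a smooth vector field along `g` under the tangent map of a smooth map. -/
lemma ContMDiffAt.mfderiv_vectorField [IsManifold IM ∞ M] [IsManifold IN ∞ N]
    {EP : Type*} [NormedAddCommGroup EP] [NormedSpace ℝ EP]
    {HP : Type*} [TopologicalSpace HP] {IP : ModelWithCorners ℝ EP HP}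
    {P : Type*} [TopologicalSpace P] [ChartedSpace HP P]
    {f : M → N} {g : P → M} {X : ∀ p, TangentSpace IM (g p)} {p : P}
    (hf : ContMDiffAt IM IN ∞ f (g p))
    (hX : ContMDiffAt IP IM.tangent ∞ (fun p => (⟨g p, X p⟩ : TangentBundle IM M)) p) :
    ContMDiffAt IP IN.tangent ∞
      (fun p => (⟨f (g p), mfderiv IM IN f (g p) (X p)⟩ : TangentBundle IN N)) p := by
  have : IsManifold IM 1 M := IsManifold.of_le (n := ∞) (by simp)
  have : IsManifold IN 1 N := IsManifold.of_le (n := ∞) (by simp)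
  have hg : ContMDiffAt IP IM ∞ g p := (contMDiffAt_totalSpace.1 hX).1
  have h := (hf.mfderiv_const (m := ∞) (by simp)).comp p hg
  exact ContMDiffAt.clm_apply_of_inCoordinates (b₁ := g) (b₂ := f ∘ g)
    (ϕ := fun p => mfderiv IM IN f (g p)) h hX (hf.comp p hg)

lemma contMDiffAt_mvfderiv_apply [IsManifold IM ∞ M]
    {EP : Type*} [NormedAddCommGroup EP] [NormedSpace ℝ EP]
    {HP : Type*} [TopologicalSpace HP] {IP : ModelWithCorners ℝ EP HP}
    {P : Type*} [TopologicalSpace P] [ChartedSpace HP P]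
    {f : M → G} {g : P → M} {X : ∀ p, TangentSpace IM (g p)} {p : P}
    (hf : ContMDiffAt IM 𝓘(ℝ, G) ∞ f (g p))
    (hX : ContMDiffAt IP IM.tangent ∞ (fun p => (⟨g p, X p⟩ : TangentBundle IM M)) p) :
    ContMDiffAt IP 𝓘(ℝ, G) ∞ (fun p => mvfderiv IM f (g p) (X p)) p := by
  have h := ContMDiffAt.mfderiv_vectorField hf hX
  exact ((contMDiff_snd_tangentBundle_modelSpace G 𝓘(ℝ, G)).contMDiffAt).comp p h

/-- The bracket of vector fields is the commutator of derivations. -/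
theorem mvfderiv_mlieBracket [IM.Boundaryless] [CompleteSpace EM] [IsManifold IM ∞ M]
    {f : M → G} {X Y : ∀ x, TangentSpace IM x} {x : M}
    (hf : ContMDiffAt IM 𝓘(ℝ, G) ∞ f x)
    (hX : MDifferentiableAt IM IM.tangent (fun x => (⟨x, X x⟩ : TangentBundle IM M)) x)
    (hY : MDifferentiableAt IM IM.tangent (fun x => (⟨x, Y x⟩ : TangentBundle IM M)) x) :
    mvfderiv IM f x (VectorField.mlieBracket IM X Y x) =
      mvfderiv IM (fun y => mvfderiv IM f y (Y y)) x (X x) -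
        mvfderiv IM (fun y => mvfderiv IM f y (X y)) x (Y x) := by
  have : IsManifold IM 2 M := IsManifold.of_le (n := ∞) ENat.LEInfty.out
  have : IsManifold IM 1 M := IsManifold.of_le (n := ∞) (by simp)
  set φ := extChartAt IM x with hφ
  let pb : (∀ x, TangentSpace IM x) → EM → EM := fun Z =>
    VectorField.mpullbackWithin 𝓘(ℝ, EM) IM φ.symm Z (range IM)
  set g : EM → G := f ∘ φ.symm with hg
  have hxs : x ∈ φ.source := mem_extChartAt_source x
  have hgC : ContDiffAt ℝ ∞ g (φ x) := by
    have h1 : ContMDiffAt 𝓘(ℝ, EM) IM ∞ φ.symm (φ x) := by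
      have := contMDiffWithinAt_extChartAt_symm_range (n := ∞) (I := IM) x (mem_extChartAt_target x)
      rwa [IM.range_eq_univ, contMDiffWithinAt_univ] at this
    have h2 : ContMDiffAt IM 𝓘(ℝ, G) ∞ f (φ.symm (φ x)) := by rwa [φ.left_inv hxs]
    exact (h2.comp (φ x) h1).contDiffAt
  have hpb : ∀ {Z : ∀ x, TangentSpace IM x},
      MDifferentiableAt IM IM.tangent (fun x => (⟨x, Z x⟩ : TangentBundle IM M)) x →
      DifferentiableAt ℝ (pb Z) (φ x) := by
    intro Z hZ
    have h1 := MDifferentiableWithinAt.differentiableWithinAt_mpullbackWithin_vectorField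
      (s := univ) (V := Z) (mdifferentiableWithinAt_univ.2 hZ)
    rw [preimage_univ, univ_inter] at h1
    exact h1.differentiableAt (by rw [IM.range_eq_univ]; exact Filter.univ_mem)
  have hφd : ∀ y ∈ φ.source, MDifferentiableAt IM 𝓘(ℝ, EM) φ y := fun y hy =>
    mdifferentiableAt_extChartAt (by simpa [hφ] using hy)
  -- The function `Z f` read in the chart is the derivative of `g` along the field `pb Z`. This uses
  -- that `φ` and `φ.symm` have mutually inverse derivatives on the chart domain.
  have hloc : ∀ Z : ∀ x, TangentSpace IM x, (fun y => mvfderiv IM f y (Z y)) =ᶠ[𝓝 x]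
      (fun z => fderiv ℝ g z (pb Z z)) ∘ φ := by
    intro Z
    have e1 : ∀ᶠ z in 𝓝 (φ x), DifferentiableAt ℝ g z := by
      have := (hgC.of_le (m := 1) (by simp)).eventually (by simp)
      exact this.mono fun z hz => hz.differentiableAt (by simp)
    have e2 : ∀ᶠ y in 𝓝 x, DifferentiableAt ℝ g (φ y) :=
      (continuousAt_extChartAt (I := IM) x).eventually e1
    filter_upwards [e2, extChartAt_source_mem_nhds (I := IM) x] with y hy hys
    have e3 : f =ᶠ[𝓝 y] g ∘ φ := by
      filter_upwards [(isOpen_extChartAt_source (I := IM) x).mem_nhds hys] with w hw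
      simp [hg, φ.left_inv hw]
    rw [e3.mvfderiv_eq]
    refine (mvfderiv_comp' hy.mdifferentiableAt (hφd y hys) _).trans ?_
    change mfderiv 𝓘(ℝ, EM) 𝓘(ℝ, G) g (φ y) _ = _
    rw [mfderiv_eq_fderiv]
    simp only [Function.comp]
    congr 1
    simp only [pb, VectorField.mpullbackWithin_apply]
    have h1 := mfderivWithin_extChartAt_symm_comp_mfderiv_extChartAt' (I := IM) hys
    have h2 := mfderiv_extChartAt_comp_mfderivWithin_extChartAt_symm' (I := IM) hys
    have h3 := ContinuousLinearMap.inverse_eq h1 h2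
    rw [φ.left_inv hys] 
    rw [h3]
  have hD : ∀ (Z : ∀ x, TangentSpace IM x) (v : TangentSpace IM x), 
      MDifferentiableAt IM IM.tangent (fun x => (⟨x, Z x⟩ : TangentBundle IM M)) x →
      mvfderiv IM (fun y => mvfderiv IM f y (Z y)) x v =
        fderiv ℝ (fderiv ℝ g) (φ x) v (pb Z (φ x)) +
          fderiv ℝ g (φ x) (fderiv ℝ (pb Z) (φ x) v) := by
    intro Z v hZ
    have d1 : DifferentiableAt ℝ (fderiv ℝ g) (φ x) :=
      (hgC.fderiv_right (m := 1) (by norm_num; exact ENat.LEInfty.out)).differentiableAt (by simp)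
    rw [(hloc Z).mvfderiv_eq]
    refine (mvfderiv_comp' (d1.clm_apply (hpb hZ)).mdifferentiableAt (hφd x hxs) _).trans ?_
    change mfderiv 𝓘(ℝ, EM) 𝓘(ℝ, G) _ (φ x) _ = _
    rw [mfderiv_eq_fderiv, mfderiv_extChartAt_self, fderiv_clm_apply d1 (hpb hZ)]
    exact add_comm _ _
  have hpbx : ∀ Z : ∀ x, TangentSpace IM x, pb Z (φ x) = Z x := by
    intro Z
    simp only [pb, VectorField.mpullbackWithin_apply]
    have h1 := mfderivWithin_extChartAt_symm_comp_mfderiv_extChartAt' (I := IM) hxs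
    have h2 := mfderiv_extChartAt_comp_mfderivWithin_extChartAt_symm' (I := IM) hxs
    have h3 := ContinuousLinearMap.inverse_eq h1 h2
    rw [φ.left_inv hxs, h3, mfderiv_extChartAt_self]
    rfl
  rw [hD Y _ hY, hD X _ hX]
  have hb : VectorField.mlieBracket IM X Y x = VectorField.lieBracket ℝ (pb X) (pb Y) (φ x) := by
    rw [← VectorField.mlieBracketWithin_univ, VectorField.mlieBracketWithin_apply,
      mfderiv_extChartAt_self]
    have h1 : (univ : Set EM) = (extChartAt IM x).symm ⁻¹' univ ∩ range IM := by
      rw [IM.range_eq_univ, preimage_univ, univ_inter]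
    rw [← h1]
    refine (DFunLike.congr_fun ContinuousLinearMap.inverse_id _).trans ?_
    exact congr_fun (VectorField.lieBracketWithin_univ (𝕜 := ℝ) (V := pb X) (W := pb Y)) (φ x)
  have hfg : ∀ v : EM, mvfderiv IM f x v = fderiv ℝ g (φ x) v := by
    intro v
    have e3 : f =ᶠ[𝓝 x] g ∘ φ := by
      filter_upwards [extChartAt_source_mem_nhds (I := IM) x] with w hw
      simp [hg, φ.left_inv hw]
    rw [e3.mvfderiv_eq]
    refine (mvfderiv_comp' (hgC.differentiableAt (by simp)).mdifferentiableAt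
      (hφd x hxs) _).trans ?_
    change mfderiv 𝓘(ℝ, EM) 𝓘(ℝ, G) g (φ x) _ = _
    rw [mfderiv_eq_fderiv, mfderiv_extChartAt_self]
    rfl
  -- The second-derivative terms of `X(Yf)` and `Y(Xf)` agree by symmetry; what is left is `Dg`
  -- applied to the bracket in the chart.
  have hsym := (hgC.isSymmSndFDerivAt (by simpa using ENat.LEInfty.out)).eq
    (pb X (φ x)) (pb Y (φ x))
  rw [hb, hfg, VectorField.lieBracket_eq]
  simp only [hpbx] at hsym ⊢
  rw [map_sub, hsym]
  abel

end Calculus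

/-! ### Smooth bundles given by sections: cutoffs, extension, frames. -/

section SmoothBundle

variable {EM : Type*} [NormedAddCommGroup EM] [NormedSpace ℝ EM]
  {HM : Type*} [TopologicalSpace HM] {IM : ModelWithCorners ℝ EM HM}
  {M : Type*} [TopologicalSpace M] [ChartedSpace HM M]

lemma exists_contMDiff_cutoff [FiniteDimensional ℝ EM] [T2Space M] [IsManifold IM ∞ M]
    {x : M} {U : Set M} (hU : U ∈ 𝓝 x) :
    ∃ χ : M → ℝ, ContMDiff IM 𝓘(ℝ, ℝ) ∞ χ ∧ (∀ᶠ y in 𝓝 x, χ y = 1) ∧ tsupport χ ⊆ U := by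
  obtain ⟨f, -, hf⟩ := (SmoothBumpFunction.nhds_basis_tsupport (I := IM) x).mem_iff.1 hU
  exact ⟨f, f.contMDiff, f.eventuallyEq_one, hf⟩

variable {V : M → Type*} [∀ x, AddCommGroup (V x)] [∀ x, Module ℝ (V x)]

namespace AlgebroidData

variable {A : AlgebroidData IM V} {r : ℕ}

/-- A smooth bundle structure from local trivialisations with values in a fixed vector space. -/
lemma isSmoothBundle_of_coords {G : Type*} [NormedAddCommGroup G] [NormedSpace ℝ G]
    [FiniteDimensional ℝ G] (hr : Module.finrank ℝ G = r)
    (h : ∀ x₀ : M, ∃ U ∈ 𝓝 x₀, ∃ Φ : ∀ x, V x →ₗ[ℝ] G, ∀ x ∈ U, Function.Bijective (Φ x) ∧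
      ∀ σ : ∀ x, V x, A.smoothAt σ x ↔
        ContMDiffAt IM 𝓘(ℝ, G) ∞ (fun y => Φ y (σ y)) x) :
    A.IsSmoothBundle r := by
  classical
  intro x₀
  obtain ⟨U, hU, Φ, hΦ⟩ := h x₀
  let b : Module.Basis (Fin r) ℝ G := Module.finBasisOfFinrankEq ℝ G hr
  -- Frames are sections over all of `M`, so an inverse is chosen everywhere, with the value zero
  -- off `U`.
  have hinv : ∀ x, ∃ Ψ : G →ₗ[ℝ] V x, x ∈ U → (∀ g, Φ x (Ψ g) = g) ∧ ∀ v, Ψ (Φ x v) = v := by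
    intro x
    by_cases hx : x ∈ U
    · let L := LinearEquiv.ofBijective (Φ x) (hΦ x hx).1
      exact ⟨L.symm, fun _ => ⟨fun g => L.apply_symm_apply g, fun v => L.symm_apply_apply v⟩⟩
    · exact ⟨0, fun h => absurd h hx⟩
  choose Ψ hΨ using hinv
  refine ⟨interior U, interior_mem_nhds.2 hU, fun i x => Ψ x (b i), fun x hxi => ?_⟩
  have hx := interior_subset hxi
  let L : V x ≃ₗ[ℝ] G := LinearEquiv.ofBijective (Φ x) (hΦ x hx).1
  have hL : ∀ g, Ψ x g = L.symm g := fun g => by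
    rw [LinearEquiv.eq_symm_apply]; exact (hΨ x hx).1 g
  refine ⟨⟨?_, ?_⟩, fun σ => ?_⟩
  · have h1 := (b.map L.symm).linearIndependent
    convert h1 using 1
    ext i; simp [hL]
  · have h1 := (b.map L.symm).span_eq
    convert h1 using 3
    ext i; simp [hL]
  · rw [(hΦ x hx).2 σ]
    constructor
    · intro hs
      refine ⟨fun i y => b.repr (Φ y (σ y)) i, fun i => ?_, ?_⟩
      · let l : G →L[ℝ] ℝ := LinearMap.toContinuousLinearMap (b.coord i)
        exact (l.contMDiff.contMDiffAt).comp x hs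
      · filter_upwards [isOpen_interior.mem_nhds hxi] with y hy
        have hy := interior_subset hy
        have h2 := congrArg (Ψ y) (b.sum_repr (Φ y (σ y)))
        rw [map_sum, (hΨ y hy).2] at h2
        simpa only [map_smul] using h2.symm
    · rintro ⟨c, hc, hσ⟩
      have h1 : ContMDiffAt IM 𝓘(ℝ, G) ∞ (fun y => ∑ i, c i y • b i) x :=
        contMDiffAt_finsetSum fun i _ => (hc i).smul contMDiffAt_const
      refine h1.congr_of_eventuallyEq ?_
      filter_upwards [hσ, isOpen_interior.mem_nhds hxi] with y hy hyU
      simp [hy, (hΨ y (interior_subset hyU)).1]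

namespace IsSmoothBundle

variable (hA : A.IsSmoothBundle r)

include hA

lemma smoothAt_congr {σ τ : ∀ x, V x} {x : M} (h : ∀ᶠ y in 𝓝 x, σ y = τ y)
    (hσ : A.smoothAt σ x) : A.smoothAt τ x := by
  obtain ⟨U, hU, e, he⟩ := hA x
  have he := (he x (mem_of_mem_nhds hU)).2
  obtain ⟨c, hc, hs⟩ := (he σ).1 hσ
  refine (he τ).2 ⟨c, hc, ?_⟩
  filter_upwards [h, hs] with y h1 h2
  rw [← h1, h2]

lemma smoothAt_add {σ τ : ∀ x, V x} {x : M} (hσ : A.smoothAt σ x) (hτ : A.smoothAt τ x) :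
    A.smoothAt (fun x => σ x + τ x) x := by
  obtain ⟨U, hU, e, he⟩ := hA x
  have he := (he x (mem_of_mem_nhds hU)).2
  obtain ⟨c, hc, hs⟩ := (he σ).1 hσ
  obtain ⟨d, hd, ht⟩ := (he τ).1 hτ
  refine (he _).2 ⟨fun i y => c i y + d i y, fun i => (hc i).add (hd i), ?_⟩
  filter_upwards [hs, ht] with y h1 h2
  simp [h1, h2, add_smul, Finset.sum_add_distrib]

lemma smoothAt_smul {f : M → ℝ} {σ : ∀ x, V x} {x : M} (hf : ContMDiffAt IM 𝓘(ℝ, ℝ) ∞ f x)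
    (hσ : A.smoothAt σ x) : A.smoothAt (fun x => f x • σ x) x := by
  obtain ⟨U, hU, e, he⟩ := hA x
  have he := (he x (mem_of_mem_nhds hU)).2
  obtain ⟨c, hc, hs⟩ := (he σ).1 hσ
  refine (he _).2 ⟨fun i y => f y * c i y, fun i => hf.mul (hc i), ?_⟩
  filter_upwards [hs] with y h1
  simp [h1, Finset.smul_sum, mul_smul]

lemma smoothAt_zero (x : M) : A.smoothAt (fun _ => 0) x := by
  obtain ⟨U, hU, e, he⟩ := hA x
  have he := (he x (mem_of_mem_nhds hU)).2
  exact (he _).2 ⟨fun _ _ => 0, fun i => contMDiffAt_const, by simp⟩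

lemma isSmooth_add {σ τ : ∀ x, V x} (hσ : A.IsSmooth σ) (hτ : A.IsSmooth τ) :
    A.IsSmooth (σ + τ) := fun x => hA.smoothAt_add (hσ x) (hτ x)

lemma isSmooth_smul {f : M → ℝ} {σ : ∀ x, V x} (hf : ContMDiff IM 𝓘(ℝ, ℝ) ∞ f)
    (hσ : A.IsSmooth σ) : A.IsSmooth (fun x => f x • σ x) :=
  fun x => hA.smoothAt_smul (hf x) (hσ x)

lemma isSmooth_const_smul (c : ℝ) {σ : ∀ x, V x} (hσ : A.IsSmooth σ) :
    A.IsSmooth (c • σ) := hA.isSmooth_smul (f := fun _ => c) contMDiff_const hσ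

lemma isSmooth_sub {σ τ : ∀ x, V x} (hσ : A.IsSmooth σ) (hτ : A.IsSmooth τ) :
    A.IsSmooth (σ - τ) := by
  have h := hA.isSmooth_add hσ (hA.isSmooth_const_smul (-1) hτ)
  simpa [sub_eq_add_neg] using h

lemma isSmooth_sum {ι : Type*} (s : Finset ι) {σ : ι → ∀ x, V x} (h : ∀ i, A.IsSmooth (σ i)) :
    A.IsSmooth (∑ i ∈ s, σ i) := by
  classical
  induction s using Finset.induction_on with
  | empty => exact fun x => hA.smoothAt_zero x
  | insert a s ha ih =>
    rw [Finset.sum_insert ha]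
    exact hA.isSmooth_add (h a) ih

variable [FiniteDimensional ℝ EM] [T2Space M] [IsManifold IM ∞ M]

/-- A section which is smooth near `x` agrees near `x` with a globally smooth one. -/
lemma exists_isSmooth_eventuallyEq {σ : ∀ x, V x} {x : M} (h : ∀ᶠ y in 𝓝 x, A.smoothAt σ y) :
    ∃ τ : ∀ x, V x, A.IsSmooth τ ∧ ∀ᶠ y in 𝓝 x, τ y = σ y := by
  -- The eventual statement serves as a neighbourhood: the cutoff is supported in the set of points
  -- where `σ` is smooth.
  obtain ⟨χ, hχ, hχ1, hχs⟩ := exists_contMDiff_cutoff (IM := IM) h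
  refine ⟨fun y => χ y • σ y, fun y => ?_, ?_⟩
  · by_cases hy : y ∈ tsupport χ
    · exact hA.smoothAt_smul (hχ y) (hχs hy)
    · refine hA.smoothAt_congr ?_ (hA.smoothAt_zero y)
      filter_upwards [(isClosed_tsupport χ).isOpen_compl.mem_nhds hy] with z hz
      rw [image_eq_zero_of_notMem_tsupport hz, zero_smul]
  · filter_upwards [hχ1] with y hy
    rw [hy, one_smul]

/-- Local frames of global smooth sections. -/
lemma exists_frame (x : M) : ∃ e : Fin r → ∀ x, V x, (∀ i, A.IsSmooth (e i)) ∧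
    (∀ᶠ y in 𝓝 x, LinearIndependent ℝ (fun i => e i y) ∧
      Submodule.span ℝ (range fun i => e i y) = ⊤) ∧
    ∀ σ, A.IsSmooth σ → ∃ c : Fin r → M → ℝ, (∀ i, ContMDiff IM 𝓘(ℝ, ℝ) ∞ (c i)) ∧
      ∀ᶠ y in 𝓝 x, σ y = ∑ i, c i y • e i y := by
  obtain ⟨U, hU, e, he⟩ := hA x
  have hU' : interior U ∈ 𝓝 x := interior_mem_nhds.2 hU
  have hsm : ∀ i, ∀ᶠ y in 𝓝 x, A.smoothAt (e i) y := by
    intro i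
    filter_upwards [hU] with y hy
    refine ((he y hy).2 (e i)).2 ⟨fun j _ => if j = i then 1 else 0, fun _ => contMDiffAt_const, ?_⟩
    simp
  choose e' he' hee' using fun i => hA.exists_isSmooth_eventuallyEq (hsm i)
  have hall : ∀ᶠ y in 𝓝 x, ∀ i, e' i y = e i y := Filter.eventually_all.2 hee'
  refine ⟨e', he', ?_, fun σ hσ => ?_⟩
  · filter_upwards [hU, hall] with y hy h1
    simpa only [h1] using (he y hy).1
  · have hex : ∀ y, ∃ a : Fin r → ℝ, y ∈ U → σ y = ∑ i, a i • e i y := by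
      intro y
      by_cases hy : y ∈ U
      · have h1 : σ y ∈ Submodule.span ℝ (range fun i => e i y) := by
          rw [(he y hy).1.2]; trivial
        obtain ⟨a, ha⟩ := (Submodule.mem_span_range_iff_exists_fun ℝ).1 h1
        exact ⟨a, fun _ => ha.symm⟩
      · exact ⟨0, fun h => absurd h hy⟩
    choose a ha using hex
    -- The coefficients were chosen pointwise. Linear independence identifies them with the smooth
    -- ones that exist near each point.
    have has : ∀ y ∈ interior U, ∀ i, ContMDiffAt IM 𝓘(ℝ, ℝ) ∞ (fun z => a z i) y := by
      intro y hy i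
      obtain ⟨c, hc, hs⟩ := ((he y (interior_subset hy)).2 σ).1 (hσ y)
      refine (hc i).congr_of_eventuallyEq ?_
      filter_upwards [hs, isOpen_interior.mem_nhds hy] with z hz hzU
      have hzU := interior_subset hzU
      have h2 := ha z hzU
      rw [hz] at h2
      have h3 : ∑ i, (a z i - c i z) • e i z = 0 := by
        simp only [sub_smul, Finset.sum_sub_distrib, ← h2, sub_self]
      exact sub_eq_zero.1 (Fintype.linearIndependent_iff.1 (he z hzU).1.1 _ h3 i)
    obtain ⟨χ, hχ, hχ1, hχs⟩ := exists_contMDiff_cutoff (IM := IM) hU'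
    refine ⟨fun i y => χ y * a y i, fun i y => ?_, ?_⟩
    · by_cases hy : y ∈ tsupport χ
      · exact (hχ y).mul (has y (hχs hy) i)
      · refine (contMDiffAt_const (c := (0 : ℝ))).congr_of_eventuallyEq ?_
        filter_upwards [(isClosed_tsupport χ).isOpen_compl.mem_nhds hy] with z hz
        rw [image_eq_zero_of_notMem_tsupport hz, zero_mul]
    · filter_upwards [hχ1, hU, hall] with y h1 h2 h3
      simp only [h1, one_mul, h3]
      exact ha y h2

/-- Every vector is the value of a smooth section. -/
lemma exists_isSmooth_apply_eq (x : M) (v : V x) : ∃ σ, A.IsSmooth σ ∧ σ x = v := by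
  obtain ⟨e, he, hb, -⟩ := hA.exists_frame x
  have h1 : v ∈ Submodule.span ℝ (range fun i => e i x) := by
    rw [hb.self_of_nhds.2]; trivial
  obtain ⟨a, ha⟩ := (Submodule.mem_span_range_iff_exists_fun ℝ).1 h1
  exact ⟨∑ i, a i • e i, hA.isSmooth_sum _ fun i => hA.isSmooth_const_smul _ (he i),
    by simpa using ha⟩

end IsSmoothBundle

end AlgebroidData

end SmoothBundle

/-! ### Locality of the bracket, Cartan's formula, tensoriality of the exterior differential. -/

section LieAlgebroid

variable {EM : Type*} [NormedAddCommGroup EM] [NormedSpace ℝ EM] [FiniteDimensional ℝ EM]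
  {HM : Type*} [TopologicalSpace HM] {IM : ModelWithCorners ℝ EM HM}
  {M : Type*} [TopologicalSpace M] [ChartedSpace HM M] [T2Space M] [IsManifold IM ∞ M]
  {V : M → Type*} [∀ x, AddCommGroup (V x)] [∀ x, Module ℝ (V x)]

namespace AlgebroidData

variable {A : AlgebroidData IM V} {r : ℕ}

lemma deriv_eq (f : M → ℝ) (x : M) (v : V x) : A.deriv f x v = mvfderiv IM f x (A.anchor x v) :=
  rfl

lemma deriv_congr {f g : M → ℝ} {x : M} (h : ∀ᶠ y in 𝓝 x, f y = g y) (v : V x) :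
    A.deriv f x v = A.deriv g x v := by
  rw [deriv_eq, deriv_eq, Filter.EventuallyEq.mvfderiv_eq h]

lemma deriv_mul {f g : M → ℝ} {x : M} (hf : MDifferentiableAt IM 𝓘(ℝ, ℝ) f x)
    (hg : MDifferentiableAt IM 𝓘(ℝ, ℝ) g x) (v : V x) :
    A.deriv (fun y => f y * g y) x v = f x * A.deriv g x v + g x * A.deriv f x v := by
  simp only [deriv_eq, mvfderiv_fun_mul hf hg]
  rfl

lemma deriv_sum {ι : Type*} (s : Finset ι) {f : ι → M → ℝ} {x : M}
    (hf : ∀ i ∈ s, MDifferentiableAt IM 𝓘(ℝ, ℝ) (f i) x) (v : V x) :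
    A.deriv (fun y => ∑ i ∈ s, f i y) x v = ∑ i ∈ s, A.deriv (f i) x v :=
  mvfderiv_sum s hf _

namespace IsLieAlgebroid

variable (hA : A.IsLieAlgebroid r)

include hA

lemma bracket_sub {σ τ₁ τ₂ : ∀ x, V x} (hσ : A.IsSmooth σ) (h₁ : A.IsSmooth τ₁)
    (h₂ : A.IsSmooth τ₂) :
    A.bracket σ (τ₁ - τ₂) = A.bracket σ τ₁ - A.bracket σ τ₂ := by
  have h3 := hA.bracket_smul (-1) _ _ hσ h₂
  have h4 := hA.bracket_add _ _ _ hσ h₁ (hA.bundle.isSmooth_const_smul (-1) h₂)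
  rw [h3] at h4
  simpa [sub_eq_add_neg] using h4

lemma bracket_sum {ι : Type*} (s : Finset ι) {σ : ∀ x, V x} {τ : ι → ∀ x, V x}
    (hσ : A.IsSmooth σ) (hτ : ∀ i, A.IsSmooth (τ i)) :
    A.bracket σ (∑ i ∈ s, τ i) = ∑ i ∈ s, A.bracket σ (τ i) := by
  classical
  induction s using Finset.induction_on with
  | empty =>
    have h := hA.bracket_smul 0 σ 0 hσ (fun x => hA.bundle.smoothAt_zero x)
    simpa using h
  | insert a s ha ih =>
    rw [Finset.sum_insert ha, Finset.sum_insert ha, ← ih]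
    exact hA.bracket_add _ _ _ hσ (hτ a) (hA.bundle.isSmooth_sum s hτ)

/-- The difference `τ - τ'` is unchanged by multiplication with `1 - χ`, where `χ` is a cutoff equal
to `1` near `x`. In the Leibniz rule one term then has the factor `1 - χ x = 0`, and the other the
factor `(τ - τ') x = 0`. -/
lemma bracket_congr_right {σ τ τ' : ∀ x, V x} {x : M} (hσ : A.IsSmooth σ) (hτ : A.IsSmooth τ)
    (hτ' : A.IsSmooth τ') (h : ∀ᶠ y in 𝓝 x, τ y = τ' y) :
    A.bracket σ τ x = A.bracket σ τ' x := by
  obtain ⟨χ, hχ, hχ1, hχs⟩ := exists_contMDiff_cutoff (IM := IM) h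
  have hd := hA.bundle.isSmooth_sub hτ hτ'
  have h1 : (τ - τ') = fun y => (1 - χ y) • (τ - τ') y := by
    ext y
    by_cases hy : y ∈ tsupport χ
    · have h2 : τ y = τ' y := hχs hy
      simp [h2]
    · rw [image_eq_zero_of_notMem_tsupport hy, sub_zero, one_smul]
  have h2 := hA.leibniz (fun y => 1 - χ y) σ (τ - τ') (contMDiff_const.sub hχ) hσ hd
  rw [← h1, hA.bracket_sub hσ hτ hτ'] at h2
  have h3 := congr_fun h2 x
  have h4 : (τ - τ') x = 0 := by simp [h.self_of_nhds]
  rw [h4] at h3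
  simp only [hχ1.self_of_nhds, sub_self, zero_smul, smul_zero, add_zero] at h3
  exact sub_eq_zero.1 h3

lemma bracket_expansion {ι : Type*} [Fintype ι] {σ τ : ∀ x, V x} {e : ι → ∀ x, V x}
    {c : ι → M → ℝ} {x : M} (hσ : A.IsSmooth σ) (hτ : A.IsSmooth τ) (he : ∀ i, A.IsSmooth (e i))
    (hc : ∀ i, ContMDiff IM 𝓘(ℝ, ℝ) ∞ (c i)) (h : ∀ᶠ y in 𝓝 x, τ y = ∑ i, c i y • e i y) :
    A.bracket σ τ x = ∑ i, (c i x • A.bracket σ (e i) x + A.deriv (c i) x (σ x) • e i x) := by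
  have h1 : ∀ i, A.IsSmooth (fun y => c i y • e i y) := fun i =>
    hA.bundle.isSmooth_smul (hc i) (he i)
  have h2 := hA.bracket_congr_right (τ' := ∑ i, fun y => c i y • e i y) hσ hτ
    (hA.bundle.isSmooth_sum _ h1) (by simpa using h)
  rw [h2, hA.bracket_sum _ hσ h1, Finset.sum_apply]
  exact Finset.sum_congr rfl fun i _ => congr_fun (hA.leibniz _ _ _ (hc i) hσ (he i)) x

/-- The Lie derivative of a `1`-section is tensorial. -/
lemma deriv_sub_bracket_congr {α : ∀ x, V x →ₗ[ℝ] ℝ}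
    (hα : ∀ τ, A.IsSmooth τ → ContMDiff IM 𝓘(ℝ, ℝ) ∞ (fun y => α y (τ y)))
    {σ τ τ' : ∀ x, V x} {x : M} (hσ : A.IsSmooth σ) (hτ : A.IsSmooth τ) (hτ' : A.IsSmooth τ')
    (h : τ x = τ' x) :
    A.deriv (fun y => α y (τ y)) x (σ x) - α x (A.bracket σ τ x) =
      A.deriv (fun y => α y (τ' y)) x (σ x) - α x (A.bracket σ τ' x) := by
  obtain ⟨e, he, hb, hexp⟩ := hA.bundle.exists_frame x
  -- Both terms produce the derivative of `c i` times `α (e i)`, and these cancel. Only the values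
  -- of the coefficients at `x` remain.
  have key : ∀ (τ : ∀ x, V x) (c : Fin r → M → ℝ), A.IsSmooth τ →
      (∀ i, ContMDiff IM 𝓘(ℝ, ℝ) ∞ (c i)) →
      (∀ᶠ y in 𝓝 x, τ y = ∑ i, c i y • e i y) →
      A.deriv (fun y => α y (τ y)) x (σ x) - α x (A.bracket σ τ x) =
        ∑ i, c i x * (A.deriv (fun y => α y (e i y)) x (σ x) - α x (A.bracket σ (e i) x)) := by
    intro τ c hτ hc hτc
    have h1 : ∀ᶠ y in 𝓝 x, α y (τ y) = ∑ i, c i y * α y (e i y) := by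
      filter_upwards [hτc] with y hy
      simp [hy]
    have d1 : ∀ i, MDifferentiableAt IM 𝓘(ℝ, ℝ) (c i) x := fun i =>
      (hc i).mdifferentiable (by simp) x
    have d2 : ∀ i, MDifferentiableAt IM 𝓘(ℝ, ℝ) (fun y => α y (e i y)) x := fun i =>
      (hα _ (he i)).mdifferentiable (by simp) x
    rw [deriv_congr h1, deriv_sum _ (f := fun i y => c i y * α y (e i y))
      (fun i _ => (d1 i).mul (d2 i)),
      hA.bracket_expansion hσ hτ he hc hτc, map_sum, ← Finset.sum_sub_distrib]
    refine Finset.sum_congr rfl fun i _ => ?_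
    rw [deriv_mul (d1 i) (d2 i)]
    simp only [map_add, map_smul, smul_eq_mul]
    ring
  obtain ⟨c, hc, hτc⟩ := hexp τ hτ
  obtain ⟨c', hc', hτc'⟩ := hexp τ' hτ'
  rw [key τ c hτ hc hτc, key τ' c' hτ' hc' hτc']
  have h0 : ∀ i, c i x = c' i x := by
    intro i
    have h1 : ∑ i, (c i x - c' i x) • e i x = 0 := by
      simp only [sub_smul, Finset.sum_sub_distrib, ← hτc.self_of_nhds, ← hτc'.self_of_nhds, h,
        sub_self]
    exact sub_eq_zero.1 (Fintype.linearIndependent_iff.1 hb.self_of_nhds.1 _ h1 i)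
  simp only [h0]

end IsLieAlgebroid

/-- The contraction of a `(k+1)`-section with a section. -/
def contract {k : ℕ} (σ : ∀ x, V x) (μ : ∀ x, V x [⋀^Fin (k + 1)]→ₗ[ℝ] ℝ) (x : M) :
    V x [⋀^Fin k]→ₗ[ℝ] ℝ := (μ x).curryLeft (σ x)

lemma contract_apply {k : ℕ} (σ : ∀ x, V x) (μ : ∀ x, V x [⋀^Fin (k + 1)]→ₗ[ℝ] ℝ) (x : M)
    (v : Fin k → V x) : contract σ μ x v = μ x (Matrix.vecCons (σ x) v) := rfl

lemma IsSmoothForm.contract {k : ℕ} {σ : ∀ x, V x} {μ : ∀ x, V x [⋀^Fin (k + 1)]→ₗ[ℝ] ℝ}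
    (hμ : A.IsSmoothForm μ) (hσ : A.IsSmooth σ) :
    A.IsSmoothForm (contract σ μ) := by
  intro τ hτ
  have h := hμ (Fin.cons σ τ) (fun i => by refine Fin.cases ?_ ?_ i <;> simp [hσ, hτ])
  refine h.congr fun x => ?_
  rw [contract_apply]
  congr 1
  ext i
  refine Fin.cases ?_ ?_ i <;> simp

lemma extDiffBracketPart_congr {k : ℕ} {μ ν : ∀ x, V x [⋀^Fin k]→ₗ[ℝ] ℝ}
    (σ : Fin (k + 1) → ∀ x, V x) {x : M} (h : μ x = ν x) :
    A.extDiffBracketPart μ σ x = A.extDiffBracketPart ν σ x := by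
  cases k with
  | zero => rfl
  | succ k => simp only [extDiffBracketPart, h]

/-- Moving `w` from the front to slot `l` takes `l` adjacent transpositions. -/
lemma map_vecCons_succAbove {W : Type*} [AddCommGroup W] [Module ℝ W] {k : ℕ}
    (f : W [⋀^Fin (k + 1)]→ₗ[ℝ] ℝ) (v : Fin (k + 1) → W) (l : Fin (k + 1)) (w : W) :
    f (Matrix.vecCons w (fun t => v (l.succAbove t))) =
      (-1 : ℝ) ^ (l : ℕ) * f (Function.update v l w) := by
  have h := f.neg_one_pow_smul_map_insertNth l w (fun t => v (l.succAbove t))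
  rw [← h]
  have h2 : l.insertNth w (fun t => v (l.succAbove t)) = Function.update v l w := by
    ext i
    refine Fin.succAboveCases l ?_ ?_ i
    · simp
    · intro j; simp [Fin.succAbove_ne]
  rw [h2]
  simp

/-- The pairs `i < j` are split according to whether `i = 0`. For `(0, l + 1)` the sign of the pair
and the sign of moving the bracket to slot `l` multiply to `-1`. For the other pairs `σ 0` stands
just behind the bracket, and exchanging the two gives the contraction with a minus sign. -/
lemma extDiffBracketPart_succ {k : ℕ} (μ : ∀ x, V x [⋀^Fin (k + 1)]→ₗ[ℝ] ℝ)
    (σ : Fin (k + 2) → ∀ x, V x) (x : M) :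
    A.extDiffBracketPart μ σ x =
      -(∑ l : Fin (k + 1), μ x (Function.update (fun t => σ t.succ x) l
        (A.bracket (σ 0) (σ l.succ) x))) -
      A.extDiffBracketPart (contract (σ 0) μ) (fun t => σ t.succ) x := by
  rw [extDiffBracketPart, Fin.sum_univ_succ, sub_eq_add_neg]
  congr 1
  · rw [← Finset.sum_neg_distrib]
    refine Finset.sum_congr rfl fun l _ => ?_
    simp only [Fin.succAbove_zero, Fin.succ_pos, if_true, Fin.val_zero, Fin.val_succ, zero_add]
    rw [map_vecCons_succAbove (μ x) (fun t => σ t.succ x) l, ← mul_assoc, ← pow_add]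
    have : Odd ((l : ℕ) + 1 + l) := ⟨l, by ring⟩
    rw [this.neg_one_pow]
    ring
  · cases k with
    | zero => simp [extDiffBracketPart]
    | succ k =>
      rw [extDiffBracketPart, ← Finset.sum_neg_distrib]
      refine Finset.sum_congr rfl fun i _ => ?_
      rw [Fin.sum_univ_succ, ← Finset.sum_neg_distrib]
      simp only [Fin.succAbove_zero, Fin.succ_succAbove_zero, Fin.not_lt_zero, if_false, zero_add]
      refine Finset.sum_congr rfl fun l _ => ?_
      simp only [Fin.succ_succAbove_succ, Fin.succ_lt_succ_iff]
      split_ifs with h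
      · rw [contract_apply, Fin.val_succ, Fin.val_succ]
        have h2 : (-1 : ℝ) ^ ((i : ℕ) + 1 + ((i.succAbove l : ℕ) + 1)) =
            (-1 : ℝ) ^ ((i : ℕ) + (i.succAbove l : ℕ)) := by
          rw [show (i : ℕ) + 1 + ((i.succAbove l : ℕ) + 1) =
            (i : ℕ) + (i.succAbove l : ℕ) + 2 by ring,
            pow_add]
          simp
        rw [h2, ← mul_neg]
        congr 1
        set b := A.bracket (σ i.succ) (σ (i.succAbove l).succ) x
        have h3 := (μ x).map_swap
          (Matrix.vecCons (σ 0 x) (Matrix.vecCons b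
            (fun t => σ (i.succAbove (l.succAbove t)).succ x)))
          (show (0 : Fin (k + 2)) ≠ 1 by simp)
        rw [← h3]
        congr 1
        ext t
        refine Fin.cases ?_ (fun t => ?_) t
        · simp
        · refine Fin.cases ?_ (fun t => ?_) t
          · simp
          · have e1 : (Equiv.swap (0 : Fin (k + 2)) 1) t.succ.succ = t.succ.succ :=
              Equiv.swap_apply_of_ne_of_ne (by simp) (by simp [Fin.ext_iff])
            simp [e1]
      · simp

/-- Cartan's formula. -/
lemma extDiff_succ {k : ℕ} (μ : ∀ x, V x [⋀^Fin (k + 1)]→ₗ[ℝ] ℝ)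
    (σ : Fin (k + 2) → ∀ x, V x) (x : M) :
    A.extDiff μ σ x = A.deriv (fun y => μ y (fun t => σ t.succ y)) x (σ 0 x) -
      ∑ l : Fin (k + 1), μ x (Function.update (fun t => σ t.succ x) l
        (A.bracket (σ 0) (σ l.succ) x)) -
      A.extDiff (contract (σ 0) μ) (fun t => σ t.succ) x := by
  rw [extDiff, extDiff, extDiffBracketPart_succ, Fin.sum_univ_succ]
  simp only [Fin.succAbove_zero, Fin.val_zero, pow_zero, one_mul, Fin.val_succ]
  have h : ∀ i : Fin (k + 1), (fun y => μ y (fun t => σ (i.succ.succAbove t) y)) =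
      fun y => contract (σ 0) μ y (fun t => σ (i.succAbove t).succ y) := by
    intro i
    ext y
    rw [contract_apply]
    congr 1
    ext t
    refine Fin.cases ?_ (fun t => ?_) t <;> simp
  simp only [h, pow_succ, mul_neg, mul_one, neg_mul, Finset.sum_neg_distrib]
  ring

namespace IsLieAlgebroid

variable (hA : A.IsLieAlgebroid r)

include hA

/-- Induction on the degree through Cartan's formula, which separates slot `0` from the others. In
either case the terms which are not visibly pointwise combine into Lie derivatives of `1`-sections,
obtained from `μ` by freezing all slots but one. -/
lemma extDiff_update {k : ℕ} {μ : ∀ x, V x [⋀^Fin k]→ₗ[ℝ] ℝ} (hμ : A.IsSmoothForm μ)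
    {σ : Fin (k + 1) → ∀ x, V x} (hσ : ∀ i, A.IsSmooth (σ i)) {τ : ∀ x, V x} (hτ : A.IsSmooth τ)
    {x : M} (i : Fin (k + 1)) (h : τ x = σ i x) :
    A.extDiff μ (Function.update σ i τ) x = A.extDiff μ σ x := by
  induction k with
  | zero =>
    obtain rfl : i = 0 := Fin.ext (by omega)
    simp [extDiff, extDiffBracketPart, h]
  | succ k ih =>
    rw [extDiff_succ, extDiff_succ]
    refine Fin.cases (fun h => ?_) (fun i h => ?_) i h
    -- Change in slot `0`: each bracket term pairs with the derivative term of the contracted form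
    -- having the same index `l`. Their sum is a Lie derivative along `σ l.succ`, hence tensorial.
    · have hs : ∀ t : Fin (k + 1), Function.update σ 0 τ t.succ = σ t.succ := fun t => by simp
      simp only [hs, Function.update_self, h]
      rw [extDiff, extDiff, extDiffBracketPart_congr (μ := contract τ μ) (ν := contract (σ 0) μ) _
        (by rw [contract, contract, h]), sub_sub, sub_sub]
      congr 1
      rw [← add_assoc, ← add_assoc]
      congr 1
      rw [← Finset.sum_add_distrib, ← Finset.sum_add_distrib]
      refine Finset.sum_congr rfl fun l _ => ?_
      let α : ∀ y, V y →ₗ[ℝ] ℝ := fun y =>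
        { toFun := fun v => μ y (Matrix.vecCons v (fun t => σ (l.succAbove t).succ y))
          map_add' := fun v w => (μ y).map_vecCons_add _ v w
          map_smul' := fun c v => (μ y).map_vecCons_smul _ c v }
      have hα : ∀ τ, A.IsSmooth τ → ContMDiff IM 𝓘(ℝ, ℝ) ∞ (fun y => α y (τ y)) := fun τ hτ =>
        hμ.contract hτ (fun t => σ (l.succAbove t).succ) (fun t => hσ _)
      have h1 := hA.deriv_sub_bracket_congr hα (hσ l.succ) hτ (hσ 0) h
      have hsg : (-1 : ℝ) ^ (l : ℕ) * (-1 : ℝ) ^ (l : ℕ) = 1 := by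
        rw [← pow_add]; exact Even.neg_one_pow ⟨l, rfl⟩
      have h2 : ∀ w, μ x (Function.update (fun t => σ t.succ x) l w) =
          (-1 : ℝ) ^ (l : ℕ) * α x w := by
        intro w
        have := map_vecCons_succAbove (μ x) (fun t => σ t.succ x) l w
        change α x w = _ at this
        rw [this, ← mul_assoc, hsg, one_mul]
      rw [h2, h2, hA.bracket_antisymm _ _ hτ (hσ _), hA.bracket_antisymm _ _ (hσ 0) (hσ _),
        Pi.neg_apply, Pi.neg_apply, map_neg, map_neg, ← mul_add, ← mul_add]
      congr 1
      rw [neg_add_eq_sub, neg_add_eq_sub]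
      exact h1
    -- Change in a later slot: the contracted form is covered by induction. The rest is the Lie
    -- derivative along `σ 0`, in which only the summand of slot `i` involves more than the value of
    -- `τ` at `x`.
    · have h0 : Function.update σ i.succ τ 0 = σ 0 :=
        Function.update_of_ne (Fin.succ_ne_zero i).symm _ _
      have hs : (fun t : Fin (k + 1) => Function.update σ i.succ τ t.succ) =
          Function.update (fun t : Fin (k + 1) => σ t.succ) i τ := by
        ext t
        by_cases ht : t = i
        · subst ht; simp
        · simp [ht]
      have hs' : ∀ t : Fin (k + 1), Function.update σ i.succ τ t.succ =
          Function.update (fun t : Fin (k + 1) => σ t.succ) i τ t := fun t => congr_fun hs t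
      simp only [h0, hs']
      rw [show (fun t => Function.update (fun t : Fin (k + 1) => σ t.succ) i τ t) =
        Function.update (fun t : Fin (k + 1) => σ t.succ) i τ from rfl,
        ih (hμ.contract (hσ 0)) (fun t => hσ t.succ) i h]
      congr 1
      have hup : ∀ (w : ∀ x, V x) (y : M), (fun t => Function.update
          (fun t : Fin (k + 1) => σ t.succ) i w t y) =
          Function.update (fun t : Fin (k + 1) => σ t.succ y) i (w y) := by
        intro w y
        ext t
        by_cases ht : t = i
        · subst ht; simp
        · simp [ht]
      simp only [hup]
      rw [h, show Function.update (fun t : Fin (k + 1) => σ t.succ x) i (σ i.succ x) =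
        (fun t => σ t.succ x) from Function.update_eq_self i _]
      rw [← Finset.add_sum_erase _ _ (Finset.mem_univ i),
        ← Finset.add_sum_erase (a := i) Finset.univ (fun l => μ x (Function.update
          (fun t : Fin (k + 1) => σ t.succ x) l (A.bracket (σ 0) (σ l.succ) x)))
          (Finset.mem_univ i)]
      have he : ∀ l ∈ Finset.univ.erase i,
          A.bracket (σ 0) (Function.update (fun t : Fin (k + 1) => σ t.succ) i τ l) x =
            A.bracket (σ 0) (σ l.succ) x := by
        intro l hl
        rw [Function.update_of_ne (Finset.ne_of_mem_erase hl)]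
      rw [Finset.sum_congr rfl fun l hl => by rw [he l hl], ← sub_sub, ← sub_sub]
      congr 1
      let α : ∀ y, V y →ₗ[ℝ] ℝ := fun y =>
        (μ y).toMultilinearMap.toLinearMap (fun t => σ t.succ y) i
      have hα : ∀ τ, A.IsSmooth τ → ContMDiff IM 𝓘(ℝ, ℝ) ∞ (fun y => α y (τ y)) := by
        intro τ hτ
        have h1 := hμ (Function.update (fun t : Fin (k + 1) => σ t.succ) i τ) (by
          intro t
          by_cases ht : t = i
          · subst ht; simpa using hτ
          · simpa [ht] using hσ _)
        refine h1.congr fun y => ?_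
        rw [hup τ y]
        rfl
      have h1 := hA.deriv_sub_bracket_congr hα (hσ 0) hτ (hσ i.succ) h
      have h2 : (fun y => α y (σ i.succ y)) = fun y => μ y (fun t => σ t.succ y) := by
        ext y
        change μ y (Function.update _ _ _) = _
        rw [show Function.update (fun t : Fin (k + 1) => σ t.succ y) i (σ i.succ y) =
          (fun t => σ t.succ y) from Function.update_eq_self i _]
      rw [h2] at h1
      simpa [α] using h1

/-- The exterior differential of a smooth form is tensorial. -/
theorem extDiff_congr {k : ℕ} {μ : ∀ x, V x [⋀^Fin k]→ₗ[ℝ] ℝ} (hμ : A.IsSmoothForm μ)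
    {σ τ : Fin (k + 1) → ∀ x, V x} (hσ : ∀ i, A.IsSmooth (σ i)) (hτ : ∀ i, A.IsSmooth (τ i))
    {x : M} (h : ∀ i, σ i x = τ i x) : A.extDiff μ σ x = A.extDiff μ τ x := by
  classical
  have key : ∀ s : Finset (Fin (k + 1)),
      A.extDiff μ (s.piecewise σ τ) x = A.extDiff μ τ x := by
    intro s
    induction s using Finset.induction_on with
    | empty => simp
    | insert a s ha ih =>
      rw [Finset.piecewise_insert, ← ih]
      refine hA.extDiff_update hμ (fun i => ?_) (hσ a) a ?_
      · by_cases hi : i ∈ s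
        · simpa [hi] using hσ i
        · simpa [hi] using hτ i
      · simp [ha, h]
  simpa using key Finset.univ

end IsLieAlgebroid

end AlgebroidData

end LieAlgebroid

/-! ### Vector fields as derivations, and brackets of related fields. -/

section VectorFields

variable {EM : Type*} [NormedAddCommGroup EM] [NormedSpace ℝ EM]
  {HM : Type*} [TopologicalSpace HM] {IM : ModelWithCorners ℝ EM HM}
  {M : Type*} [TopologicalSpace M] [ChartedSpace HM M] [IsManifold IM ∞ M]
  {EN : Type*} [NormedAddCommGroup EN] [NormedSpace ℝ EN]
  {HN : Type*} [TopologicalSpace HN] {IN : ModelWithCorners ℝ EN HN}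
  {N : Type*} [TopologicalSpace N] [ChartedSpace HN N] [IsManifold IN ∞ N]

lemma mvfderiv_extChartAt_self (x : M) (v : TangentSpace IM x) :
    mvfderiv IM (extChartAt IM x) x v = v := by
  have : IsManifold IM 1 M := IsManifold.of_le (n := ∞) (by simp)
  exact DFunLike.congr_fun (mfderiv_extChartAt_self (I := IM) (x := x)) v

lemma eventually_mdifferentiableAt {f : M → N} {x : M} (hf : ContMDiffAt IM IN ∞ f x) :
    ∀ᶠ y in 𝓝 x, MDifferentiableAt IM IN f y := by
  have : IsManifold IM 1 M := IsManifold.of_le (n := ∞) (by simp)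
  have : IsManifold IN 1 N := IsManifold.of_le (n := ∞) (by simp)
  have h := (contMDiffAt_iff_contMDiffAt_nhds (n := 1) (by simp)).1 (hf.of_le (by simp))
  exact h.mono fun y hy => hy.mdifferentiableAt (by simp)

/-- Tangent vectors are determined by their action on global smooth functions. -/
lemma eq_of_forall_mvfderiv_eq [FiniteDimensional ℝ EM] [T2Space M] {x : M}
    {v w : TangentSpace IM x}
    (h : ∀ f : M → ℝ, ContMDiff IM 𝓘(ℝ, ℝ) ∞ f → mvfderiv IM f x v = mvfderiv IM f x w) :
    v = w := by
  -- The test functions are linear functionals of the chart, cut off so as to be globally smooth.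
  obtain ⟨χ, hχ, hχ1, hχs⟩ :=
    exists_contMDiff_cutoff (IM := IM) (extChartAt_source_mem_nhds (I := IM) x)
  have hsm : ContMDiff IM 𝓘(ℝ, EM) ∞ (fun y => χ y • extChartAt IM x y) := by
    intro y
    by_cases hy : y ∈ tsupport χ
    · refine (hχ y).smul (contMDiffAt_extChartAt' ?_)
      have := hχs hy
      rwa [extChartAt_source] at this
    · refine (contMDiffAt_const (c := (0 : EM))).congr_of_eventuallyEq ?_
      filter_upwards [(isClosed_tsupport χ).isOpen_compl.mem_nhds hy] with z hz
      rw [image_eq_zero_of_notMem_tsupport hz, zero_smul]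
  have hloc : (fun y => χ y • extChartAt IM x y) =ᶠ[𝓝 x] extChartAt IM x := by
    filter_upwards [hχ1] with y hy
    rw [hy, one_smul]
  suffices h0 : mvfderiv IM (fun y => χ y • extChartAt IM x y) x v =
      mvfderiv IM (fun y => χ y • extChartAt IM x y) x w by
    rwa [hloc.mvfderiv_eq, mvfderiv_extChartAt_self, mvfderiv_extChartAt_self] at h0
  refine sub_eq_zero.1 ((Module.forall_dual_apply_eq_zero_iff ℝ (_ - _ : EM)).1 fun l => ?_)
  have hd := hsm.mdifferentiable (by simp) x
  have h1 := h _ ((LinearMap.toContinuousLinearMap l).contMDiff.comp hsm)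
  have h2 := fun u => mvfderiv_clm_comp (LinearMap.toContinuousLinearMap l) hd u
  rw [map_sub, sub_eq_zero]
  exact (h2 v).symm.trans (h1.trans (h2 w))

/-- Brackets of related vector fields are related. -/
theorem mlieBracket_of_related [IM.Boundaryless] [CompleteSpace EM] [IN.Boundaryless]
    [CompleteSpace EN] {g : N → M} {b : N} (hg : ContMDiffAt IN IM ∞ g b)
    {X Y : ∀ x, TangentSpace IM x} {v w : ∀ y, TangentSpace IN y}
    (hX : ContMDiffAt IM IM.tangent ∞ (fun x => (⟨x, X x⟩ : TangentBundle IM M)) (g b))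
    (hY : ContMDiffAt IM IM.tangent ∞ (fun x => (⟨x, Y x⟩ : TangentBundle IM M)) (g b))
    (hv : MDifferentiableAt IN IN.tangent (fun x => (⟨x, v x⟩ : TangentBundle IN N)) b)
    (hw : MDifferentiableAt IN IN.tangent (fun x => (⟨x, w x⟩ : TangentBundle IN N)) b)
    (hXv : ∀ᶠ y in 𝓝 b, X (g y) = mfderiv IN IM g y (v y))
    (hYw : ∀ᶠ y in 𝓝 b, Y (g y) = mfderiv IN IM g y (w y)) :
    VectorField.mlieBracket IM X Y (g b) =
      mfderiv IN IM g b (VectorField.mlieBracket IN v w b) := by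
  -- Both sides are tested on the vector-valued chart at `g b`, whose derivative at that point is
  -- the identity. Both brackets then become commutators of derivations, matched by the chain rule.
  set f : M → EM := fun x => extChartAt IM (g b) x with hfdef
  have hf : ContMDiffAt IM 𝓘(ℝ, EM) ∞ f (g b) := contMDiffAt_extChartAt
  have hgd := hg.mdifferentiableAt (by simp)
  have hfd := hf.mdifferentiableAt (by simp)
  have hrel : ∀ {Z : ∀ x, TangentSpace IM x} {u : ∀ y, TangentSpace IN y},
      (∀ᶠ y in 𝓝 b, Z (g y) = mfderiv IN IM g y (u y)) →
      (fun y => mvfderiv IN (fun y => f (g y)) y (u y)) =ᶠ[𝓝 b]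
        fun y => (fun x => mvfderiv IM f x (Z x)) (g y) := by
    intro Z u h
    filter_upwards [h, eventually_mdifferentiableAt hg,
      hg.continuousAt.eventually (eventually_mdifferentiableAt hf)] with y h1 h2 h3
    rw [mvfderiv_comp' h3 h2, h1]
  have hsm : ∀ {Z : ∀ x, TangentSpace IM x},
      ContMDiffAt IM IM.tangent ∞ (fun x => (⟨x, Z x⟩ : TangentBundle IM M)) (g b) →
      MDifferentiableAt IM 𝓘(ℝ, EM) (fun x => mvfderiv IM f x (Z x)) (g b) := fun hZ =>
    (contMDiffAt_mvfderiv_apply (g := fun x => x) hf hZ).mdifferentiableAt (by simp)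
  have h1 := mvfderiv_mlieBracket hf (hX.mdifferentiableAt (by simp))
    (hY.mdifferentiableAt (by simp))
  have h2 := mvfderiv_mlieBracket (hf.comp b hg) hv hw
  simp only [Function.comp_def] at h2
  rw [(hrel hXv).mvfderiv_eq, (hrel hYw).mvfderiv_eq, mvfderiv_comp' hfd hgd,
    mvfderiv_comp' (hsm hX) hgd, mvfderiv_comp' (hsm hY) hgd, ← hXv.self_of_nhds,
    ← hYw.self_of_nhds, ← h1, mvfderiv_extChartAt_self, mvfderiv_extChartAt_self] at h2
  exact h2.symm

end VectorFields

/-! ### The anchor preserves brackets. -/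

section AnchorBracket

variable {EM : Type*} [NormedAddCommGroup EM] [NormedSpace ℝ EM] [FiniteDimensional ℝ EM]
  {HM : Type*} [TopologicalSpace HM] {IM : ModelWithCorners ℝ EM HM} [IM.Boundaryless]
  {M : Type*} [TopologicalSpace M] [ChartedSpace HM M] [T2Space M] [IsManifold IM ∞ M]
  {V : M → Type*} [∀ x, AddCommGroup (V x)] [∀ x, Module ℝ (V x)]

namespace AlgebroidData.IsLieAlgebroid

variable {A : AlgebroidData IM V} {r : ℕ} (hA : A.IsLieAlgebroid r)

include hA

lemma contMDiff_deriv {f : M → ℝ} (hf : ContMDiff IM 𝓘(ℝ, ℝ) ∞ f) {σ : ∀ x, V x}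
    (hσ : A.IsSmooth σ) : ContMDiff IM 𝓘(ℝ, ℝ) ∞ (fun y => A.deriv f y (σ y)) := fun y =>
  contMDiffAt_mvfderiv_apply (g := fun x => x) (hf y) (hA.anchor_smooth σ hσ y)

/-- Expand the Jacobi identity of `σ, τ, fυ` by Leibniz and subtract `f` times that of `σ, τ, υ`.
The terms with a single derivative of `f` along `σ` or `τ` cancel, and the coefficient of `υ` is the
anchor identity applied to `f`. -/
lemma deriv_bracket_smul {f : M → ℝ} (hf : ContMDiff IM 𝓘(ℝ, ℝ) ∞ f) {σ τ υ : ∀ x, V x}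
    (hσ : A.IsSmooth σ) (hτ : A.IsSmooth τ) (hυ : A.IsSmooth υ) (x : M) :
    A.deriv f x (A.bracket σ τ x) • υ x =
      (A.deriv (fun y => A.deriv f y (τ y)) x (σ x) -
        A.deriv (fun y => A.deriv f y (σ y)) x (τ x)) • υ x := by
  have hB := hA.bundle
  have hfυ := hB.isSmooth_smul hf hυ
  have hf' : ∀ {σ}, A.IsSmooth σ → _ := fun hσ => hA.contMDiff_deriv hf hσ
  have key : ∀ {σ τ : ∀ x, V x}, A.IsSmooth σ → A.IsSmooth τ →
      A.bracket σ (A.bracket τ (fun x => f x • υ x)) x =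
        f x • A.bracket σ (A.bracket τ υ) x + A.deriv f x (σ x) • A.bracket τ υ x +
        (A.deriv f x (τ x) • A.bracket σ υ x +
          A.deriv (fun y => A.deriv f y (τ y)) x (σ x) • υ x) := by
    intro σ τ hσ hτ
    have hb := hA.bracket_smooth _ _ hτ hυ
    have h1 : A.bracket τ (fun x => f x • υ x) = (fun x => f x • A.bracket τ υ x) +
        fun x => A.deriv f x (τ x) • υ x := hA.leibniz f τ υ hf hτ hυ
    rw [h1, hA.bracket_add _ _ _ hσ (hB.isSmooth_smul hf hb) (hB.isSmooth_smul (hf' hτ) hυ),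
      hA.leibniz f σ _ hf hσ hb, hA.leibniz _ σ υ (hf' hτ) hσ hυ]
    rfl
  have hJ := congr_fun (hA.jacobi σ τ _ hσ hτ hfυ) x
  have hJ' := congr_fun (hA.jacobi σ τ υ hσ hτ hυ) x
  have hbn : ∀ {σ τ : ∀ x, V x}, A.IsSmooth σ → A.IsSmooth τ → 
      A.bracket σ (-τ) = -A.bracket σ τ := by
    intro σ τ hσ hτ
    simpa using hA.bracket_smul (-1) σ τ hσ hτ
  have hb := hA.bracket_smooth _ _ hσ hτ
  simp only [Pi.add_apply, Pi.zero_apply] at hJ hJ'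
  rw [hA.bracket_antisymm _ σ hfυ hσ, hbn hτ (hA.bracket_smooth _ _ hσ hfυ), Pi.neg_apply,
    hA.bracket_antisymm _ _ hfυ hb, Pi.neg_apply, key hσ hτ, key hτ hσ, hA.leibniz f _ υ hf hb hυ]
    at hJ
  rw [hA.bracket_antisymm _ σ hυ hσ, hbn hτ (hA.bracket_smooth _ _ hσ hυ), Pi.neg_apply,
    hA.bracket_antisymm _ _ hυ hb, Pi.neg_apply] at hJ'
  have h0 : f x • (A.bracket σ (A.bracket τ υ) x + -A.bracket τ (A.bracket σ υ) x +
    -A.bracket (A.bracket σ τ) υ x) = 0 := by rw [hJ', smul_zero]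
  simp only [smul_add, smul_neg] at h0
  beta_reduce at hJ
  linear_combination (norm := module) h0 - hJ

/-- The anchor of a Lie algebroid is a morphism of Lie algebras. -/
theorem anchor_bracket {σ τ : ∀ x, V x} (hσ : A.IsSmooth σ) (hτ : A.IsSmooth τ) (x : M) :
    A.anchor x (A.bracket σ τ x) =
      VectorField.mlieBracket IM (fun x => A.anchor x (σ x)) (fun x => A.anchor x (τ x)) x := by
  obtain ⟨e, he, hb, hexp⟩ := hA.bundle.exists_frame x
  -- Comparing coefficients needs a section which is nonzero at `x`. In rank zero there is none, but
  -- then all sections vanish and so do both sides.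
  rcases Nat.eq_zero_or_pos r with rfl | hr
  · have h0 : ∀ y (v : V y), v = 0 := by
      intro y v
      obtain ⟨e', -, hb', -⟩ := hA.bundle.exists_frame y
      have h1 : v ∈ Submodule.span ℝ (range fun i => e' i y) := by
        rw [hb'.self_of_nhds.2]; trivial
      simpa using h1
    have h1 : (fun x => A.anchor x (σ x)) = 0 := by
      ext y
      rw [h0 y (σ y), map_zero]
      rfl
    rw [h1, h0 x (A.bracket σ τ x), map_zero, VectorField.mlieBracket_zero_left]
    rfl
  · refine eq_of_forall_mvfderiv_eq fun f hf => ?_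
    have h1 := hA.deriv_bracket_smul hf hσ hτ (he ⟨0, hr⟩) x
    have h2 : e ⟨0, hr⟩ x ≠ 0 := hb.self_of_nhds.1.ne_zero ⟨0, hr⟩
    have h3 := smul_left_injective ℝ h2 h1
    rw [mvfderiv_mlieBracket (hf x) ((hA.anchor_smooth σ hσ).mdifferentiable (by simp) x)
      ((hA.anchor_smooth τ hτ).mdifferentiable (by simp) x)]
    exact h3

end AlgebroidData.IsLieAlgebroid

end AnchorBracket

/-! ### Local structure functions of a Lie algebroid. -/

section LocalForm

variable {EB : Type*} [NormedAddCommGroup EB] [NormedSpace ℝ EB]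
  {Q : Type*} [TopologicalSpace Q] [ChartedSpace EB Q] [IsManifold 𝓘(ℝ, EB) ∞ Q]
  {F : Type*} [NormedAddCommGroup F] [NormedSpace ℝ F]
  {E : Q → Type*} [TopologicalSpace (TotalSpace F E)]
  [∀ q, AddCommGroup (E q)] [∀ q, Module ℝ (E q)] [∀ q, TopologicalSpace (E q)]
  [FiberBundle F E] [VectorBundle ℝ F E]

variable (F E) in
/-- The linear coordinates on the fibre `E q` given by the preferred trivialisation at `q₀`. -/
def coord (q₀ q : Q) : E q →ₗ[ℝ] F := (trivializationAt F E q₀).linearMapAt ℝ q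

lemma coord_apply {q₀ q : Q} (hq : q ∈ (trivializationAt F E q₀).baseSet) (a : E q) :
    coord F E q₀ q a = (trivializationAt F E q₀ ⟨q, a⟩).2 :=
  congr_fun ((trivializationAt F E q₀).coe_linearMapAt_of_mem hq) a

lemma coord_bijective {q₀ q : Q} (hq : q ∈ (trivializationAt F E q₀).baseSet) :
    Function.Bijective (coord F E q₀ q) := by
  have h := (trivializationAt F E q₀).linearMapAt_def_of_mem (R := ℝ) hq
  rw [coord, h]
  exact LinearEquiv.bijective _

variable {EN : Type*} [NormedAddCommGroup EN] [NormedSpace ℝ EN]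
  {HN : Type*} [TopologicalSpace HN] {IN : ModelWithCorners ℝ EN HN}
  {N : Type*} [TopologicalSpace N] [ChartedSpace HN N]

lemma eventually_mem_baseSet {f : N → Q} {x : N} {q₀ : Q} (hf : ContinuousAt f x)
    (hx : f x ∈ (trivializationAt F E q₀).baseSet) :
    ∀ᶠ y in 𝓝 x, f y ∈ (trivializationAt F E q₀).baseSet :=
  hf.eventually ((trivializationAt F E q₀).open_baseSet.mem_nhds hx)

lemma contMDiffAt_iff_coord [ContMDiffVectorBundle ∞ F E 𝓘(ℝ, EB)] {f : N → Q}
    {s : ∀ x, E (f x)} {x : N} {q₀ : Q} (hf : ContMDiffAt IN 𝓘(ℝ, EB) ∞ f x)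
    (hx : f x ∈ (trivializationAt F E q₀).baseSet) :
    ContMDiffAt IN (𝓘(ℝ, EB).prod 𝓘(ℝ, F)) ∞ (fun x => (⟨f x, s x⟩ : TotalSpace F E)) x ↔
      ContMDiffAt IN 𝓘(ℝ, F) ∞ (fun x => coord F E q₀ (f x) (s x)) x := by
  rw [(trivializationAt F E q₀).contMDiffAt_iff
    ((trivializationAt F E q₀).mem_source.2 hx)]
  refine (and_iff_right hf).trans (Filter.EventuallyEq.contMDiffAt_iff ?_)
  filter_upwards [eventually_mem_baseSet hf.continuousAt hx] with y hy
  exact (coord_apply hy _).symm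

lemma contMDiffAt_smulRight {G G' : Type*} [NormedAddCommGroup G] [NormedSpace ℝ G]
    [NormedAddCommGroup G'] [NormedSpace ℝ G'] (L : G →L[ℝ] ℝ) {f : N → G'} {x : N}
    (hf : ContMDiffAt IN 𝓘(ℝ, G') ∞ f x) :
    ContMDiffAt IN 𝓘(ℝ, G →L[ℝ] G') ∞ (fun x => L.smulRight (f x)) x :=
  (ContinuousLinearMap.smulRightL ℝ G G' L).contMDiff.contMDiffAt.comp x hf

variable [FiniteDimensional ℝ EB] [T2Space Q] [FiniteDimensional ℝ F]
  [ContMDiffVectorBundle ∞ F E 𝓘(ℝ, EB)]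
  (ρ : ∀ q, E q →L[ℝ] TangentSpace 𝓘(ℝ, EB) q)
  (br : (∀ q, E q) → (∀ q, E q) → ∀ q, E q)

/-- The local form of a Lie algebroid in the coordinates at `q₀`: the anchor is `R` and the
bracket of constant sections is `C`. -/
structure IsLocalForm (q₀ : Q) (O : Set Q) (R : Q → F →L[ℝ] EB) (C : Q → F →L[ℝ] F →L[ℝ] F) :
    Prop where
  isOpen : IsOpen O
  subset_baseSet : O ⊆ (trivializationAt F E q₀).baseSet
  subset_source : O ⊆ (extChartAt 𝓘(ℝ, EB) q₀).source
  smooth_R : ∀ q ∈ O, ContMDiffAt 𝓘(ℝ, EB) 𝓘(ℝ, F →L[ℝ] EB) ∞ R q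
  smooth_C : ∀ q ∈ O, ContMDiffAt 𝓘(ℝ, EB) 𝓘(ℝ, F →L[ℝ] F →L[ℝ] F) ∞ C q
  anchor : ∀ q ∈ O, ∀ a : E q,
    R q (coord F E q₀ q a) = mvfderiv 𝓘(ℝ, EB) (extChartAt 𝓘(ℝ, EB) q₀) q (ρ q a)
  bracket : ∀ q ∈ O, ∀ σ τ : ∀ q, E q, (ofBundle F ρ br).IsSmooth σ →
    (ofBundle F ρ br).IsSmooth τ →
    coord F E q₀ q (br σ τ q) =
      mvfderiv 𝓘(ℝ, EB) (fun q => coord F E q₀ q (τ q)) q (ρ q (σ q)) -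
      mvfderiv 𝓘(ℝ, EB) (fun q => coord F E q₀ q (σ q)) q (ρ q (τ q)) +
      C q (coord F E q₀ q (σ q)) (coord F E q₀ q (τ q))
  antisymm : ∀ q ∈ O, ∀ a b, C q a b = -C q b a
  anchor_bracket : ∀ q ∈ O, ∀ a b : E q,
    R q (C q (coord F E q₀ q a) (coord F E q₀ q b)) =
      mvfderiv 𝓘(ℝ, EB) R q (ρ q a) (coord F E q₀ q b) -
      mvfderiv 𝓘(ℝ, EB) R q (ρ q b) (coord F E q₀ q a)
  jacobi : ∀ q ∈ O, ∀ a b c : E q,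
    (mvfderiv 𝓘(ℝ, EB) C q (ρ q a) (coord F E q₀ q b) (coord F E q₀ q c) +
      C q (coord F E q₀ q a) (C q (coord F E q₀ q b) (coord F E q₀ q c))) +
    (mvfderiv 𝓘(ℝ, EB) C q (ρ q b) (coord F E q₀ q c) (coord F E q₀ q a) +
      C q (coord F E q₀ q b) (C q (coord F E q₀ q c) (coord F E q₀ q a))) +
    (mvfderiv 𝓘(ℝ, EB) C q (ρ q c) (coord F E q₀ q a) (coord F E q₀ q b) +
      C q (coord F E q₀ q c) (C q (coord F E q₀ q a) (coord F E q₀ q b))) = 0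

variable {ρ br} {m : ℕ} (hE : (ofBundle F ρ br).IsLieAlgebroid m)

lemma contMDiffAt_coord {σ : ∀ q, E q} (hσ : (ofBundle F ρ br).IsSmooth σ) {q₀ q : Q}
    (hq : q ∈ (trivializationAt F E q₀).baseSet) :
    ContMDiffAt 𝓘(ℝ, EB) 𝓘(ℝ, F) ∞ (fun q => coord F E q₀ q (σ q)) q :=
  (contMDiffAt_iff_coord (f := fun q => q) contMDiffAt_id hq).1 (hσ q)

include hE

/-- Derivative of the coordinates minus the coordinates of the bracket is tensorial in the second
section. -/
lemma coord_bracket_congr {σ τ τ' : ∀ q, E q} (hσ : (ofBundle F ρ br).IsSmooth σ)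
    (hτ : (ofBundle F ρ br).IsSmooth τ) (hτ' : (ofBundle F ρ br).IsSmooth τ') {q₀ q : Q}
    (hq : q ∈ (trivializationAt F E q₀).baseSet) (h : τ q = τ' q) :
    mvfderiv 𝓘(ℝ, EB) (fun q => coord F E q₀ q (τ q)) q (ρ q (σ q)) -
      coord F E q₀ q (br σ τ q) =
    mvfderiv 𝓘(ℝ, EB) (fun q => coord F E q₀ q (τ' q)) q (ρ q (σ q)) -
      coord F E q₀ q (br σ τ' q) := by
  refine sub_eq_zero.1 ((Module.forall_dual_apply_eq_zero_iff ℝ _).1 fun l => ?_)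
  let l' : F →L[ℝ] ℝ := LinearMap.toContinuousLinearMap l
  obtain ⟨χ, hχ, hχ1, hχs⟩ := exists_contMDiff_cutoff (IM := 𝓘(ℝ, EB))
    ((trivializationAt F E q₀).open_baseSet.mem_nhds hq)
  -- A linear functional of the coordinates is a `1`-section only over the base set. The cutoff
  -- makes it global without changing it near `q`.
  let α : ∀ y, E y →ₗ[ℝ] ℝ := fun y => χ y • (l ∘ₗ coord F E q₀ y)
  have hα : ∀ τ, (ofBundle F ρ br).IsSmooth τ →
      ContMDiff 𝓘(ℝ, EB) 𝓘(ℝ, ℝ) ∞ (fun y => α y (τ y)) := by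
    intro τ hτ y
    by_cases hy : y ∈ tsupport χ
    · exact (hχ y).smul (l'.contMDiff.contMDiffAt.comp y (contMDiffAt_coord hτ (hχs hy)))
    · refine (contMDiffAt_const (c := (0 : ℝ))).congr_of_eventuallyEq ?_
      filter_upwards [(isClosed_tsupport χ).isOpen_compl.mem_nhds hy] with z hz
      simp [α, image_eq_zero_of_notMem_tsupport hz]
  have h1 := hE.deriv_sub_bracket_congr hα hσ hτ hτ' h
  have hd : ∀ τ, (ofBundle F ρ br).IsSmooth τ →
      (ofBundle F ρ br).deriv (fun y => α y (τ y)) q (σ q) =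
        l (mvfderiv 𝓘(ℝ, EB) (fun q => coord F E q₀ q (τ q)) q (ρ q (σ q))) := by
    intro τ hτ
    have h2 : ∀ᶠ y in 𝓝 q, α y (τ y) = l' (coord F E q₀ y (τ y)) := by
      filter_upwards [hχ1] with y hy
      simp [α, hy, l']
    rw [AlgebroidData.deriv_congr h2]
    exact mvfderiv_clm_comp l' ((contMDiffAt_coord hτ hq).mdifferentiableAt (by simp)) _
  have hb : ∀ v, α q v = l (coord F E q₀ q v) := fun v => by
    simp [α, hχ1.self_of_nhds]
  rw [hd τ hτ, hd τ' hτ', hb, hb, ← map_sub, ← map_sub] at h1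
  rw [map_sub, sub_eq_zero]
  exact h1

set_option synthInstance.maxHeartbeats 200000 in
/-- Every Lie algebroid has a local form near each point. -/
theorem exists_isLocalForm (q₀ : Q) :
    ∃ (O : Set Q) (R : Q → F →L[ℝ] EB) (C : Q → F →L[ℝ] F →L[ℝ] F),
      q₀ ∈ O ∧ IsLocalForm ρ br q₀ O R C := by
  have hB := hE.bundle
  set e := trivializationAt F E q₀ with he
  have hq₀ : q₀ ∈ e.baseSet := mem_baseSet_trivializationAt F E q₀
  let n := Module.finrank ℝ F
  let b : Module.Basis (Fin n) ℝ F := Module.finBasis ℝ F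
  -- The bracket axioms concern global sections, so the frame of constant coordinates is first
  -- extended globally and `O` is chosen where nothing has changed.
  have hs : ∀ i, ∃ s : ∀ q, E q, (ofBundle F ρ br).IsSmooth s ∧
      ∀ᶠ q in 𝓝 q₀, coord F E q₀ q (s q) = b i := by
    intro i
    have h0 : ∀ q ∈ e.baseSet, coord F E q₀ q (e.symm q (b i)) = b i := by
      intro q hq
      rw [coord_apply hq, e.apply_mk_symm hq]
    obtain ⟨s, hs, hs'⟩ := hB.exists_isSmooth_eventuallyEq (x := q₀)
      (σ := fun q => e.symm q (b i)) (by
        filter_upwards [e.open_baseSet.mem_nhds hq₀] with q hq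
        refine (contMDiffAt_iff_coord (f := fun q => q) (q₀ := q₀) contMDiffAt_id hq).2 ?_
        refine (contMDiffAt_const (c := b i)).congr_of_eventuallyEq ?_
        filter_upwards [e.open_baseSet.mem_nhds hq] with y hy
        exact h0 y hy)
    refine ⟨s, hs, ?_⟩
    filter_upwards [hs', e.open_baseSet.mem_nhds hq₀] with q hq hqe
    rw [hq, h0 q hqe]
  choose s hs hsb using hs
  have hev : ∀ᶠ q in 𝓝 q₀, (∀ i, coord F E q₀ q (s i q) = b i) ∧ q ∈ e.baseSet ∧
      q ∈ (extChartAt 𝓘(ℝ, EB) q₀).source :=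
    (Filter.eventually_all.2 hsb).and (Filter.Eventually.and (e.open_baseSet.mem_nhds hq₀)
      (extChartAt_source_mem_nhds q₀))
  obtain ⟨O, hO, hOo, hqO⟩ := eventually_nhds_iff.1 hev
  let L : Fin n → F →L[ℝ] ℝ := fun i => LinearMap.toContinuousLinearMap (b.coord i)
  have hL : ∀ a : F, ∑ i, L i a • b i = a := fun a => b.sum_repr a
  -- The section with constant coordinates `a` on `O`. It is linear in `a`, so `R` and `C` below are
  -- the anchor and bracket of these sections written as operators.
  let c : F → ∀ q, E q := fun a => ∑ i, L i a • s i
  have hc : ∀ a, (ofBundle F ρ br).IsSmooth (c a) := fun a =>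
    hB.isSmooth_sum _ fun i => hB.isSmooth_const_smul _ (hs i)
  have hcb : ∀ a, ∀ q ∈ O, coord F E q₀ q (c a q) = a := by
    intro a q hq
    simp only [c, Finset.sum_apply, Pi.smul_apply, map_sum, map_smul, (hO q hq).1, hL]
  have hcq : ∀ q ∈ O, ∀ a : E q, c (coord F E q₀ q a) q = a := fun q hq a =>
    (coord_bijective (hO q hq).2.1).1 (hcb _ q hq)
  let φ := extChartAt 𝓘(ℝ, EB) q₀
  have hφ : ∀ q ∈ O, ContMDiffAt 𝓘(ℝ, EB) 𝓘(ℝ, EB) ∞ φ q := fun q hq =>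
    contMDiffAt_extChartAt' (by have := (hO q hq).2.2; rwa [extChartAt_source] at this)
  let R : Q → F →L[ℝ] EB := fun q =>
    ∑ i, (L i).smulRight (mvfderiv 𝓘(ℝ, EB) φ q (ρ q (s i q)))
  let C : Q → F →L[ℝ] F →L[ℝ] F := fun q =>
    ∑ i, ∑ j, (L i).smulRight ((L j).smulRight (coord F E q₀ q (br (s i) (s j) q)))
  have hRc : ∀ q a, R q a = mvfderiv 𝓘(ℝ, EB) φ q (ρ q (c a q)) := by
    intro q a
    simp [R, c, Finset.sum_apply]
  have hCc : ∀ q a d, C q a d = coord F E q₀ q (br (c a) (c d) q) := by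
    intro q a d
    have h1 : br (c a) (c d) = ∑ i, ∑ j, (L i a * L j d) • br (s i) (s j) := by
      have e1 : ∀ σ, (ofBundle F ρ br).IsSmooth σ → br σ (c a) = ∑ i, L i a • br σ (s i) := by
        intro σ hσ
        refine (hE.bracket_sum _ hσ fun i => hB.isSmooth_const_smul _ (hs i)).trans ?_
        exact Finset.sum_congr rfl fun i _ => hE.bracket_smul _ _ _ hσ (hs i)
      refine (hE.bracket_sum _ (hc a) fun i => hB.isSmooth_const_smul _ (hs i)).trans ?_
      rw [Finset.sum_comm]
      refine Finset.sum_congr rfl fun j _ => ?_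
      rw [hE.bracket_smul _ _ _ (hc a) (hs j), hE.bracket_antisymm _ _ (hc a) (hs j)]
      change L j d • -br (s j) (c a) = _
      rw [e1 _ (hs j), ← Finset.sum_neg_distrib, Finset.smul_sum]
      refine Finset.sum_congr rfl fun i _ => ?_
      have h3 := hE.bracket_antisymm _ _ (hs i) (hs j)
      change br (s i) (s j) = -br (s j) (s i) at h3
      rw [h3, smul_neg, smul_neg, smul_smul, mul_comm]
    rw [h1]
    simp [C, Finset.sum_apply, mul_smul]
  have hconst : ∀ a, ∀ q ∈ O, mvfderiv 𝓘(ℝ, EB) (fun q => coord F E q₀ q (c a q)) q = 0 := by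
    intro a q hq
    have : (fun q => coord F E q₀ q (c a q)) =ᶠ[𝓝 q] fun _ => a := by
      filter_upwards [hOo.mem_nhds hq] with y hy using hcb a y hy
    rw [this.mvfderiv_eq, mvfderiv_const]
  -- For constant coordinates this is the definition of `C`. By `coord_bracket_congr` one may
  -- replace `τ`, and then after exchanging the arguments also `σ`, by the constant section with the
  -- same value at `q`; each replacement contributes one derivative term.
  have hbr : ∀ q ∈ O, ∀ σ τ : ∀ q, E q, (ofBundle F ρ br).IsSmooth σ →
      (ofBundle F ρ br).IsSmooth τ →
      coord F E q₀ q (br σ τ q) =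
        mvfderiv 𝓘(ℝ, EB) (fun q => coord F E q₀ q (τ q)) q (ρ q (σ q)) -
        mvfderiv 𝓘(ℝ, EB) (fun q => coord F E q₀ q (σ q)) q (ρ q (τ q)) +
        C q (coord F E q₀ q (σ q)) (coord F E q₀ q (τ q)) := by
    intro q hq σ τ hσ hτ
    have hqe := (hO q hq).2.1
    have h1 := coord_bracket_congr hE hσ hτ (hc (coord F E q₀ q (τ q))) hqe (hcq q hq _).symm
    have h2 := coord_bracket_congr hE (hc (coord F E q₀ q (τ q))) hσ
      (hc (coord F E q₀ q (σ q))) hqe (hcq q hq _).symm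
    have h3 := congr_fun (hE.bracket_antisymm _ _ hσ (hc (coord F E q₀ q (τ q)))) q
    have h4 := congr_fun (hE.bracket_antisymm _ _ (hc (coord F E q₀ q (σ q)))
      (hc (coord F E q₀ q (τ q)))) q
    change br σ (c (coord F E q₀ q (τ q))) q = -br _ _ q at h3
    change br _ _ q = -br _ _ q at h4
    rw [hconst _ q hq] at h1 h2
    rw [hcq q hq] at h2
    rw [h3, map_neg] at h1
    rw [hCc, h4, map_neg]
    simp only [zero_apply, zero_sub, neg_neg] at h1 h2
    linear_combination (norm := module) h2 - h1
  have hsC : ∀ q ∈ O, ContMDiffAt 𝓘(ℝ, EB) 𝓘(ℝ, F →L[ℝ] F →L[ℝ] F) ∞ C q := by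
    intro q hq
    refine contMDiffAt_finsetSum fun i _ => contMDiffAt_finsetSum fun j _ => ?_
    exact contMDiffAt_smulRight _ (contMDiffAt_smulRight _
      (contMDiffAt_coord (hE.bracket_smooth _ _ (hs i) (hs j)) (hO q hq).2.1))
  have hsR : ∀ q ∈ O, ContMDiffAt 𝓘(ℝ, EB) 𝓘(ℝ, F →L[ℝ] EB) ∞ R q := by
    intro q hq
    refine contMDiffAt_finsetSum fun i _ => ?_
    exact contMDiffAt_smulRight _
      (contMDiffAt_mvfderiv_apply (g := fun q => q) (hφ q hq) (hE.anchor_smooth _ (hs i) q))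
  refine ⟨O, R, C, hqO, hOo, fun q hq => (hO q hq).2.1, fun q hq => (hO q hq).2.2, hsR, hsC, ?_,
    hbr, ?_, ?_, ?_⟩
  · intro q hq a
    rw [hRc, hcq q hq]
  · intro q hq a d
    rw [hCc, hCc, ← map_neg]
    congr 1
    exact congr_fun (hE.bracket_antisymm _ _ (hc a) (hc d)) q
  -- The identity is `anchor_bracket` for the sections `c a'` and `c d'`, applied to the chart of
  -- the base.
  · intro q hq a d
    set a' := coord F E q₀ q a with ha'
    set d' := coord F E q₀ q d with hd'
    have hR1 : ∀ x y : F, mvfderiv 𝓘(ℝ, EB) (fun q => mvfderiv 𝓘(ℝ, EB) φ q (ρ q (c y q))) q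
        (ρ q (c x q)) = mvfderiv 𝓘(ℝ, EB) R q (ρ q (c x q)) y := by
      intro x y
      simp only [← hRc]
      exact mvfderiv_clm_comp (ContinuousLinearMap.apply ℝ EB y)
        ((hsR q hq).mdifferentiableAt (by simp)) _
    have h1 := mvfderiv_mlieBracket (hφ q hq)
      ((hE.anchor_smooth _ (hc a')).mdifferentiable (by simp) q)
      ((hE.anchor_smooth _ (hc d')).mdifferentiable (by simp) q)
    rw [← hE.anchor_bracket (hc a') (hc d')] at h1
    have h2 := hR1 a' d'
    have h3 := hR1 d' a'
    rw [hcq q hq a] at h2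
    rw [hcq q hq d] at h3
    have h4 : R q (C q a' d') = mvfderiv 𝓘(ℝ, EB) φ q (ρ q (br (c a') (c d') q)) := by
      rw [hCc, hRc, hcq q hq]
    rw [h4, ← h2, ← h3]
    have e1 : c a' q = a := hcq q hq a
    have e2 : c d' q = d := hcq q hq d
    refine h1.trans ?_
    congr 2
    · exact congr_arg (ρ q) e1
    · exact congr_arg (ρ q) e2
  -- The identity is the Jacobi identity for sections of constant coordinates. The inner bracket has
  -- coordinates given by `C`, whose derivative enters through `hbr`.
  · intro q hq a d f
    have hCd := (hsC q hq).mdifferentiableAt (by simp)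
    have key : ∀ a d f : E q, coord F E q₀ q (br (c (coord F E q₀ q a))
        (br (c (coord F E q₀ q d)) (c (coord F E q₀ q f))) q) =
        mvfderiv 𝓘(ℝ, EB) C q (ρ q a) (coord F E q₀ q d) (coord F E q₀ q f) +
        C q (coord F E q₀ q a) (C q (coord F E q₀ q d) (coord F E q₀ q f)) := by
      intro a d f
      have hbs : (ofBundle F ρ br).IsSmooth (br (c (coord F E q₀ q d)) (c (coord F E q₀ q f))) :=
        hE.bracket_smooth _ _ (hc _) (hc _)
      rw [hbr q hq _ _ (hc _) hbs, hconst _ q hq]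
      have h1 : (fun q' => coord F E q₀ q' (br (c (coord F E q₀ q d))
          (c (coord F E q₀ q f)) q')) =
          fun q' => C q' (coord F E q₀ q d) (coord F E q₀ q f) := by
        ext q'
        rw [hCc]
      have h2 := mvfderiv_clm_comp ((ContinuousLinearMap.apply ℝ F (coord F E q₀ q f)).comp
        (ContinuousLinearMap.apply ℝ (F →L[ℝ] F) (coord F E q₀ q d))) hCd (ρ q a)
      simp only [ContinuousLinearMap.comp_apply, ContinuousLinearMap.apply_apply] at h2
      rw [h1, hcq q hq, h2, zero_apply, sub_zero, ← hCc q (coord F E q₀ q d)]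
    rw [← key, ← key, ← key, ← map_add, ← map_add]
    rw [show (0 : F) = coord F E q₀ q 0 by simp]
    congr 1
    exact congr_fun (hE.jacobi _ _ _ (hc _) (hc _) (hc _)) q

end LocalForm

/-! ### Vector fields in chart coordinates. -/

section TangentCoord

variable {EM : Type*} [NormedAddCommGroup EM] [NormedSpace ℝ EM]
  {HM : Type*} [TopologicalSpace HM] {IM : ModelWithCorners ℝ EM HM}
  {M : Type*} [TopologicalSpace M] [ChartedSpace HM M] [IsManifold IM ∞ M]
  {EN : Type*} [NormedAddCommGroup EN] [NormedSpace ℝ EN]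
  {HN : Type*} [TopologicalSpace HN] {IN : ModelWithCorners ℝ EN HN}
  {N : Type*} [TopologicalSpace N] [ChartedSpace HN N]

/-- The preferred trivialisation of the tangent bundle is the derivative of the extended chart. -/
lemma contMDiffAt_vectorField_iff {g : N → M} {X : ∀ y, TangentSpace IM (g y)} {y : N} {x₀ : M}
    (hg : ContMDiffAt IN IM ∞ g y) (hy : g y ∈ (extChartAt IM x₀).source) :
    ContMDiffAt IN IM.tangent ∞ (fun y => (⟨g y, X y⟩ : TangentBundle IM M)) y ↔
      ContMDiffAt IN 𝓘(ℝ, EM) ∞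
        (fun y => mvfderiv IM (extChartAt IM x₀) (g y) (X y)) y := by
  have : IsManifold IM 1 M := IsManifold.of_le (n := ∞) (by simp)
  rw [extChartAt_source] at hy
  have hb : ∀ {x}, x ∈ (chartAt HM x₀).source →
      x ∈ (trivializationAt EM (TangentSpace IM : M → Type _) x₀).baseSet := fun h => h
  rw [(trivializationAt EM (TangentSpace IM : M → Type _) x₀).contMDiffAt_iff
    (by rw [Trivialization.mem_source]; exact hb hy)]
  refine (and_iff_right hg).trans (Filter.EventuallyEq.contMDiffAt_iff ?_)
  filter_upwards [hg.continuousAt.eventually ((chartAt HM x₀).open_source.mem_nhds hy)] with z hz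
  have h1 := congr_fun ((trivializationAt EM (TangentSpace IM : M → Type _)
    x₀).coe_linearMapAt_of_mem (R := ℝ) (hb hz)) (X z)
  have h2 := DFunLike.congr_fun
    (TangentBundle.continuousLinearMapAt_trivializationAt (I := IM) hz) (X z)
  exact h1.symm.trans h2

lemma mvfderiv_extChartAt_bijective {x₀ x : M} (hx : x ∈ (extChartAt IM x₀).source) :
    Function.Bijective (mvfderiv IM (extChartAt IM x₀) x) := by
  have : IsManifold IM 1 M := IsManifold.of_le (n := ∞) (by simp)
  obtain ⟨e, he⟩ := isInvertible_mfderiv_extChartAt (I := IM) hx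
  have h : (mvfderiv IM (extChartAt IM x₀) x : TangentSpace IM x → EM) = e := by
    ext v
    exact (DFunLike.congr_fun he v).symm
  rw [h]
  exact e.bijective

end TangentCoord

/-! ### Smoothness of coefficients in a moving basis. -/

section FrameCoefficients

variable {EN : Type*} [NormedAddCommGroup EN] [NormedSpace ℝ EN]
  {HN : Type*} [TopologicalSpace HN] {IN : ModelWithCorners ℝ EN HN}
  {N : Type*} [TopologicalSpace N] [ChartedSpace HN N]
  {F : Type*} [NormedAddCommGroup F] [NormedSpace ℝ F] [FiniteDimensional ℝ F]

/-- The coefficients of a smooth function with respect to a smooth moving basis are smooth. -/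
lemma contMDiffAt_coefficients {n : ℕ} (hn : Module.finrank ℝ F = n) {e : Fin n → N → F}
    {c : Fin n → N → ℝ} {f : N → F} {x : N}
    (he : ∀ i, ContMDiffAt IN 𝓘(ℝ, F) ∞ (e i) x) (hf : ContMDiffAt IN 𝓘(ℝ, F) ∞ f x)
    (hli : ∀ᶠ y in 𝓝 x, LinearIndependent ℝ (fun i => e i y))
    (hfc : ∀ᶠ y in 𝓝 x, f y = ∑ i, c i y • e i y) (i : Fin n) :
    ContMDiffAt IN 𝓘(ℝ, ℝ) ∞ (c i) x := by
  -- The coefficients are `T⁻¹ f` for the operator `T` with columns `e i`, and inversion of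
  -- operators is smooth at invertible ones.
  let T : N → (Fin n → ℝ) →L[ℝ] F := fun y =>
    ∑ i, (ContinuousLinearMap.proj (R := ℝ) (φ := fun _ : Fin n => ℝ) i).smulRight (e i y)
  have hTa : ∀ y v, T y v = ∑ i, v i • e i y := fun y v => by simp [T]
  have hT : ContMDiffAt IN 𝓘(ℝ, (Fin n → ℝ) →L[ℝ] F) ∞ T x :=
    contMDiffAt_finsetSum fun i _ => contMDiffAt_smulRight _ (he i)
  have hinv : ∀ y, LinearIndependent ℝ (fun i => e i y) → (T y).IsInvertible := by
    intro y hy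
    have hinj : Function.Injective (T y).toLinearMap := by
      rw [← LinearMap.ker_eq_bot, LinearMap.ker_eq_bot']
      intro v hv
      have h1 : ∑ i, v i • e i y = 0 := (hTa y v).symm.trans hv
      exact funext (Fintype.linearIndependent_iff.1 hy v h1)
    have hd : Module.finrank ℝ (Fin n → ℝ) = Module.finrank ℝ F := by simp [hn]
    have hbij : Function.Bijective (T y).toLinearMap :=
      ⟨hinj, (LinearMap.injective_iff_surjective_of_finrank_eq_finrank hd).1 hinj⟩
    refine ⟨(LinearEquiv.ofBijective _ hbij).toContinuousLinearEquiv, ?_⟩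
    ext v
    rfl
  have h1 : ContMDiffAt IN 𝓘(ℝ, F →L[ℝ] (Fin n → ℝ)) ∞ (fun y => (T y).inverse) x :=
    ((hinv x hli.self_of_nhds).contDiffAt_map_inverse (n := ∞)).contMDiffAt.comp x hT
  have h2 : ContMDiffAt IN 𝓘(ℝ, ℝ) ∞ (fun y => (T y).inverse (f y) i) x :=
    (ContinuousLinearMap.proj (R := ℝ) (φ := fun _ : Fin n => ℝ) i).contMDiff.contMDiffAt.comp x
      (h1.clm_apply hf)
  refine h2.congr_of_eventuallyEq ?_
  filter_upwards [hli, hfc] with y hy hfy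
  rw [hfy, ← hTa y (fun i => c i y), (hinv y hy).inverse_apply_self]

end FrameCoefficients

/-! ### The bracket of a prolongation in coordinates. -/

section Prolongation

variable {EB : Type*} [NormedAddCommGroup EB] [NormedSpace ℝ EB] [FiniteDimensional ℝ EB]
  {Q : Type*} [TopologicalSpace Q] [ChartedSpace EB Q] [IsManifold 𝓘(ℝ, EB) ∞ Q] [T2Space Q]
  {F : Type*} [NormedAddCommGroup F] [NormedSpace ℝ F] [FiniteDimensional ℝ F]
  {E : Q → Type*} [TopologicalSpace (TotalSpace F E)]
  [∀ q, AddCommGroup (E q)] [∀ q, Module ℝ (E q)] [∀ q, TopologicalSpace (E q)]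
  [FiberBundle F E] [VectorBundle ℝ F E] [ContMDiffVectorBundle ∞ F E 𝓘(ℝ, EB)]
  {ρ : ∀ q, E q →L[ℝ] TangentSpace 𝓘(ℝ, EB) q}
  {br : (∀ q, E q) → (∀ q, E q) → ∀ q, E q}
  {EP : Type*} [NormedAddCommGroup EP] [NormedSpace ℝ EP] [FiniteDimensional ℝ EP]
  {HP : Type*} [TopologicalSpace HP] {IP : ModelWithCorners ℝ EP HP} [IP.Boundaryless]
  {P : Type*} [TopologicalSpace P] [ChartedSpace HP P] [IsManifold IP ∞ P] [T2Space P]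
  {pr : P → Q}

variable (F) in
/-- The coordinates of the `E`-component of a section of the prolongation. -/
def prolongCoord (q₀ : Q) (Z : ∀ p, prolongFibre ρ IP pr p) (p : P) : F :=
  coord F E q₀ (pr p) (Z p).1.1

lemma contMDiffAt_prolongCoord (hpr : ContMDiff IP 𝓘(ℝ, EB) ∞ pr)
    {Z : ∀ p, prolongFibre ρ IP pr p} {p : P} {q₀ : Q}
    (hp : pr p ∈ (trivializationAt F E q₀).baseSet)
    (hZ : (prolongation F ρ br IP pr).smoothAt Z p) :
    ContMDiffAt IP 𝓘(ℝ, F) ∞ (prolongCoord F q₀ Z) p :=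
  (contMDiffAt_iff_coord (hpr p) hp).1 hZ.1

lemma prolongFibre_ext {q₀ : Q} {p : P} (hp : pr p ∈ (trivializationAt F E q₀).baseSet)
    {z w : prolongFibre ρ IP pr p}
    (h1 : coord F E q₀ (pr p) z.1.1 = coord F E q₀ (pr p) w.1.1) (h2 : z.1.2 = w.1.2) : z = w :=
  Subtype.ext (Prod.ext ((coord_bijective hp).1 h1) h2)

variable {m : ℕ} (hm : Module.finrank ℝ F = m) (hE : (ofBundle F ρ br).IsLieAlgebroid m)
  (hpr : ContMDiff IP 𝓘(ℝ, EB) ∞ pr)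

include hm hE in
-- Guarantees that the default value `0` in `prolongBracketFst` never occurs over a Lie algebroid.
lemma exists_isFrameExpansion (hpr : ContMDiff IP 𝓘(ℝ, EB) ∞ pr)
    (Z W : ∀ p, prolongFibre ρ IP pr p) (p : P) :
    ∃ e z w, IsFrameExpansion F ρ br IP pr Z W p e z w := by
  subst hm
  obtain ⟨e, he, hb, -⟩ := hE.bundle.exists_frame (pr p)
  have h : ∀ Z : ∀ p, prolongFibre ρ IP pr p, ∃ z : Fin (Module.finrank ℝ F) → P → ℝ,
      ∀ᶠ p' in 𝓝 p, (Z p').1.1 = ∑ i, z i p' • e i (pr p') := by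
    intro Z
    have h1 : ∀ p', ∃ c : Fin (Module.finrank ℝ F) → ℝ,
        Submodule.span ℝ (range fun i => e i (pr p')) = ⊤ →
          (Z p').1.1 = ∑ i, c i • e i (pr p') := by
      intro p'
      by_cases hp : Submodule.span ℝ (range fun i => e i (pr p')) = ⊤
      · obtain ⟨c, hc⟩ := (Submodule.mem_span_range_iff_exists_fun ℝ).1
          (hp ▸ Submodule.mem_top : (Z p').1.1 ∈ Submodule.span ℝ (range fun i => e i (pr p')))
        exact ⟨c, fun _ => hc.symm⟩
      · exact ⟨0, fun h => absurd h hp⟩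
    choose c hc using h1
    refine ⟨fun i p' => c p' i, ?_⟩
    filter_upwards [(hpr p).continuousAt.eventually hb] with p' hp' using hc p' hp'.2
  obtain ⟨z, hz⟩ := h Z
  obtain ⟨w, hw⟩ := h W
  exact ⟨e, z, w, he, hb, hz, hw⟩

variable {q₀ : Q} {O : Set Q} {R : Q → F →L[ℝ] EB} {C : Q → F →L[ℝ] F →L[ℝ] F}
  (hO : IsLocalForm ρ br q₀ O R C)

include hO in
/-- The derivative of the coordinates of a section given by its coefficients in a frame. -/
lemma IsFrameExpansion.mvfderiv_eq (hpr : ContMDiff IP 𝓘(ℝ, EB) ∞ pr)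
    {Z W : ∀ p, prolongFibre ρ IP pr p} {p : P}
    (hp : pr p ∈ O) {e : Fin (Module.finrank ℝ F) → ∀ q, E q}
    {z w : Fin (Module.finrank ℝ F) → P → ℝ}
    (h : IsFrameExpansion F ρ br IP pr Z W p e z w)
    (hW : (prolongation F ρ br IP pr).smoothAt W p) :
    mvfderiv IP (prolongCoord F q₀ W) p (Z p).1.2 =
      ∑ c, dirDeriv IP (w c) p (Z p).1.2 • coord F E q₀ (pr p) (e c (pr p)) +
        ∑ a, ∑ b, (z a p * w b p) •
          mvfderiv 𝓘(ℝ, EB) (fun q => coord F E q₀ q (e b q)) (pr p) (ρ (pr p) (e a (pr p))) := by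
  have hpe := hO.subset_baseSet hp
  have he : ∀ i, ContMDiffAt 𝓘(ℝ, EB) 𝓘(ℝ, F) ∞ (fun q => coord F E q₀ q (e i q)) (pr p) :=
    fun i => contMDiffAt_coord (h.smooth i) hpe
  have he' : ∀ i, ContMDiffAt IP 𝓘(ℝ, F) ∞ (fun p => coord F E q₀ (pr p) (e i (pr p))) p :=
    fun i => (he i).comp p (hpr p)
  have hev : ∀ᶠ y in 𝓝 p, prolongCoord F q₀ W y =
      ∑ i, w i y • coord F E q₀ (pr y) (e i (pr y)) := by
    filter_upwards [h.right] with y hy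
    rw [prolongCoord, hy, map_sum]
    simp only [map_smul]
  have hli : ∀ᶠ y in 𝓝 p, LinearIndependent ℝ (fun i => coord F E q₀ (pr y) (e i (pr y))) := by
    filter_upwards [(hpr p).continuousAt.eventually h.basis,
      (hpr p).continuousAt.eventually (hO.isOpen.mem_nhds hp)] with y hy hyO
    exact hy.1.map' _ (LinearMap.ker_eq_bot.2 (coord_bijective (hO.subset_baseSet hyO)).1)
  -- A frame expansion does not ask for differentiable coefficients; this comes from the smoothness
  -- of `W` and the independence of the frame.
  have hw : ∀ i, MDifferentiableAt IP 𝓘(ℝ, ℝ) (w i) p := fun i =>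
    (contMDiffAt_coefficients rfl he' (contMDiffAt_prolongCoord hpr hpe hW) hli hev
      i).mdifferentiableAt (by simp)
  have hwe : ∀ i ∈ Finset.univ, MDifferentiableAt IP 𝓘(ℝ, F)
      (fun y => w i y • coord F E q₀ (pr y) (e i (pr y))) p := fun i _ =>
    (hw i).smul ((he' i).mdifferentiableAt (by simp))
  rw [Filter.EventuallyEq.mvfderiv_eq hev, mvfderiv_sum _ hwe]
  have h1 : ∀ i, mvfderiv IP (fun y => w i y • coord F E q₀ (pr y) (e i (pr y))) p (Z p).1.2 =
      dirDeriv IP (w i) p (Z p).1.2 • coord F E q₀ (pr p) (e i (pr p)) +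
        ∑ a, (z a p * w i p) •
          mvfderiv 𝓘(ℝ, EB) (fun q => coord F E q₀ q (e i q)) (pr p) (ρ (pr p) (e a (pr p))) := by
    intro i
    have h2 := mvfderiv_comp' (IN := 𝓘(ℝ, EB)) ((he i).mdifferentiableAt (by simp))
      ((hpr p).mdifferentiableAt (by simp)) (Z p).1.2
    have h3 := mvfderiv_bilin (ContinuousLinearMap.lsmul ℝ ℝ : ℝ →L[ℝ] F →L[ℝ] F) (hw i)
      ((he' i).mdifferentiableAt (by simp)) (Z p).1.2
    simp only [ContinuousLinearMap.lsmul_apply] at h3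
    refine h3.trans (congr_arg₂ (· + ·) rfl ?_)
    -- The defining condition of the prolongation turns derivatives along the vector field of `Z` of
    -- functions on the base into derivatives along the anchor.
    have h4 : mfderiv IP 𝓘(ℝ, EB) pr p (Z p).1.2 = ∑ a, z a p • ρ (pr p) (e a (pr p)) := by
      have h5 : ρ (pr p) (Z p).1.1 = mfderiv IP 𝓘(ℝ, EB) pr p (Z p).1.2 := (Z p).2
      rw [← h5, h.left.self_of_nhds, map_sum]
      simp only [map_smul]
    rw [h2, h4, map_sum, Finset.smul_sum]
    refine Finset.sum_congr rfl fun a _ => ?_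
    rw [map_smul, smul_smul, mul_comm]
  rw [Finset.sum_congr rfl fun i _ => h1 i, Finset.sum_add_distrib]
  congr 1
  rw [Finset.sum_comm]

lemma IsFrameExpansion.symm {Z W : ∀ p, prolongFibre ρ IP pr p} {p : P}
    {e : Fin (Module.finrank ℝ F) → ∀ q, E q} {z w : Fin (Module.finrank ℝ F) → P → ℝ}
    (h : IsFrameExpansion F ρ br IP pr Z W p e z w) :
    IsFrameExpansion F ρ br IP pr W Z p e w z :=
  ⟨h.smooth, h.basis, h.right, h.left⟩

include hm hE hO in
/-- The bracket of sections of the prolongation in coordinates. -/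
theorem coord_prolongBracketFst (hpr : ContMDiff IP 𝓘(ℝ, EB) ∞ pr)
    {Z W : ∀ p, prolongFibre ρ IP pr p} {p : P} (hp : pr p ∈ O)
    (hZ : (prolongation F ρ br IP pr).smoothAt Z p)
    (hW : (prolongation F ρ br IP pr).smoothAt W p) :
    coord F E q₀ (pr p) (prolongBracketFst F ρ br IP pr Z W p) =
      mvfderiv IP (prolongCoord F q₀ W) p (Z p).1.2 -
      mvfderiv IP (prolongCoord F q₀ Z) p (W p).1.2 +
      C (pr p) (prolongCoord F q₀ Z p) (prolongCoord F q₀ W p) := by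
  have hex := exists_isFrameExpansion hm hE hpr Z W p
  -- The frame in the definition is an arbitrary choice, so the formula is proved for every frame.
  -- Its right side does not involve the frame, which also shows independence of the choice.
  suffices key : ∀ e z w, IsFrameExpansion F ρ br IP pr Z W p e z w →
      coord F E q₀ (pr p)
        ((∑ c, (dirDeriv IP (w c) p (Z p).1.2 - dirDeriv IP (z c) p (W p).1.2) • e c (pr p))
          + ∑ a, ∑ b, (z a p * w b p) • br (e a) (e b) (pr p)) =
      mvfderiv IP (prolongCoord F q₀ W) p (Z p).1.2 -
      mvfderiv IP (prolongCoord F q₀ Z) p (W p).1.2 +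
      C (pr p) (prolongCoord F q₀ Z p) (prolongCoord F q₀ W p) by
    rw [prolongBracketFst, dif_pos hex]
    exact key _ _ _ hex.choose_spec.choose_spec.choose_spec
  intro e z w h
  rw [h.mvfderiv_eq hO hpr hp hW, h.symm.mvfderiv_eq hO hpr hp hZ]
  have hz : prolongCoord F q₀ Z p = ∑ a, z a p • coord F E q₀ (pr p) (e a (pr p)) := by
    rw [prolongCoord, h.left.self_of_nhds, map_sum]
    simp only [map_smul]
  have hw : prolongCoord F q₀ W p = ∑ a, w a p • coord F E q₀ (pr p) (e a (pr p)) := by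
    rw [prolongCoord, h.right.self_of_nhds, map_sum]
    simp only [map_smul]
  have hC : C (pr p) (prolongCoord F q₀ Z p) (prolongCoord F q₀ W p) =
      ∑ a, ∑ b, (z a p * w b p) •
        C (pr p) (coord F E q₀ (pr p) (e a (pr p))) (coord F E q₀ (pr p) (e b (pr p))) := by
    rw [hz, map_sum, sum_apply]
    refine Finset.sum_congr rfl fun a _ => ?_
    rw [map_smul, smul_apply, hw, map_sum, Finset.smul_sum]
    refine Finset.sum_congr rfl fun b _ => ?_
    rw [map_smul, smul_smul]
  have hbr : ∀ a b, coord F E q₀ (pr p) (br (e a) (e b) (pr p)) = _ := fun a b =>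
    hO.bracket (pr p) hp _ _ (h.smooth a) (h.smooth b)
  simp only [map_add, map_sub, map_sum, map_smul, hbr, hC, sub_smul, smul_add, smul_sub,
    Finset.sum_sub_distrib, Finset.sum_add_distrib]
  rw [Finset.sum_comm (f := fun a b => (w a p * z b p) • mvfderiv 𝓘(ℝ, EB)
    (fun q => coord F E q₀ q (e b q)) (pr p) (ρ (pr p) (e a (pr p))))]
  simp only [mul_comm (w _ p)]
  abel

end Prolongation

/-! ### The bracket stays in the prolongation; smooth sections in fibre coordinates. -/

section ProlongationLieAlgebroid

variable {EB : Type*} [NormedAddCommGroup EB] [NormedSpace ℝ EB] [FiniteDimensional ℝ EB]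
  {Q : Type*} [TopologicalSpace Q] [ChartedSpace EB Q] [IsManifold 𝓘(ℝ, EB) ∞ Q] [T2Space Q]
  {F : Type*} [NormedAddCommGroup F] [NormedSpace ℝ F] [FiniteDimensional ℝ F]
  {E : Q → Type*} [TopologicalSpace (TotalSpace F E)]
  [∀ q, AddCommGroup (E q)] [∀ q, Module ℝ (E q)] [∀ q, TopologicalSpace (E q)]
  [FiberBundle F E] [VectorBundle ℝ F E] [ContMDiffVectorBundle ∞ F E 𝓘(ℝ, EB)]
  {ρ : ∀ q, E q →L[ℝ] TangentSpace 𝓘(ℝ, EB) q}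
  {br : (∀ q, E q) → (∀ q, E q) → ∀ q, E q}
  {EP : Type*} [NormedAddCommGroup EP] [NormedSpace ℝ EP] [FiniteDimensional ℝ EP]
  {HP : Type*} [TopologicalSpace HP] {IP : ModelWithCorners ℝ EP HP} [IP.Boundaryless]
  {P : Type*} [TopologicalSpace P] [ChartedSpace HP P] [IsManifold IP ∞ P] [T2Space P]
  {pr : P → Q} {m : ℕ} (hm : Module.finrank ℝ F = m)
  (hE : (ofBundle F ρ br).IsLieAlgebroid m) (hpr : ContMDiff IP 𝓘(ℝ, EB) ∞ pr)
  {q₀ : Q} {O : Set Q} {R : Q → F →L[ℝ] EB} {C : Q → F →L[ℝ] F →L[ℝ] F}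
  (hO : IsLocalForm ρ br q₀ O R C)
  {K : Type*} [NormedAddCommGroup K] [NormedSpace ℝ K] [FiniteDimensional ℝ K]

include hO in
lemma IsLocalForm.mvfderiv_proj (hpr : ContMDiff IP 𝓘(ℝ, EB) ∞ pr) {p : P} (hp : pr p ∈ O)
    (z : prolongFibre ρ IP pr p) :
    mvfderiv IP (fun p => extChartAt 𝓘(ℝ, EB) q₀ (pr p)) p z.1.2 =
      R (pr p) (coord F E q₀ (pr p) z.1.1) := by
  have hφ : ContMDiffAt 𝓘(ℝ, EB) 𝓘(ℝ, EB) ∞ (extChartAt 𝓘(ℝ, EB) q₀) (pr p) :=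
    contMDiffAt_extChartAt' (by have := hO.subset_source hp; rwa [extChartAt_source] at this)
  rw [mvfderiv_comp' (hφ.mdifferentiableAt (by simp)) ((hpr p).mdifferentiableAt (by simp)),
    hO.anchor _ hp]
  exact congr_arg _ z.2.symm

include hm hE hO in
-- Applying the derivative of the base chart turns the claim into an identity in `EB`. On one side
-- is `R` of the coordinate formula; on the other is the commutator of derivations applied to the
-- base coordinates, where `X(pr)` is `R z`. The product rule leaves derivatives of `R`, which the
-- anchor identity of the local form trades for `R (C z w)`.
lemma prolongBracket_mem_of_isLocalForm (hpr : ContMDiff IP 𝓘(ℝ, EB) ∞ pr)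
    {Z W : ∀ p, prolongFibre ρ IP pr p} {p : P} (hp : pr p ∈ O)
    (hZ : (prolongation F ρ br IP pr).smoothAt Z p)
    (hW : (prolongation F ρ br IP pr).smoothAt W p) :
    (prolongBracketFst F ρ br IP pr Z W p,
      VectorField.mlieBracket IP (fun p => (Z p).1.2) (fun p => (W p).1.2) p) ∈
        prolongFibre ρ IP pr p := by
  change ρ (pr p) (prolongBracketFst F ρ br IP pr Z W p) = mfderiv IP 𝓘(ℝ, EB) pr p _
  refine (mvfderiv_extChartAt_bijective (hO.subset_source hp)).1 ?_
  have hφ : ContMDiffAt 𝓘(ℝ, EB) 𝓘(ℝ, EB) ∞ (extChartAt 𝓘(ℝ, EB) q₀) (pr p) :=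
    contMDiffAt_extChartAt' (by have := hO.subset_source hp; rwa [extChartAt_source] at this)
  have hpO : ∀ᶠ y in 𝓝 p, pr y ∈ O :=
    (hpr p).continuousAt.eventually (hO.isOpen.mem_nhds hp)
  have hder : ∀ {V : ∀ p, prolongFibre ρ IP pr p},
      (prolongation F ρ br IP pr).smoothAt V p → ∀ z : prolongFibre ρ IP pr p,
      mvfderiv IP (fun y => mvfderiv IP (fun p => extChartAt 𝓘(ℝ, EB) q₀ (pr p)) y (V y).1.2) p
        z.1.2 = mvfderiv 𝓘(ℝ, EB) R (pr p) (ρ (pr p) z.1.1) (prolongCoord F q₀ V p) +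
          R (pr p) (mvfderiv IP (prolongCoord F q₀ V) p z.1.2) := by
    intro V hV z
    have h1 : (fun y => mvfderiv IP (fun p => extChartAt 𝓘(ℝ, EB) q₀ (pr p)) y (V y).1.2) =ᶠ[𝓝 p]
        fun y => R (pr y) (prolongCoord F q₀ V y) := by
      filter_upwards [hpO] with y hy using hO.mvfderiv_proj hpr hy (V y)
    have hR := (hO.smooth_R _ hp).mdifferentiableAt (by simp)
    have h2 := mvfderiv_bilin (ContinuousLinearMap.id ℝ (F →L[ℝ] EB)) (f := fun y => R (pr y))
      (((hO.smooth_R _ hp).comp p (hpr p)).mdifferentiableAt (by simp))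
      ((contMDiffAt_prolongCoord hpr (hO.subset_baseSet hp) hV).mdifferentiableAt (by simp)) z.1.2
    have h3 := mvfderiv_comp' hR ((hpr p).mdifferentiableAt (by simp)) z.1.2
    have h4 : ρ (pr p) z.1.1 = mfderiv IP 𝓘(ℝ, EB) pr p z.1.2 := z.2
    rw [h1.mvfderiv_eq, h4, ← h3]
    exact h2
  have h1 := mvfderiv_comp' (hφ.mdifferentiableAt (by simp))
    ((hpr p).mdifferentiableAt (by simp))
    (VectorField.mlieBracket IP (fun p => (Z p).1.2) (fun p => (W p).1.2) p)
  refine Eq.trans ?_ h1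
  have hφp : ContMDiffAt IP 𝓘(ℝ, EB) ∞ (fun y => extChartAt 𝓘(ℝ, EB) q₀ (pr y)) p :=
    hφ.comp p (hpr p)
  rw [mvfderiv_mlieBracket hφp (hZ.2.mdifferentiableAt (by simp))
    (hW.2.mdifferentiableAt (by simp)), ← hO.anchor _ hp,
    coord_prolongBracketFst hm hE hO hpr hp hZ hW, hder hW (Z p), hder hZ (W p), map_add, map_sub]
  have h5 := hO.anchor_bracket _ hp (Z p).1.1 (W p).1.1
  change R (pr p) (C (pr p) (prolongCoord F q₀ Z p) (prolongCoord F q₀ W p)) =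
    mvfderiv 𝓘(ℝ, EB) R (pr p) (ρ (pr p) (Z p).1.1) (prolongCoord F q₀ W p) -
    mvfderiv 𝓘(ℝ, EB) R (pr p) (ρ (pr p) (W p).1.1) (prolongCoord F q₀ Z p) at h5
  rw [h5]
  abel

include hm hE in
lemma prolongation_bracket_val (hpr : ContMDiff IP 𝓘(ℝ, EB) ∞ pr)
    {Z W : ∀ p, prolongFibre ρ IP pr p} {p : P}
    (hZ : (prolongation F ρ br IP pr).smoothAt Z p)
    (hW : (prolongation F ρ br IP pr).smoothAt W p) :
    ((prolongation F ρ br IP pr).bracket Z W p).1 =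
      (prolongBracketFst F ρ br IP pr Z W p,
        VectorField.mlieBracket IP (fun p => (Z p).1.2) (fun p => (W p).1.2) p) := by
  obtain ⟨O, R, C, hq, hO⟩ := exists_isLocalForm hE (pr p)
  have h := prolongBracket_mem_of_isLocalForm hm hE hO hpr hq hZ hW
  simp only [prolongation]
  rw [dif_pos h]

include hm hE in
lemma prolongation_bracket_snd (hpr : ContMDiff IP 𝓘(ℝ, EB) ∞ pr)
    {Z W : ∀ p, prolongFibre ρ IP pr p} {p : P}
    (hZ : (prolongation F ρ br IP pr).smoothAt Z p)
    (hW : (prolongation F ρ br IP pr).smoothAt W p) :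
    ((prolongation F ρ br IP pr).bracket Z W p).1.2 =
      VectorField.mlieBracket IP (fun p => (Z p).1.2) (fun p => (W p).1.2) p := by
  rw [prolongation_bracket_val hm hE hpr hZ hW]

include hm hE hO in
lemma prolongCoord_bracket (hpr : ContMDiff IP 𝓘(ℝ, EB) ∞ pr)
    {Z W : ∀ p, prolongFibre ρ IP pr p} {p : P} (hp : pr p ∈ O)
    (hZ : (prolongation F ρ br IP pr).smoothAt Z p)
    (hW : (prolongation F ρ br IP pr).smoothAt W p) :
    prolongCoord F q₀ ((prolongation F ρ br IP pr).bracket Z W) p =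
      mvfderiv IP (prolongCoord F q₀ W) p (Z p).1.2 -
      mvfderiv IP (prolongCoord F q₀ Z) p (W p).1.2 +
      C (pr p) (prolongCoord F q₀ Z p) (prolongCoord F q₀ W p) := by
  rw [← coord_prolongBracketFst hm hE hO hpr hp hZ hW, prolongCoord,
    prolongation_bracket_val hm hE hpr hZ hW]

variable (EB IP pr) in
/-- Fibre coordinates for `pr` on an open set. -/
structure IsFibreCoord (κ : P → K) (U : Set P) : Prop where
  isOpen : IsOpen U
  smooth : ∀ p ∈ U, ContMDiffAt IP 𝓘(ℝ, K) ∞ κ p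
  bijective : ∀ p ∈ U, Function.Bijective fun v : TangentSpace IP p =>
    ((mfderiv IP 𝓘(ℝ, EB) pr p v, mvfderiv IP κ p v) : TangentSpace 𝓘(ℝ, EB) (pr p) × K)
  smooth_vectorField : ∀ p ∈ U, ∀ X : ∀ p, TangentSpace IP p,
    ContMDiffAt IP 𝓘(ℝ, EB).tangent ∞
      (fun p => (⟨pr p, mfderiv IP 𝓘(ℝ, EB) pr p (X p)⟩ : TangentBundle 𝓘(ℝ, EB) Q)) p →
    ContMDiffAt IP 𝓘(ℝ, K) ∞ (fun p => mvfderiv IP κ p (X p)) p →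
    ContMDiffAt IP IP.tangent ∞ (fun p => (⟨p, X p⟩ : TangentBundle IP P)) p

variable (F) in
/-- Linear coordinates on the fibres of the prolongation. -/
def prolongTriv (q₀ : Q) (κ : P → K) (p : P) : prolongFibre ρ IP pr p →ₗ[ℝ] F × K :=
  ((coord F E q₀ (pr p)).prodMap (mvfderiv IP κ p).toLinearMap).comp
    (prolongFibre ρ IP pr p).subtype

lemma prolongTriv_apply (q₀ : Q) (κ : P → K) (p : P) (z : prolongFibre ρ IP pr p) :
    prolongTriv F q₀ κ p z = (coord F E q₀ (pr p) z.1.1, mvfderiv IP κ p z.1.2) := rfl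

lemma prolongTriv_bijective {κ : P → K} {U : Set P} (hκ : IsFibreCoord EB IP pr κ U) {p : P}
    (hp : p ∈ U) (hpq : pr p ∈ (trivializationAt F E q₀).baseSet) :
    Function.Bijective (prolongTriv (ρ := ρ) (IP := IP) (pr := pr) F q₀ κ p) := by
  constructor
  · intro z w h
    rw [prolongTriv_apply, prolongTriv_apply, Prod.mk.injEq] at h
    have h1 : z.1.1 = w.1.1 := (coord_bijective hpq).1 h.1
    refine Subtype.ext (Prod.ext h1 ((hκ.bijective p hp).1 (Prod.ext ?_ h.2)))
    have hz : ρ (pr p) z.1.1 = mfderiv IP 𝓘(ℝ, EB) pr p z.1.2 := z.2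
    have hw : ρ (pr p) w.1.1 = mfderiv IP 𝓘(ℝ, EB) pr p w.1.2 := w.2
    change mfderiv IP 𝓘(ℝ, EB) pr p z.1.2 = mfderiv IP 𝓘(ℝ, EB) pr p w.1.2
    rw [← hz, ← hw, h1]
  · rintro ⟨f, k⟩
    obtain ⟨a, ha⟩ := (coord_bijective (q₀ := q₀) hpq).2 f
    obtain ⟨v, hv⟩ := (hκ.bijective p hp).2 (ρ (pr p) a, k)
    simp only [Prod.mk.injEq] at hv
    exact ⟨⟨(a, v), hv.1.symm⟩, Prod.ext ha hv.2⟩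

include hO in
-- The horizontal part of the vector field carries no condition of its own: in the base chart it is
-- `R` applied to the `E`-coordinates.
lemma prolongation_smoothAt_iff (hpr : ContMDiff IP 𝓘(ℝ, EB) ∞ pr) {κ : P → K} {U : Set P}
    (hκ : IsFibreCoord EB IP pr κ U) {p : P} (hp : p ∈ U) (hpq : pr p ∈ O)
    (Z : ∀ p, prolongFibre ρ IP pr p) :
    (prolongation F ρ br IP pr).smoothAt Z p ↔
      ContMDiffAt IP 𝓘(ℝ, F × K) ∞ (fun p => prolongTriv F q₀ κ p (Z p)) p := by
  have hb := hO.subset_baseSet hpq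
  rw [contMDiffAt_prod_module_iff]
  constructor
  · intro hZ
    exact ⟨contMDiffAt_prolongCoord hpr hb hZ,
      contMDiffAt_mvfderiv_apply (g := fun p => p) (hκ.smooth p hp) hZ.2⟩
  · rintro ⟨h1, h2⟩
    refine ⟨(contMDiffAt_iff_coord (hpr p) hb).2 h1, hκ.smooth_vectorField p hp _ ?_ h2⟩
    rw [contMDiffAt_vectorField_iff (hpr p) (hO.subset_source hpq)]
    refine (((hO.smooth_R _ hpq).comp p (hpr p)).clm_apply h1).congr_of_eventuallyEq ?_
    filter_upwards [(hpr p).continuousAt.eventually (hO.isOpen.mem_nhds hpq)] with y hy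
    have h3 : ρ (pr y) (Z y).1.1 = mfderiv IP 𝓘(ℝ, EB) pr y (Z y).1.2 := (Z y).2
    rw [← h3, ← hO.anchor _ hy]
    rfl

end ProlongationLieAlgebroid

/-! ### Smoothness and the cyclic Jacobi identity for brackets of vector fields. -/

section Jacobi

variable {EM : Type*} [NormedAddCommGroup EM] [NormedSpace ℝ EM] [CompleteSpace EM]
  {HM : Type*} [TopologicalSpace HM] {IM : ModelWithCorners ℝ EM HM} [IM.Boundaryless]
  {M : Type*} [TopologicalSpace M] [ChartedSpace HM M] [IsManifold IM ∞ M]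

lemma ContMDiffAt.mlieBracket {X Y : ∀ x, TangentSpace IM x} {x : M}
    (hX : ContMDiffAt IM IM.tangent ∞ (fun x => (⟨x, X x⟩ : TangentBundle IM M)) x)
    (hY : ContMDiffAt IM IM.tangent ∞ (fun x => (⟨x, Y x⟩ : TangentBundle IM M)) x) :
    ContMDiffAt IM IM.tangent ∞
      (fun x => (⟨x, VectorField.mlieBracket IM X Y x⟩ : TangentBundle IM M)) x := by
  have h2 : minSmoothness ℝ 2 ≤ ∞ := by
    rw [minSmoothness_of_isRCLikeNormedField]
    exact ENat.LEInfty.out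
  have : IsManifold IM (minSmoothness ℝ 2) M := IsManifold.of_le (n := ∞) h2
  have : IsManifold IM ((⊤ : ℕ∞) + 1) M := ‹IsManifold IM ∞ M›
  exact ContMDiffAt.mlieBracket_vectorField (m := ⊤) (n := ⊤) hX hY (by simp)

lemma mlieBracket_jacobi {X Y Z : ∀ x, TangentSpace IM x} {x : M}
    (hX : ContMDiffAt IM IM.tangent ∞ (fun x => (⟨x, X x⟩ : TangentBundle IM M)) x)
    (hY : ContMDiffAt IM IM.tangent ∞ (fun x => (⟨x, Y x⟩ : TangentBundle IM M)) x)
    (hZ : ContMDiffAt IM IM.tangent ∞ (fun x => (⟨x, Z x⟩ : TangentBundle IM M)) x) :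
    VectorField.mlieBracket IM X (VectorField.mlieBracket IM Y Z) x +
      VectorField.mlieBracket IM Y (VectorField.mlieBracket IM Z X) x +
      VectorField.mlieBracket IM Z (VectorField.mlieBracket IM X Y) x = 0 := by
  have : IsManifold IM (minSmoothness ℝ 3) M := by
    rw [minSmoothness_of_isRCLikeNormedField]
    exact IsManifold.of_le (n := ∞) ENat.LEInfty.out
  have h2 : minSmoothness ℝ 2 ≤ ∞ := by
    rw [minSmoothness_of_isRCLikeNormedField]
    exact ENat.LEInfty.out
  have h := VectorField.leibniz_identity_mlieBracket_apply (hX.of_le h2) (hY.of_le h2)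
    (hZ.of_le h2)
  have h3 : VectorField.mlieBracket IM Y (VectorField.mlieBracket IM Z X) x =
      -VectorField.mlieBracket IM Y (VectorField.mlieBracket IM X Z) x := by
    rw [VectorField.mlieBracket_swap (V := Z) (W := X)]
    have h4 := VectorField.mlieBracket_const_smul_right (I := IM) (V := Y) (c := (-1 : ℝ))
      ((ContMDiffAt.mlieBracket hX hZ).mdifferentiableAt (by simp))
    simpa using h4
  have h5 : VectorField.mlieBracket IM Z (VectorField.mlieBracket IM X Y) x =
      -VectorField.mlieBracket IM (VectorField.mlieBracket IM X Y) Z x :=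
    VectorField.mlieBracket_swap_apply
  rw [h, h3, h5]
  abel

end Jacobi

/-! ### The Lie algebroid axioms for the prolongation. -/

section ProlongationLieAlgebroid

variable {EB : Type*} [NormedAddCommGroup EB] [NormedSpace ℝ EB] [FiniteDimensional ℝ EB]
  {Q : Type*} [TopologicalSpace Q] [ChartedSpace EB Q] [IsManifold 𝓘(ℝ, EB) ∞ Q] [T2Space Q]
  {F : Type*} [NormedAddCommGroup F] [NormedSpace ℝ F] [FiniteDimensional ℝ F]
  {E : Q → Type*} [TopologicalSpace (TotalSpace F E)]
  [∀ q, AddCommGroup (E q)] [∀ q, Module ℝ (E q)] [∀ q, TopologicalSpace (E q)]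
  [FiberBundle F E] [VectorBundle ℝ F E] [ContMDiffVectorBundle ∞ F E 𝓘(ℝ, EB)]
  {ρ : ∀ q, E q →L[ℝ] TangentSpace 𝓘(ℝ, EB) q}
  {br : (∀ q, E q) → (∀ q, E q) → ∀ q, E q}
  {EP : Type*} [NormedAddCommGroup EP] [NormedSpace ℝ EP] [FiniteDimensional ℝ EP]
  {HP : Type*} [TopologicalSpace HP] {IP : ModelWithCorners ℝ EP HP} [IP.Boundaryless]
  {P : Type*} [TopologicalSpace P] [ChartedSpace HP P] [IsManifold IP ∞ P] [T2Space P]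
  
  {pr : P → Q} {m : ℕ} (hm : Module.finrank ℝ F = m)
  (hE : (ofBundle F ρ br).IsLieAlgebroid m)
  {q₀ : Q} {O : Set Q} {R : Q → F →L[ℝ] EB} {C : Q → F →L[ℝ] F →L[ℝ] F}
  (hO : IsLocalForm ρ br q₀ O R C)
  {K : Type*} [NormedAddCommGroup K] [NormedSpace ℝ K] [FiniteDimensional ℝ K]

lemma prolongCoord_add (Z W : ∀ p, prolongFibre ρ IP pr p) :
    prolongCoord F q₀ (Z + W) = fun p => prolongCoord F q₀ Z p + prolongCoord F q₀ W p :=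
  funext fun _ => map_add _ _ _

lemma prolongCoord_smul (f : P → ℝ) (Z : ∀ p, prolongFibre ρ IP pr p) :
    prolongCoord F q₀ (fun p => f p • Z p) = fun p => f p • prolongCoord F q₀ Z p :=
  funext fun _ => map_smul _ _ _

include hE in
lemma prolongation_isSmoothBundle (hpr : ContMDiff IP 𝓘(ℝ, EB) ∞ pr)
    (hκ : ∀ p, ∃ (κ : P → K) (U : Set P), p ∈ U ∧ IsFibreCoord EB IP pr κ U) :
    (prolongation F ρ br IP pr).IsSmoothBundle (Module.finrank ℝ F + Module.finrank ℝ K) := by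
  refine AlgebroidData.isSmoothBundle_of_coords (G := F × K) Module.finrank_prod fun p₀ => ?_
  obtain ⟨κ, U, hp₀, hκ⟩ := hκ p₀
  obtain ⟨O, R, C, hq, hO⟩ := exists_isLocalForm hE (pr p₀)
  refine ⟨U ∩ pr ⁻¹' O, Filter.inter_mem (hκ.isOpen.mem_nhds hp₀)
    ((hpr p₀).continuousAt.preimage_mem_nhds (hO.isOpen.mem_nhds hq)), prolongTriv F (pr p₀) κ, ?_⟩
  rintro p ⟨hp, hpO⟩
  exact ⟨prolongTriv_bijective hκ hp (hO.subset_baseSet hpO),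
    prolongation_smoothAt_iff hO hpr hκ hp hpO⟩

include hm hE in
lemma prolongation_bracket_smoothAt (hpr : ContMDiff IP 𝓘(ℝ, EB) ∞ pr)
    {Z W : ∀ p, prolongFibre ρ IP pr p} (hZ : (prolongation F ρ br IP pr).IsSmooth Z)
    (hW : (prolongation F ρ br IP pr).IsSmooth W) :
    (prolongation F ρ br IP pr).IsSmooth ((prolongation F ρ br IP pr).bracket Z W) := by
  intro p
  obtain ⟨O, R, C, hq, hO⟩ := exists_isLocalForm hE (pr p)
  have hb := hO.subset_baseSet hq
  constructor
  · refine (contMDiffAt_iff_coord (hpr p) hb).2 ?_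
    have hz := contMDiffAt_prolongCoord hpr hb (hZ p)
    have hw := contMDiffAt_prolongCoord hpr hb (hW p)
    refine ContMDiffAt.congr_of_eventuallyEq
      (((contMDiffAt_mvfderiv_apply (g := fun p => p) hw (hZ p).2).sub
        (contMDiffAt_mvfderiv_apply (g := fun p => p) hz (hW p).2)).add
      ((((hO.smooth_C _ hq).comp p (hpr p)).clm_apply hz).clm_apply hw)) ?_
    filter_upwards [(hpr p).continuousAt.eventually (hO.isOpen.mem_nhds hq)] with y hy
    exact prolongCoord_bracket hm hE hO hpr hy (hZ y) (hW y)
  · have h := ContMDiffAt.mlieBracket (hZ p).2 (hW p).2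
    convert h using 2 with y
    rw [prolongation_bracket_snd hm hE hpr (hZ y) (hW y)]

include hm hE in
lemma prolongation_leibniz (hpr : ContMDiff IP 𝓘(ℝ, EB) ∞ pr) {f : P → ℝ}
    (hf : ContMDiff IP 𝓘(ℝ, ℝ) ∞ f) {Z W : ∀ p, prolongFibre ρ IP pr p}
    (hZ : (prolongation F ρ br IP pr).IsSmooth Z) (hW : (prolongation F ρ br IP pr).IsSmooth W)
    (hfW : (prolongation F ρ br IP pr).IsSmooth (fun p => f p • W p)) :
    (prolongation F ρ br IP pr).bracket Z (fun p => f p • W p) =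
      fun p => f p • (prolongation F ρ br IP pr).bracket Z W p +
        (prolongation F ρ br IP pr).deriv f p (Z p) • W p := by
  funext p
  obtain ⟨O, R, C, hq, hO⟩ := exists_isLocalForm hE (pr p)
  have hb := hO.subset_baseSet hq
  have hfp := (hf p).mdifferentiableAt (n := ∞) (by simp)
  have hd : (prolongation F ρ br IP pr).deriv f p (Z p) = mvfderiv IP f p (Z p).1.2 := rfl
  refine prolongFibre_ext hb ?_ ?_
  · change prolongCoord F (pr p) _ p = coord F E (pr p) (pr p)
      (f p • ((prolongation F ρ br IP pr).bracket Z W p).1.1 +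
        (prolongation F ρ br IP pr).deriv f p (Z p) • (W p).1.1)
    rw [map_add, map_smul, map_smul]
    change _ = f p • prolongCoord F (pr p) ((prolongation F ρ br IP pr).bracket Z W) p +
      _ • prolongCoord F (pr p) W p
    have hw := (contMDiffAt_prolongCoord hpr hb (hW p)).mdifferentiableAt (n := ∞) (by simp)
    have h3 := mvfderiv_bilin (ContinuousLinearMap.lsmul ℝ ℝ : ℝ →L[ℝ] F →L[ℝ] F) hfp hw
      (Z p).1.2
    simp only [ContinuousLinearMap.lsmul_apply] at h3
    rw [prolongCoord_bracket hm hE hO hpr hq (hZ p) (hW p),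
      prolongCoord_bracket hm hE hO hpr hq (hZ p) (hfW p), prolongCoord_smul, h3, hd, map_smul]
    have h4 : mvfderiv IP (prolongCoord F (pr p) Z) p (f p • W p).1.2 =
      f p • mvfderiv IP (prolongCoord F (pr p) Z) p (W p).1.2 := map_smul _ _ _
    rw [h4]
    module
  · change _ = f p • ((prolongation F ρ br IP pr).bracket Z W p).1.2 +
        (prolongation F ρ br IP pr).deriv f p (Z p) • (W p).1.2
    rw [prolongation_bracket_snd hm hE hpr (hZ p) (hW p),
      prolongation_bracket_snd hm hE hpr (hZ p) (hfW p), hd, add_comm]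
    exact VectorField.mlieBracket_smul_right hfp ((hW p).2.mdifferentiableAt (by simp))

set_option synthInstance.maxHeartbeats 200000 in
include hm hE hO in
-- The product rule applied to the coordinate formula of the inner bracket, with `[W, T]` acting as
-- a commutator. Fully expanded, so that the cyclic sum in the Jacobi identity can be cancelled
-- termwise.
lemma prolongCoord_bracket_bracket (hpr : ContMDiff IP 𝓘(ℝ, EB) ∞ pr)
    {Z W T : ∀ p, prolongFibre ρ IP pr p} (hZ : (prolongation F ρ br IP pr).IsSmooth Z)
    (hW : (prolongation F ρ br IP pr).IsSmooth W) (hT : (prolongation F ρ br IP pr).IsSmooth T)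
    {p : P} (hp : pr p ∈ O) :
    prolongCoord F q₀ ((prolongation F ρ br IP pr).bracket Z
        ((prolongation F ρ br IP pr).bracket W T)) p =
      mvfderiv IP (fun y => mvfderiv IP (prolongCoord F q₀ T) y (W y).1.2) p (Z p).1.2 -
      mvfderiv IP (fun y => mvfderiv IP (prolongCoord F q₀ W) y (T y).1.2) p (Z p).1.2 +
      mvfderiv 𝓘(ℝ, EB) C (pr p) (ρ (pr p) (Z p).1.1) (prolongCoord F q₀ W p)
        (prolongCoord F q₀ T p) +
      C (pr p) (mvfderiv IP (prolongCoord F q₀ W) p (Z p).1.2) (prolongCoord F q₀ T p) +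
      C (pr p) (prolongCoord F q₀ W p) (mvfderiv IP (prolongCoord F q₀ T) p (Z p).1.2) -
      (mvfderiv IP (fun y => mvfderiv IP (prolongCoord F q₀ Z) y (T y).1.2) p (W p).1.2 -
        mvfderiv IP (fun y => mvfderiv IP (prolongCoord F q₀ Z) y (W y).1.2) p (T p).1.2) +
      C (pr p) (prolongCoord F q₀ Z p) (mvfderiv IP (prolongCoord F q₀ T) p (W p).1.2) -
      C (pr p) (prolongCoord F q₀ Z p) (mvfderiv IP (prolongCoord F q₀ W) p (T p).1.2) +
      C (pr p) (prolongCoord F q₀ Z p) (C (pr p) (prolongCoord F q₀ W p)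
        (prolongCoord F q₀ T p)) := by
  have hb := hO.subset_baseSet hp
  have hWT := prolongation_bracket_smoothAt hm hE hpr hW hT
  have hz := contMDiffAt_prolongCoord hpr hb (hZ p)
  have hw := contMDiffAt_prolongCoord hpr hb (hW p)
  have ht := contMDiffAt_prolongCoord hpr hb (hT p)
  have hC := (hO.smooth_C _ hp).comp p (hpr p)
  have hev : prolongCoord F q₀ ((prolongation F ρ br IP pr).bracket W T) =ᶠ[𝓝 p] fun y =>
      mvfderiv IP (prolongCoord F q₀ T) y (W y).1.2 -
      mvfderiv IP (prolongCoord F q₀ W) y (T y).1.2 +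
      C (pr y) (prolongCoord F q₀ W y) (prolongCoord F q₀ T y) := by
    filter_upwards [(hpr p).continuousAt.eventually (hO.isOpen.mem_nhds hp)] with y hy
    exact prolongCoord_bracket hm hE hO hpr hy (hW y) (hT y)
  have d1 := (contMDiffAt_mvfderiv_apply (g := fun p => p) ht (hW p).2).mdifferentiableAt
    (n := ∞) (by simp)
  have d2 := (contMDiffAt_mvfderiv_apply (g := fun p => p) hw (hT p).2).mdifferentiableAt
    (n := ∞) (by simp)
  have hCw : MDifferentiableAt IP 𝓘(ℝ, F →L[ℝ] F) (fun y => C (pr y) (prolongCoord F q₀ W y)) p :=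
    (hC.clm_apply hw).mdifferentiableAt (by simp)
  have d3 : MDifferentiableAt IP 𝓘(ℝ, F)
      (fun y => C (pr y) (prolongCoord F q₀ W y) (prolongCoord F q₀ T y)) p :=
    ((hC.clm_apply hw).clm_apply ht).mdifferentiableAt (by simp)
  have e1 := mvfderiv_bilin (ContinuousLinearMap.id ℝ (F →L[ℝ] F)) hCw
    (ht.mdifferentiableAt (by simp)) (Z p).1.2
  have e2 := mvfderiv_bilin (ContinuousLinearMap.id ℝ (F →L[ℝ] F →L[ℝ] F))
    (f := fun y => C (pr y)) (hC.mdifferentiableAt (by simp))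
    (hw.mdifferentiableAt (by simp)) (Z p).1.2
  have e3 := mvfderiv_comp' ((hO.smooth_C _ hp).mdifferentiableAt (by simp))
    ((hpr p).mdifferentiableAt (by simp)) (Z p).1.2
  have e4 : ρ (pr p) (Z p).1.1 = mfderiv IP 𝓘(ℝ, EB) pr p (Z p).1.2 := (Z p).2
  simp only [ContinuousLinearMap.id_apply] at e1 e2
  have e5 : mvfderiv IP (fun y => mvfderiv IP (prolongCoord F q₀ T) y (W y).1.2 -
      mvfderiv IP (prolongCoord F q₀ W) y (T y).1.2 +
      C (pr y) (prolongCoord F q₀ W y) (prolongCoord F q₀ T y)) p (Z p).1.2 =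
      mvfderiv IP (fun y => mvfderiv IP (prolongCoord F q₀ T) y (W y).1.2) p (Z p).1.2 -
      mvfderiv IP (fun y => mvfderiv IP (prolongCoord F q₀ W) y (T y).1.2) p (Z p).1.2 +
      mvfderiv IP (fun y => C (pr y) (prolongCoord F q₀ W y) (prolongCoord F q₀ T y)) p
        (Z p).1.2 := by
    have d12 : MDifferentiableAt IP 𝓘(ℝ, F) (fun y =>
        mvfderiv IP (prolongCoord F q₀ T) y (W y).1.2 -
        mvfderiv IP (prolongCoord F q₀ W) y (T y).1.2) p := d1.sub d2
    rw [mvfderiv_fun_add d12 d3, mvfderiv_fun_sub d1 d2]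
    rfl
  rw [prolongCoord_bracket hm hE hO hpr hp (hZ p) (hWT p), hev.mvfderiv_eq, e5, e1, e2, e3, ← e4,
    prolongation_bracket_snd hm hE hpr (hW p) (hT p), mvfderiv_mlieBracket hz
      ((hW p).2.mdifferentiableAt (by simp)) ((hT p).2.mdifferentiableAt (by simp)),
    prolongCoord_bracket hm hE hO hpr hp (hW p) (hT p)]
  simp only [map_add, map_sub, add_apply]
  abel

include hm hE in
/-- The prolongation of a Lie algebroid over a fibration is a Lie algebroid. -/
theorem prolongation_isLieAlgebroid (hpr : ContMDiff IP 𝓘(ℝ, EB) ∞ pr)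
    (hκ : ∀ p, ∃ (κ : P → K) (U : Set P), p ∈ U ∧ IsFibreCoord EB IP pr κ U) :
    (prolongation F ρ br IP pr).IsLieAlgebroid (Module.finrank ℝ F + Module.finrank ℝ K) := by
  have hB := prolongation_isSmoothBundle (K := K) hE hpr hκ
  have hbr : ∀ Z W, (prolongation F ρ br IP pr).IsSmooth Z →
      (prolongation F ρ br IP pr).IsSmooth W →
      (prolongation F ρ br IP pr).IsSmooth ((prolongation F ρ br IP pr).bracket Z W) :=
    fun Z W hZ hW => prolongation_bracket_smoothAt hm hE hpr hZ hW
  have hlz : ∀ (f : P → ℝ) σ τ, ContMDiff IP 𝓘(ℝ, ℝ) ∞ f →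
      (prolongation F ρ br IP pr).IsSmooth σ → (prolongation F ρ br IP pr).IsSmooth τ →
      (prolongation F ρ br IP pr).bracket σ (fun x => f x • τ x) =
        fun x => f x • (prolongation F ρ br IP pr).bracket σ τ x +
          (prolongation F ρ br IP pr).deriv f x (σ x) • τ x := fun f σ τ hf hσ hτ =>
    prolongation_leibniz hm hE hpr hf hσ hτ (hB.isSmooth_smul hf hτ)
  refine ⟨hB, fun σ hσ p => (hσ p).2, hbr, ?_, ?_, ?_, ?_, hlz⟩
  · intro σ τ₁ τ₂ hσ h₁ h₂
    funext p
    obtain ⟨O, R, C, hq, hO⟩ := exists_isLocalForm hE (pr p)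
    have hb := hO.subset_baseSet hq
    have h12 := hB.isSmooth_add h₁ h₂
    refine prolongFibre_ext hb ?_ ?_
    · change prolongCoord F (pr p) _ p = coord F E (pr p) (pr p)
        (((prolongation F ρ br IP pr).bracket σ τ₁ p).1.1 +
          ((prolongation F ρ br IP pr).bracket σ τ₂ p).1.1)
      rw [map_add]
      change _ = prolongCoord F (pr p) ((prolongation F ρ br IP pr).bracket σ τ₁) p +
        prolongCoord F (pr p) ((prolongation F ρ br IP pr).bracket σ τ₂) p
      rw [prolongCoord_bracket hm hE hO hpr hq (hσ p) (h₁ p),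
        prolongCoord_bracket hm hE hO hpr hq (hσ p) (h₂ p),
        prolongCoord_bracket hm hE hO hpr hq (hσ p) (h12 p), prolongCoord_add,
        mvfderiv_fun_add
          ((contMDiffAt_prolongCoord hpr hb (h₁ p)).mdifferentiableAt (by simp))
          ((contMDiffAt_prolongCoord hpr hb (h₂ p)).mdifferentiableAt (by simp))]
      have h4 : mvfderiv IP (prolongCoord F (pr p) σ) p ((τ₁ + τ₂) p).1.2 =
        mvfderiv IP (prolongCoord F (pr p) σ) p (τ₁ p).1.2 +
          mvfderiv IP (prolongCoord F (pr p) σ) p (τ₂ p).1.2 := map_add _ _ _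
      rw [h4, map_add, add_apply]
      abel
    · change _ = ((prolongation F ρ br IP pr).bracket σ τ₁ p).1.2 +
          ((prolongation F ρ br IP pr).bracket σ τ₂ p).1.2
      rw [prolongation_bracket_snd hm hE hpr (hσ p) (h₁ p),
        prolongation_bracket_snd hm hE hpr (hσ p) (h₂ p),
        prolongation_bracket_snd hm hE hpr (hσ p) (h12 p)]
      exact VectorField.mlieBracket_add_right ((h₁ p).2.mdifferentiableAt (by simp))
        ((h₂ p).2.mdifferentiableAt (by simp))
  · intro c σ τ hσ hτ
    -- Homogeneity is the Leibniz rule for a constant function.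
    refine (hlz (fun _ => c) σ τ contMDiff_const hσ hτ).trans ?_
    funext p
    have h : (prolongation F ρ br IP pr).deriv (fun _ => c) p (σ p) = 0 := by
      rw [AlgebroidData.deriv_eq, mvfderiv_const]
      rfl
    simp only [h, zero_smul, add_zero]
    rfl
  · intro σ τ hσ hτ
    funext p
    obtain ⟨O, R, C, hq, hO⟩ := exists_isLocalForm hE (pr p)
    refine prolongFibre_ext (hO.subset_baseSet hq) ?_ ?_
    · change prolongCoord F (pr p) _ p = coord F E (pr p) (pr p)
        (-((prolongation F ρ br IP pr).bracket τ σ p).1.1)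
      rw [map_neg]
      change _ = -prolongCoord F (pr p) ((prolongation F ρ br IP pr).bracket τ σ) p
      rw [prolongCoord_bracket hm hE hO hpr hq (hσ p) (hτ p),
        prolongCoord_bracket hm hE hO hpr hq (hτ p) (hσ p), hO.antisymm _ hq]
      abel
    · change _ = -((prolongation F ρ br IP pr).bracket τ σ p).1.2
      rw [prolongation_bracket_snd hm hE hpr (hσ p) (hτ p),
        prolongation_bracket_snd hm hE hpr (hτ p) (hσ p)]
      exact VectorField.mlieBracket_swap_apply
  · intro σ τ υ hσ hτ hυ
    funext p
    obtain ⟨O, R, C, hq, hO⟩ := exists_isLocalForm hE (pr p)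
    refine prolongFibre_ext (hO.subset_baseSet hq) ?_ ?_
    · change coord F E (pr p) (pr p) (((prolongation F ρ br IP pr).bracket σ
        ((prolongation F ρ br IP pr).bracket τ υ) p).1.1 + ((prolongation F ρ br IP pr).bracket τ
        ((prolongation F ρ br IP pr).bracket υ σ) p).1.1 + ((prolongation F ρ br IP pr).bracket υ
        ((prolongation F ρ br IP pr).bracket σ τ) p).1.1) = coord F E (pr p) (pr p) 0
      rw [map_add, map_add, map_zero]
      have h1 := prolongCoord_bracket_bracket hm hE hO hpr hσ hτ hυ hq
      have h2 := prolongCoord_bracket_bracket hm hE hO hpr hτ hυ hσ hq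
      have h3 := prolongCoord_bracket_bracket hm hE hO hpr hυ hσ hτ hq
      let D : prolongFibre ρ IP pr p → F → F → F := fun z =>
        fun a b => mvfderiv 𝓘(ℝ, EB) C (pr p) (ρ (pr p) z.1.1) a b
      have hj : ∀ s t u, s = prolongCoord F (pr p) σ p → t = prolongCoord F (pr p) τ p →
          u = prolongCoord F (pr p) υ p →
          (D (σ p) t u + C (pr p) s (C (pr p) t u)) + (D (τ p) u s + C (pr p) t (C (pr p) u s)) +
          (D (υ p) s t + C (pr p) u (C (pr p) s t)) = 0 := by
        rintro _ _ _ rfl rfl rfl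
        exact hO.jacobi _ hq (σ p).1.1 (τ p).1.1 (υ p).1.1
      refine Eq.trans (congr_arg₂ (· + ·) (congr_arg₂ (· + ·) h1 h2) h3) ?_
      have ha := hO.antisymm _ hq
      -- In the cyclic sum the iterated derivatives cancel. Of the twelve terms with one derivative
      -- inside `C`, six cancel directly and six in antisymmetric pairs, for which these three are
      -- turned round. The remainder is `hj`.
      rw [ha (mvfderiv IP (prolongCoord F (pr p) τ) p (σ p).1.2),
        ha (mvfderiv IP (prolongCoord F (pr p) υ) p (τ p).1.2),
        ha (mvfderiv IP (prolongCoord F (pr p) σ) p (υ p).1.2)]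
      refine Eq.trans ?_ (hj _ _ _ rfl rfl rfl)
      simp only [D]
      abel
    · change ((prolongation F ρ br IP pr).bracket σ
        ((prolongation F ρ br IP pr).bracket τ υ) p).1.2 + ((prolongation F ρ br IP pr).bracket τ
        ((prolongation F ρ br IP pr).bracket υ σ) p).1.2 + ((prolongation F ρ br IP pr).bracket υ
        ((prolongation F ρ br IP pr).bracket σ τ) p).1.2 = 0
      have h : ∀ {Z W T}, (prolongation F ρ br IP pr).IsSmooth Z →
          (prolongation F ρ br IP pr).IsSmooth W → (prolongation F ρ br IP pr).IsSmooth T →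
          ((prolongation F ρ br IP pr).bracket Z
            ((prolongation F ρ br IP pr).bracket W T) p).1.2 =
          VectorField.mlieBracket IP (fun p => (Z p).1.2) (VectorField.mlieBracket IP
            (fun p => (W p).1.2) (fun p => (T p).1.2)) p := by
        intro Z W T hZ hW hT
        rw [prolongation_bracket_snd hm hE hpr (hZ p) (hbr _ _ hW hT p)]
        congr 1
        funext y
        exact prolongation_bracket_snd hm hE hpr (hW y) (hT y)
      rw [h hσ hτ hυ, h hτ hυ hσ, h hυ hσ hτ]
      exact mlieBracket_jacobi (hσ p).2 (hτ p).2 (hυ p).2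

end ProlongationLieAlgebroid

/-- Needed for cutoff functions on `E* × ℝ`. Points of one fibre are separated in a trivialisation,
points of different fibres by the base. -/
lemma t2Space_totalSpace {B : Type*} [TopologicalSpace B] [T2Space B] {F : Type*}
    [TopologicalSpace F] [T2Space F] {E : B → Type*} [TopologicalSpace (TotalSpace F E)]
    [∀ b, TopologicalSpace (E b)] [FiberBundle F E] : T2Space (TotalSpace F E) := by
  refine ⟨fun x y hxy => ?_⟩
  by_cases h : x.proj = y.proj
  · set e := trivializationAt F E x.proj
    have hx : x ∈ e.source := FiberBundle.mem_trivializationAt_proj_source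
    have hy : y ∈ e.source := by
      rw [Trivialization.mem_source, ← h]
      exact mem_baseSet_trivializationAt F E x.proj
    obtain ⟨u, v, hu, hv, hxu, hyv, huv⟩ := t2_separation
      (fun he => hxy (e.injOn hx hy he) : e x ≠ e y)
    refine ⟨e.source ∩ e ⁻¹' u, e.source ∩ e ⁻¹' v,
      e.toOpenPartialHomeomorph.isOpen_inter_preimage hu,
      e.toOpenPartialHomeomorph.isOpen_inter_preimage hv, ⟨hx, hxu⟩, ⟨hy, hyv⟩, ?_⟩
    exact ((huv.preimage e).mono inter_subset_right inter_subset_right)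
  · obtain ⟨u, v, hu, hv, hxu, hyv, huv⟩ := t2_separation h
    exact ⟨_, _, hu.preimage (FiberBundle.continuous_proj F E),
      hv.preimage (FiberBundle.continuous_proj F E), hxu, hyv, huv.preimage _⟩

/-! ### Fibre coordinates on `E* × ℝ`. -/

section PhaseCoordinates

variable {EB : Type*} [NormedAddCommGroup EB] [NormedSpace ℝ EB] [FiniteDimensional ℝ EB]
  {Q : Type*} [TopologicalSpace Q] [ChartedSpace EB Q] [IsManifold 𝓘(ℝ, EB) ∞ Q] [T2Space Q]
  {F : Type*} [NormedAddCommGroup F] [NormedSpace ℝ F] [FiniteDimensional ℝ F]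
  {E : Q → Type*} [TopologicalSpace (TotalSpace F E)]
  [∀ q, AddCommGroup (E q)] [∀ q, Module ℝ (E q)] [∀ q, TopologicalSpace (E q)]
  [FiberBundle F E] [VectorBundle ℝ F E] [ContMDiffVectorBundle ∞ F E 𝓘(ℝ, EB)]

instance : T2Space (Phase F E) := by
  have : T2Space (TotalSpace (F →L[ℝ] ℝ) (Dual E)) := t2Space_totalSpace
  infer_instance

variable (F E) in
/-- Linear coordinates on the fibres of the dual bundle. -/
abbrev dualCoord (q₀ q : Q) : Dual E q →ₗ[ℝ] (F →L[ℝ] ℝ) := coord (F →L[ℝ] ℝ) (Dual E) q₀ q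

lemma mem_baseSet_dual {q₀ q : Q} (hq : q ∈ (trivializationAt F E q₀).baseSet) :
    q ∈ (trivializationAt (F →L[ℝ] ℝ) (Dual E) q₀).baseSet := by
  rw [hom_trivializationAt_baseSet]
  exact ⟨hq, mem_univ _⟩

/-- The dual bundle is trivialised by conjugation with the trivialisation of `E`, so the coordinates
respect the pairing. This is what puts the Liouville section in its usual form. -/
lemma dualCoord_apply {q₀ q : Q} (hq : q ∈ (trivializationAt F E q₀).baseSet) (b : Dual E q)
    (a : E q) : dualCoord F E q₀ q b (coord F E q₀ q a) = b a := by
  rw [dualCoord, coord_apply (mem_baseSet_dual hq), hom_trivializationAt_apply]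
  have h := (trivializationAt F E q₀).symmL_continuousLinearMapAt (R := ℝ) hq a
  simp only [ContinuousLinearMap.inCoordinates, ContinuousLinearMap.comp_apply]
  have h2 : (trivializationAt F E q₀).symmL ℝ q (coord F E q₀ q a) = a := h
  rw [h2]
  simp

variable (F E) in
/-- The fibre coordinates of the phase space near `q₀`. -/
def phaseCoord (q₀ : Q) (p : Phase F E) : (F →L[ℝ] ℝ) × ℝ :=
  (dualCoord F E q₀ p.1.proj p.1.2, p.2)

lemma contMDiff_phaseProj : ContMDiff (phaseModel EB F) 𝓘(ℝ, EB) ∞ (phaseProj F E) :=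
  (Bundle.contMDiff_proj (n := ∞) (IB := 𝓘(ℝ, EB)) (F := F →L[ℝ] ℝ) (Dual E)).comp contMDiff_fst

variable (F E) in
/-- The domain of the fibre coordinates of the phase space. -/
def phaseDomain (q₀ : Q) : Set (Phase F E) :=
  phaseProj F E ⁻¹' ((trivializationAt F E q₀).baseSet ∩ (extChartAt 𝓘(ℝ, EB) q₀).source)

lemma isOpen_phaseDomain (q₀ : Q) : IsOpen (phaseDomain (EB := EB) F E q₀) :=
  ((trivializationAt F E q₀).open_baseSet.inter (isOpen_extChartAt_source q₀)).preimage
    (contMDiff_phaseProj (EB := EB)).continuous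

lemma mem_phaseDomain (p : Phase F E) : p ∈ phaseDomain (EB := EB) F E p.1.proj :=
  ⟨mem_baseSet_trivializationAt F E _, mem_extChartAt_source _⟩

lemma contMDiffAt_phaseCoord {q₀ : Q} {p : Phase F E}
    (hp : p ∈ phaseDomain (EB := EB) F E q₀) :
    ContMDiffAt (phaseModel EB F) 𝓘(ℝ, (F →L[ℝ] ℝ) × ℝ) ∞ (phaseCoord F E q₀) p := by
  rw [contMDiffAt_prod_module_iff]
  refine ⟨?_, contMDiffAt_snd⟩
  exact (contMDiffAt_iff_coord (F := F →L[ℝ] ℝ) (E := Dual E) (f := phaseProj F E)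
    (s := fun p => p.1.2) (contMDiff_phaseProj p) (mem_baseSet_dual hp.1)).1 contMDiffAt_fst

/-- The chart of a vector bundle is its trivialisation followed by the chart of the base; the zero
point over `q₀` serves as the centre. -/
lemma extChartAt_phase_eq {q₀ : Q} {p : Phase F E} (hp : p ∈ phaseDomain (EB := EB) F E q₀) :
    extChartAt (phaseModel EB F) ((⟨q₀, 0⟩, 0) : Phase F E) p =
      ((extChartAt 𝓘(ℝ, EB) q₀ p.1.proj, (phaseCoord F E q₀ p).1), (phaseCoord F E q₀ p).2) := by
  have hb := mem_baseSet_dual hp.1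
  have h1 : (trivializationAt (F →L[ℝ] ℝ) (Dual E) q₀ p.1).1 = p.1.proj :=
    Trivialization.coe_fst' _ hb
  rw [phaseCoord, dualCoord, coord_apply hb]
  simp only [extChartAt_prod, FiberBundle.extChartAt, PartialEquiv.prod_coe,
    PartialEquiv.coe_trans, Function.comp_apply, PartialEquiv.refl_coe, id]
  refine Prod.ext (Prod.ext ?_ rfl) rfl
  exact congr_arg (extChartAt 𝓘(ℝ, EB) q₀) h1

lemma mem_extChartAt_phase_source {q₀ : Q} {p : Phase F E}
    (hp : p ∈ phaseDomain (EB := EB) F E q₀) :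
    p ∈ (extChartAt (phaseModel EB F) ((⟨q₀, 0⟩, 0) : Phase F E)).source := by
  have hb := mem_baseSet_dual hp.1
  have h1 : (trivializationAt (F →L[ℝ] ℝ) (Dual E) q₀ p.1).1 = p.1.proj :=
    Trivialization.coe_fst' _ hb
  have h2 : p.1 ∈ (trivializationAt (F →L[ℝ] ℝ) (Dual E) q₀).source :=
    (Trivialization.mem_source _).2 hb
  have h3 := hp.2
  rw [extChartAt_prod, PartialEquiv.prod_source, FiberBundle.extChartAt, PartialEquiv.trans_source]
  refine ⟨⟨h2, ?_⟩, by rw [extChartAt_source]; exact mem_chart_source ℝ p.2⟩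
  refine ⟨?_, mem_univ _⟩
  change (trivializationAt (F →L[ℝ] ℝ) (Dual E) q₀ p.1).1 ∈ _
  rw [h1]
  exact h3

lemma mvfderiv_extChartAt_phase {q₀ : Q} {p : Phase F E}
    (hp : p ∈ phaseDomain (EB := EB) F E q₀) (v : TangentSpace (phaseModel EB F) p) :
    mvfderiv (phaseModel EB F)
      (extChartAt (phaseModel EB F) ((⟨q₀, 0⟩, 0) : Phase F E)) p v =
      ((mvfderiv 𝓘(ℝ, EB) (extChartAt 𝓘(ℝ, EB) q₀) p.1.proj
          (mfderiv (phaseModel EB F) 𝓘(ℝ, EB) (phaseProj F E) p v),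
        (mvfderiv (phaseModel EB F) (phaseCoord F E q₀) p v).1),
        (mvfderiv (phaseModel EB F) (phaseCoord F E q₀) p v).2) := by
  have hs := mem_extChartAt_phase_source hp
  have hev : ∀ᶠ y in 𝓝 p, y ∈ phaseDomain (EB := EB) F E q₀ := (isOpen_phaseDomain q₀).mem_nhds hp
  have hd : MDifferentiableAt (phaseModel EB F) 𝓘(ℝ, (EB × (F →L[ℝ] ℝ)) × ℝ)
      (extChartAt (phaseModel EB F) ((⟨q₀, 0⟩, 0) : Phase F E)) p :=
    (contMDiffAt_extChartAt' (n := ∞) (by rwa [extChartAt_source] at hs)).mdifferentiableAt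
      (by simp)
  have hκ := (contMDiffAt_phaseCoord hp).mdifferentiableAt (n := ∞) (by simp)
  have hφ : MDifferentiableAt 𝓘(ℝ, EB) 𝓘(ℝ, EB) (extChartAt 𝓘(ℝ, EB) q₀) (phaseProj F E p) :=
    (contMDiffAt_extChartAt' (n := ∞)
      (by have := hp.2; rwa [extChartAt_source] at this)).mdifferentiableAt (by simp)
  refine Prod.ext (Prod.ext ?_ ?_) ?_
  · refine (mvfderiv_clm_comp ((ContinuousLinearMap.fst ℝ EB (F →L[ℝ] ℝ)).comp
      (ContinuousLinearMap.fst ℝ (EB × (F →L[ℝ] ℝ)) ℝ)) hd v).symm.trans ?_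
    refine Eq.trans ?_ (mvfderiv_comp' hφ ((contMDiff_phaseProj p).mdifferentiableAt
      (n := ∞) (by simp)) v)
    refine DFunLike.congr_fun (Filter.EventuallyEq.mvfderiv_eq ?_) v
    filter_upwards [hev] with y hy
    exact congr_arg (fun z => z.1.1) (extChartAt_phase_eq hy)
  · refine (mvfderiv_clm_comp ((ContinuousLinearMap.snd ℝ EB (F →L[ℝ] ℝ)).comp
      (ContinuousLinearMap.fst ℝ (EB × (F →L[ℝ] ℝ)) ℝ)) hd v).symm.trans ?_
    refine Eq.trans ?_ (mvfderiv_clm_comp (ContinuousLinearMap.fst ℝ (F →L[ℝ] ℝ) ℝ) hκ v)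
    refine DFunLike.congr_fun (Filter.EventuallyEq.mvfderiv_eq ?_) v
    filter_upwards [hev] with y hy
    exact congr_arg (fun z => z.1.2) (extChartAt_phase_eq hy)
  · refine (mvfderiv_clm_comp (ContinuousLinearMap.snd ℝ (EB × (F →L[ℝ] ℝ)) ℝ) hd v).symm.trans ?_
    refine Eq.trans ?_ (mvfderiv_clm_comp (ContinuousLinearMap.snd ℝ (F →L[ℝ] ℝ) ℝ) hκ v)
    refine DFunLike.congr_fun (Filter.EventuallyEq.mvfderiv_eq ?_) v
    filter_upwards [hev] with y hy
    exact congr_arg (fun z => z.2) (extChartAt_phase_eq hy)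

/-- The chart of `E* × ℝ` consists of the base chart and the fibre coordinates. The derivatives of
the projection and of the fibre coordinates together are therefore its derivative, up to the
invertible derivative of the base chart. -/
lemma isFibreCoord_phaseCoord (q₀ : Q) :
    IsFibreCoord EB (phaseModel EB F) (phaseProj F E) (phaseCoord F E q₀)
      (phaseDomain (EB := EB) F E q₀) := by
  refine ⟨isOpen_phaseDomain q₀, fun p hp => contMDiffAt_phaseCoord hp, fun p hp => ?_,
    fun p hp X h1 h2 => ?_⟩
  · have hb := mvfderiv_extChartAt_bijective (IM := phaseModel EB F)
      (mem_extChartAt_phase_source hp)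
    have hφ := mvfderiv_extChartAt_bijective (IM := 𝓘(ℝ, EB)) hp.2
    constructor
    · intro v w h
      simp only [Prod.mk.injEq] at h
      refine hb.1 ?_
      rw [mvfderiv_extChartAt_phase hp, mvfderiv_extChartAt_phase hp, h.1, h.2]
    · rintro ⟨u, k⟩
      obtain ⟨v, hv⟩ := hb.2 ((mvfderiv 𝓘(ℝ, EB) (extChartAt 𝓘(ℝ, EB) q₀) p.1.proj u, k.1), k.2)
      rw [mvfderiv_extChartAt_phase hp] at hv
      simp only [Prod.mk.injEq] at hv
      exact ⟨v, Prod.ext (hφ.1 hv.1.1) (Prod.ext hv.1.2 hv.2)⟩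
  · refine (contMDiffAt_vectorField_iff (g := fun y => y) contMDiffAt_id
      (mem_extChartAt_phase_source hp)).2 ?_
    rw [contMDiffAt_vectorField_iff (contMDiff_phaseProj p) hp.2] at h1
    rw [contMDiffAt_prod_module_iff] at h2
    have h3 : ContMDiffAt (phaseModel EB F) 𝓘(ℝ, (EB × (F →L[ℝ] ℝ)) × ℝ) ∞
        (fun y => ((mvfderiv 𝓘(ℝ, EB) (extChartAt 𝓘(ℝ, EB) q₀) y.1.proj
          (mfderiv (phaseModel EB F) 𝓘(ℝ, EB) (phaseProj F E) y (X y)),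
        (mvfderiv (phaseModel EB F) (phaseCoord F E q₀) y (X y)).1),
        (mvfderiv (phaseModel EB F) (phaseCoord F E q₀) y (X y)).2)) p :=
      (contMDiffAt_prod_module_iff _).2 ⟨(contMDiffAt_prod_module_iff _).2 ⟨h1, h2.1⟩, h2.2⟩
    refine h3.congr_of_eventuallyEq ?_
    filter_upwards [(isOpen_phaseDomain q₀).mem_nhds hp] with y hy
    exact mvfderiv_extChartAt_phase hy (X y)

variable {ρ : ∀ q, E q →L[ℝ] TangentSpace 𝓘(ℝ, EB) q}
  {br : (∀ q, E q) → (∀ q, E q) → ∀ q, E q} {m : ℕ}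

theorem hamProlongation_isLieAlgebroid (hm : Module.finrank ℝ F = m)
    (hE : (ofBundle F ρ br).IsLieAlgebroid m) :
    (hamProlongation F ρ br).IsLieAlgebroid (2 * m + 1) := by
  have h := prolongation_isLieAlgebroid (K := (F →L[ℝ] ℝ) × ℝ) hm hE contMDiff_phaseProj
    fun p => ⟨phaseCoord F E p.1.proj, phaseDomain (EB := EB) F E p.1.proj, mem_phaseDomain p,
      isFibreCoord_phaseCoord p.1.proj⟩
  have hd : Module.finrank ℝ (F →L[ℝ] ℝ) = m := by
    rw [← hm, ← (LinearMap.toContinuousLinearMap (E := F) (F' := ℝ) (𝕜 := ℝ)).finrank_eq]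
    exact Subspace.dual_finrank_eq
  have h2 : Module.finrank ℝ F + Module.finrank ℝ ((F →L[ℝ] ℝ) × ℝ) = 2 * m + 1 := by
    rw [Module.finrank_prod, hd, hm, Module.finrank_self]
    ring
  rw [h2] at h
  exact h

end PhaseCoordinates

/-! ### Positivity of the volume sum on an adapted basis. -/

section SymplecticSigns

/-- The standard symplectic pairing on an index set. -/
def blockPairing {m : ℕ} : Option (Fin m × Bool) → Option (Fin m × Bool) → ℝ
  | some (i, false), some (j, true) => if i = j then 1 else 0
  | some (i, true), some (j, false) => if i = j then -1 else 0
  | _, _ => 0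

lemma exists_block_of_blockPairing_ne_zero {m : ℕ} {x y : Option (Fin m × Bool)}
    (h : blockPairing x y ≠ 0) : ∃ (j : Fin m) (c : Bool), x = some (j, c) ∧ y = some (j, !c) := by
  rcases x with - | ⟨i, - | -⟩ <;> rcases y with - | ⟨j, - | -⟩ <;>
    simp [blockPairing] at h ⊢ <;> exact h.symm

lemma blockPairing_block {m : ℕ} (j : Fin m) (c : Bool) :
    blockPairing (some (j, c)) (some (j, !c)) = if c then -1 else 1 := by
  cases c <;> simp [blockPairing]

/-- If the product is nonzero, `s` sends each pair of conjugate indices to such a pair, possibly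
reversed. Permuting the pairs is an even permutation, and each reversal contributes `-1` both to the
sign and to the product. -/
lemma sign_mul_prod_blockPairing_nonneg {m : ℕ} (s : Equiv.Perm (Option (Fin m × Bool)))
    (h0 : s none = none) :
    0 ≤ ((Equiv.Perm.sign s : ℤ) : ℝ) *
      ∏ i : Fin m, blockPairing (s (some (i, false))) (s (some (i, true))) := by
  by_cases hne : ∃ i, blockPairing (s (some (i, false))) (s (some (i, true))) = 0
  · obtain ⟨i, hi⟩ := hne
    rw [Finset.prod_eq_zero (Finset.mem_univ i) hi, mul_zero]
  push Not at hne
  choose g c h1 h2 using fun i => exists_block_of_blockPairing_ne_zero (hne i)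
  have h3 : ∀ i b, s (some (i, b)) = some (g i, xor b (c i)) := by
    rintro i (- | -)
    · simpa using h1 i
    · simpa using h2 i
  have hg : Function.Injective g := by
    intro i i' h
    have h4 : s (some (i, c i)) = s (some (i', c i')) := by
      rw [h3, h3, h]
      simp
    have h5 := s.injective h4
    simp only [Option.some.injEq, Prod.mk.injEq] at h5
    exact h5.1
  let g' : Equiv.Perm (Fin m) := Equiv.ofBijective g (Finite.injective_iff_bijective.1 hg)
  let δ : Fin m → Equiv.Perm Bool := fun i => if c i then Equiv.swap false true else 1
  -- First reversals inside the pairs, then the permutation `g'` of the pairs. The latter acts on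
  -- both copies of `Fin m`, so its sign is squared.
  have hs : s = Equiv.optionCongr
      ((Equiv.prodCongrLeft fun _ : Bool => g') * (Equiv.prodCongrRight δ)) := by
    ext1 x
    rcases x with - | ⟨i, b⟩
    · simpa using h0
    · rw [h3]
      cases hc : c i <;> cases b <;> simp [δ, hc, g']
  have hsign : Equiv.Perm.sign s = ∏ i, Equiv.Perm.sign (δ i) := by
    rw [hs, Equiv.optionCongr_sign, Equiv.Perm.sign_mul, Equiv.Perm.sign_prodCongrLeft,
      Equiv.Perm.sign_prodCongrRight]
    simp
  rw [hsign, Units.coe_prod, Int.cast_prod, ← Finset.prod_mul_distrib]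
  refine Finset.prod_nonneg fun i _ => ?_
  rw [h1, h2, blockPairing_block]
  cases hc : c i <;> simp [δ, hc]

/-- The enumeration `0, 1, …, 2m` of the index set of an adapted basis. -/
def blockIndex (m : ℕ) : Option (Fin m × Bool) → Fin (2 * m + 1)
  | none => 0
  | some (i, false) => ⟨2 * i + 1, by omega⟩
  | some (i, true) => ⟨2 * i + 2, by omega⟩

lemma blockIndex_bijective (m : ℕ) : Function.Bijective (blockIndex m) := by
  rw [Fintype.bijective_iff_injective_and_card]
  constructor
  · rintro (- | ⟨i, - | -⟩) (- | ⟨j, - | -⟩) h <;>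
      simp [blockIndex, Fin.ext_iff] at h ⊢ <;> omega
  · simp [mul_comm]

/-- The sum in the volume of an adapted basis is positive. -/
lemma sum_sign_mul_pos (m : ℕ) (h : Fin (2 * m + 1) → ℝ)
    (B : Fin (2 * m + 1) → Fin (2 * m + 1) → ℝ)
    (h0 : h 0 = 1) (h1 : ∀ i, i ≠ 0 → h i = 0)
    (hB : ∀ x y, B (blockIndex m x) (blockIndex m y) = blockPairing x y) :
    0 < ∑ s : Equiv.Perm (Fin (2 * m + 1)), ((Equiv.Perm.sign s : ℤ) : ℝ) *
      (h (s 0) * ∏ i : Fin m, B (s ⟨2 * i + 1, by omega⟩) (s ⟨2 * i + 2, by omega⟩)) := by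
  let e : Option (Fin m × Bool) ≃ Fin (2 * m + 1) := Equiv.ofBijective _ (blockIndex_bijective m)
  -- Permutations which move `0` contribute zero through `h`, those which fix it are nonnegative,
  -- and the identity contributes `1`.
  refine Finset.sum_pos' (fun s _ => ?_) ⟨1, Finset.mem_univ _, ?_⟩
  · by_cases hs : s 0 = 0
    · let t : Equiv.Perm (Option (Fin m × Bool)) := e.symm.permCongr s
      have ht : ∀ x, blockIndex m (t x) = s (blockIndex m x) := fun x => by
        change e (e.symm (s (e.symm.symm x))) = s (e x)
        simp
      have ht0 : t none = none := (blockIndex_bijective m).1 ((ht none).trans hs)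
      have h2 := sign_mul_prod_blockPairing_nonneg t ht0
      rw [Equiv.Perm.sign_permCongr] at h2
      rw [hs, h0, one_mul]
      refine h2.trans_eq (congr_arg _ (Finset.prod_congr rfl fun i _ => ?_))
      rw [← hB, ht, ht]
      rfl
    · rw [h1 _ hs]
      simp
  · have h3 : ∀ i : Fin m, B ⟨2 * i + 1, by omega⟩ ⟨2 * i + 2, by omega⟩ = 1 := fun i => by
      have := hB (some (i, false)) (some (i, true))
      simpa [blockPairing, blockIndex] using this
    simp [h0, h3]

end SymplecticSigns

/-! ### Exterior differential of a `1`-section. -/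

section OneForm

variable {EM : Type*} [NormedAddCommGroup EM] [NormedSpace ℝ EM]
  {HM : Type*} [TopologicalSpace HM] {IM : ModelWithCorners ℝ EM HM}
  {M : Type*} [TopologicalSpace M] [ChartedSpace HM M]
  {V : M → Type*} [∀ x, AddCommGroup (V x)] [∀ x, Module ℝ (V x)]

lemma AlgebroidData.oneForm_apply (η : ∀ x, V x →ₗ[ℝ] ℝ) (x : M) (v : Fin 1 → V x) :
    oneForm η x v = η x (v 0) := rfl

lemma AlgebroidData.extDiff_oneForm (A : AlgebroidData IM V) (η : ∀ x, V x →ₗ[ℝ] ℝ)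
    (σ τ : ∀ x, V x) (x : M) :
    A.extDiff (oneForm η) ![σ, τ] x =
      A.deriv (fun y => η y (τ y)) x (σ x) - A.deriv (fun y => η y (σ y)) x (τ x) -
        η x (A.bracket σ τ x) := by
  simp [extDiff, extDiffBracketPart, Fin.sum_univ_two, oneForm_apply, Fin.succAbove]
  ring

end OneForm

/-! ### The contact structure on the prolongation. -/

section Contact

variable {EB : Type*} [NormedAddCommGroup EB] [NormedSpace ℝ EB] [FiniteDimensional ℝ EB]
  {Q : Type*} [TopologicalSpace Q] [ChartedSpace EB Q] [IsManifold 𝓘(ℝ, EB) ∞ Q] [T2Space Q]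
  {F : Type*} [NormedAddCommGroup F] [NormedSpace ℝ F] [FiniteDimensional ℝ F]
  {E : Q → Type*} [TopologicalSpace (TotalSpace F E)]
  [∀ q, AddCommGroup (E q)] [∀ q, Module ℝ (E q)] [∀ q, TopologicalSpace (E q)]
  [FiberBundle F E] [VectorBundle ℝ F E] [ContMDiffVectorBundle ∞ F E 𝓘(ℝ, EB)]
  {ρ : ∀ q, E q →L[ℝ] TangentSpace 𝓘(ℝ, EB) q}
  {br : (∀ q, E q) → (∀ q, E q) → ∀ q, E q} {m : ℕ}

lemma contactForm_apply (p : Phase F E) (z : HamFibre F ρ p) :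
    contactForm F ρ p z =
      mvfderiv (phaseModel EB F) (fun p : Phase F E => p.2) p z.1.2 - p.1.2 z.1.1 := rfl

lemma mvfderiv_phaseCoord_snd {q₀ : Q} {p : Phase F E} (hp : p ∈ phaseDomain (EB := EB) F E q₀)
    (v : TangentSpace (phaseModel EB F) p) :
    mvfderiv (phaseModel EB F) (fun p : Phase F E => p.2) p v =
      (mvfderiv (phaseModel EB F) (phaseCoord F E q₀) p v).2 :=
  mvfderiv_clm_comp (ContinuousLinearMap.snd ℝ (F →L[ℝ] ℝ) ℝ)
    ((contMDiffAt_phaseCoord hp).mdifferentiableAt (n := ∞) (by simp)) v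

/-- The contact form in coordinates. -/
lemma contactForm_eq_coord {q₀ : Q} {p : Phase F E} (hp : p ∈ phaseDomain (EB := EB) F E q₀)
    (z : HamFibre F ρ p) :
    contactForm F ρ p z =
      mvfderiv (phaseModel EB F) (fun p : Phase F E => p.2) p z.1.2 -
        (phaseCoord F E q₀ p).1 (coord F E q₀ p.1.proj z.1.1) := by
  rw [contactForm_apply, phaseCoord, dualCoord_apply hp.1]

lemma contMDiffAt_phaseCoord_fst {q₀ : Q} {p : Phase F E}
    (hp : p ∈ phaseDomain (EB := EB) F E q₀) :
    ContMDiffAt (phaseModel EB F) 𝓘(ℝ, F →L[ℝ] ℝ) ∞ (fun p => (phaseCoord F E q₀ p).1) p :=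
  ((contMDiffAt_prod_module_iff _).1 (contMDiffAt_phaseCoord hp)).1

lemma contMDiffAt_mvfderiv_snd {Z : ∀ p, HamFibre F ρ p} {p : Phase F E}
    (hZ : (hamProlongation F ρ br).smoothAt Z p) :
    ContMDiffAt (phaseModel EB F) 𝓘(ℝ, ℝ) ∞
      (fun p => mvfderiv (phaseModel EB F) (fun p : Phase F E => p.2) p (Z p).1.2) p :=
  contMDiffAt_mvfderiv_apply (g := fun p => p) contMDiffAt_snd hZ.2

lemma contactForm_isSmoothForm :
    (hamProlongation F ρ br).IsSmoothForm (AlgebroidData.oneForm (contactForm F ρ)) := by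
  intro σ hσ p
  have hp := mem_phaseDomain (EB := EB) p
  have h := (contMDiffAt_mvfderiv_snd (hσ 0 p)).sub
    ((contMDiffAt_phaseCoord_fst hp).clm_apply
      (contMDiffAt_prolongCoord contMDiff_phaseProj hp.1 (hσ 0 p)))
  refine h.congr_of_eventuallyEq ?_
  filter_upwards [(isOpen_phaseDomain (EB := EB) p.1.proj).mem_nhds hp] with y hy
  exact contactForm_eq_coord hy _

/-- The differential of the contact form in coordinates. -/
lemma extDiff_contactForm (hm : Module.finrank ℝ F = m)
    (hE : (ofBundle F ρ br).IsLieAlgebroid m) {q₀ : Q} {O : Set Q} {R : Q → F →L[ℝ] EB}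
    {C : Q → F →L[ℝ] F →L[ℝ] F} (hO : IsLocalForm ρ br q₀ O R C) {Z W : ∀ p, HamFibre F ρ p}
    (hZ : (hamProlongation F ρ br).IsSmooth Z) (hW : (hamProlongation F ρ br).IsSmooth W)
    {p : Phase F E} (hp : p ∈ phaseDomain (EB := EB) F E q₀) (hpO : p.1.proj ∈ O) :
    (hamProlongation F ρ br).extDiff (AlgebroidData.oneForm (contactForm F ρ)) ![Z, W] p =
      -(mvfderiv (phaseModel EB F) (phaseCoord F E q₀) p (Z p).1.2).1 (prolongCoord F q₀ W p) +
      (mvfderiv (phaseModel EB F) (phaseCoord F E q₀) p (W p).1.2).1 (prolongCoord F q₀ Z p) +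
      (phaseCoord F E q₀ p).1 (C p.1.proj (prolongCoord F q₀ Z p) (prolongCoord F q₀ W p)) := by
  have hκ := contMDiffAt_phaseCoord hp
  have hκ1 := contMDiffAt_phaseCoord_fst hp
  have hs : ContMDiffAt (phaseModel EB F) 𝓘(ℝ, ℝ) ∞ (fun p : Phase F E => p.2) p := contMDiffAt_snd
  have hev := (isOpen_phaseDomain (EB := EB) q₀).mem_nhds hp
  have key : ∀ {W : ∀ p, HamFibre F ρ p}, (hamProlongation F ρ br).IsSmooth W →
      ∀ z : HamFibre F ρ p,
      (hamProlongation F ρ br).deriv (fun y => contactForm F ρ y (W y)) p z =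
        mvfderiv (phaseModel EB F) (fun y => mvfderiv (phaseModel EB F)
          (fun p : Phase F E => p.2) y (W y).1.2) p z.1.2 -
        ((mvfderiv (phaseModel EB F) (phaseCoord F E q₀) p z.1.2).1 (prolongCoord F q₀ W p) +
          (phaseCoord F E q₀ p).1
            (mvfderiv (phaseModel EB F) (prolongCoord F q₀ W) p z.1.2)) := by
    intro W hW z
    have hw := contMDiffAt_prolongCoord contMDiff_phaseProj hp.1 (hW p)
    have h1 : ∀ᶠ y in 𝓝 p, contactForm F ρ y (W y) =
        mvfderiv (phaseModel EB F) (fun p : Phase F E => p.2) y (W y).1.2 -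
          (phaseCoord F E q₀ y).1 (prolongCoord F q₀ W y) := by
      filter_upwards [hev] with y hy using contactForm_eq_coord hy _
    have h2 := mvfderiv_bilin (ContinuousLinearMap.id ℝ (F →L[ℝ] ℝ))
      (f := fun y => (phaseCoord F E q₀ y).1) (hκ1.mdifferentiableAt (by simp))
      (hw.mdifferentiableAt (by simp)) z.1.2
    have h3 := mvfderiv_clm_comp (ContinuousLinearMap.fst ℝ (F →L[ℝ] ℝ) ℝ)
      (hκ.mdifferentiableAt (by simp)) z.1.2
    simp only [ContinuousLinearMap.id_apply, ContinuousLinearMap.coe_fst'] at h2 h3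
    have h4 : MDifferentiableAt (phaseModel EB F) 𝓘(ℝ, ℝ)
        (fun y => (phaseCoord F E q₀ y).1 (prolongCoord F q₀ W y)) p :=
      (hκ1.clm_apply hw).mdifferentiableAt (by simp)
    rw [AlgebroidData.deriv_congr h1, AlgebroidData.deriv_eq, mvfderiv_fun_sub
      ((contMDiffAt_mvfderiv_snd (hW p)).mdifferentiableAt (by simp)) h4, ← h3, ← h2]
    rfl
  have hbr : contactForm F ρ p ((hamProlongation F ρ br).bracket Z W p) =
      (mvfderiv (phaseModel EB F) (fun y => mvfderiv (phaseModel EB F)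
          (fun p : Phase F E => p.2) y (W y).1.2) p (Z p).1.2 -
        mvfderiv (phaseModel EB F) (fun y => mvfderiv (phaseModel EB F)
          (fun p : Phase F E => p.2) y (Z y).1.2) p (W p).1.2) -
      (phaseCoord F E q₀ p).1 (mvfderiv (phaseModel EB F) (prolongCoord F q₀ W) p (Z p).1.2 -
      mvfderiv (phaseModel EB F) (prolongCoord F q₀ Z) p (W p).1.2 +
      C p.1.proj (prolongCoord F q₀ Z p) (prolongCoord F q₀ W p)) := by
    rw [contactForm_eq_coord hp]
    have h1 := prolongCoord_bracket hm hE hO contMDiff_phaseProj hpO (hZ p) (hW p)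
    have h2 := prolongation_bracket_snd hm hE contMDiff_phaseProj (hZ p) (hW p)
    refine congr_arg₂ (· - ·) ?_ (congr_arg _ h1)
    refine (congr_arg _ h2).trans ?_
    exact mvfderiv_mlieBracket hs ((hZ p).2.mdifferentiableAt (by simp))
      ((hW p).2.mdifferentiableAt (by simp))
  -- The iterated derivatives of `s` and the derivatives of the coordinates of `Z` and `W` occur in
  -- the bracket term exactly as in the two derivative terms, and cancel.
  rw [AlgebroidData.extDiff_oneForm, key hW, key hZ, hbr]
  simp only [map_add, map_sub]
  ring

/-- The prolongation of a Lie algebroid over its extended dual bundle is contact. -/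
theorem hamProlongation_isContact (hm : Module.finrank ℝ F = m)
    (hE : (ofBundle F ρ br).IsLieAlgebroid m) :
    (hamProlongation F ρ br).IsContact m (contactForm F ρ) := by
  have hA := hamProlongation_isLieAlgebroid hm hE
  refine ⟨hA, contactForm_isSmoothForm, fun p => ?_⟩
  set q₀ := p.1.proj with hq₀
  obtain ⟨O, R, C, hq, hO⟩ := exists_isLocalForm hE q₀
  have hp := mem_phaseDomain (EB := EB) p
  let ξ : F →L[ℝ] ℝ := (phaseCoord F E q₀ p).1
  let b : Module.Basis (Fin m) ℝ F := Module.finBasisOfFinrankEq ℝ F hm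
  let L : Fin m → F →L[ℝ] ℝ := fun i => LinearMap.toContinuousLinearMap (b.coord i)
  -- The entry `ξ (b i)` puts the vector in the kernel of the contact form. The two corrections `(1
  -- / 2) ξ ∘ C` of a pair `b i`, `b j` add up, by antisymmetry of `C`, to minus the term `ξ (C (b
  -- i) (b j))` of the differential.
  let c : Option (Fin m × Bool) → F × ((F →L[ℝ] ℝ) × ℝ)
    | none => (0, 0, 1)
    | some (i, false) => (b i, (1 / 2 : ℝ) • ξ.comp (C q₀ (b i)), ξ (b i))
    | some (i, true) => (0, L i, 0)
  let e : Option (Fin m × Bool) ≃ Fin (2 * m + 1) := Equiv.ofBijective _ (blockIndex_bijective m)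
  have hex : ∀ x, ∃ σ, (hamProlongation F ρ br).IsSmooth σ ∧
      prolongTriv F q₀ (phaseCoord F E q₀) p (σ p) = c x := by
    intro x
    obtain ⟨z, hz⟩ := (prolongTriv_bijective (isFibreCoord_phaseCoord q₀) hp hp.1).2 (c x)
    obtain ⟨σ, hσ, hσz⟩ := hA.bundle.exists_isSmooth_apply_eq p z
    exact ⟨σ, hσ, by rw [hσz, hz]⟩
  choose σ hσ hσc using hex
  have hη : ∀ x, contactForm F ρ p (σ x p) = (c x).2.2 - ξ (c x).1 := by
    intro x
    rw [contactForm_eq_coord hp, mvfderiv_phaseCoord_snd hp, ← hσc x]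
    rfl
  have hdη : ∀ x y, (hamProlongation F ρ br).extDiff
      (AlgebroidData.oneForm (contactForm F ρ)) ![σ x, σ y] p =
      -(c x).2.1 (c y).1 + (c y).2.1 (c x).1 + ξ (C q₀ (c x).1 (c y).1) := by
    intro x y
    rw [extDiff_contactForm hm hE hO (hσ x) (hσ y) hp hq, ← hσc x, ← hσc y]
    rfl
  have hL : ∀ i j, L i (b j) = if i = j then 1 else 0 := fun i j => by
    simp [L, Finsupp.single_apply, eq_comm]
  have hanti := hO.antisymm q₀ hq
  have hpair : ∀ x y, (hamProlongation F ρ br).extDiff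
      (AlgebroidData.oneForm (contactForm F ρ)) ![σ x, σ y] p = blockPairing x y := by
    intro x y
    rw [hdη]
    rcases x with - | ⟨i, - | -⟩ <;> rcases y with - | ⟨j, - | -⟩ <;>
      simp [c, blockPairing, hL]
    · rw [hanti (b j) (b i), map_neg]
      ring
    · simp only [eq_comm]
    · split_ifs <;> simp
  refine ⟨fun i => σ (e.symm i), fun i => hσ _, ?_⟩
  refine mul_ne_zero (by positivity) (ne_of_gt ?_)
  refine sum_sign_mul_pos m (fun i => contactForm F ρ p (σ (e.symm i) p))
    (fun i j => (hamProlongation F ρ br).extDiff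
      (AlgebroidData.oneForm (contactForm F ρ)) ![σ (e.symm i), σ (e.symm j)] p) ?_ ?_ ?_
  · have h0 : e.symm 0 = none := by rw [Equiv.symm_apply_eq]; rfl
    rw [h0, hη]
    simp [c]
  · intro i hi
    obtain ⟨x, rfl⟩ := e.surjective i
    rw [Equiv.symm_apply_apply, hη]
    rcases x with - | ⟨i, - | -⟩
    · exact absurd rfl hi
    · simp [c]
    · simp [c]
  · intro x y
    have hx : ∀ x, e.symm (blockIndex m x) = x := fun x => e.symm_apply_apply x
    rw [hx, hx, hpair]

end Contact

/-! ### A criterion for morphisms of Lie algebroids. -/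

section Morphisms

variable {EM : Type*} [NormedAddCommGroup EM] [NormedSpace ℝ EM] [FiniteDimensional ℝ EM]
  {HM : Type*} [TopologicalSpace HM] {IM : ModelWithCorners ℝ EM HM}
  {M : Type*} [TopologicalSpace M] [ChartedSpace HM M] [T2Space M] [IsManifold IM ∞ M]
  {V : M → Type*} [∀ x, AddCommGroup (V x)] [∀ x, Module ℝ (V x)]
  {EN : Type*} [NormedAddCommGroup EN] [NormedSpace ℝ EN]
  {HN : Type*} [TopologicalSpace HN] {IN : ModelWithCorners ℝ EN HN}
  {N : Type*} [TopologicalSpace N] [ChartedSpace HN N] [IsManifold IN ∞ N]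
  {W : N → Type*} [∀ x, AddCommGroup (W x)] [∀ x, Module ℝ (W x)]
  {A : AlgebroidData IM V} {B : AlgebroidData IN W} {r : ℕ}

/-- A bundle map which commutes with the anchors, such that smooth sections are locally related to
smooth sections and brackets of related sections are related, is a morphism of Lie algebroids. -/
theorem isMorphism_of_related (hA : A.IsLieAlgebroid r) {i : N → M} {j : ∀ x, W x →ₗ[ℝ] V (i x)}
    (hi : ContMDiff IN IM ∞ i)
    (hanchor : ∀ x w, mfderiv IN IM i x (B.anchor x w) = A.anchor (i x) (j x w))
    (hext : ∀ x σ, B.IsSmooth σ → ∃ τ, A.IsSmooth τ ∧ ∀ᶠ y in 𝓝 x, τ (i y) = j y (σ y))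
    (hbr : ∀ x σ σ' τ τ', B.IsSmooth σ → B.IsSmooth σ' → A.IsSmooth τ → A.IsSmooth τ' →
      (∀ᶠ y in 𝓝 x, τ (i y) = j y (σ y)) → (∀ᶠ y in 𝓝 x, τ' (i y) = j y (σ' y)) →
      A.bracket τ τ' (i x) = j x (B.bracket σ σ' x)) :
    IsMorphism B A i j := by
  refine ⟨hi, fun μ hμ σ hσ x => ?_, fun k μ hμ σ τ hσ hτ x h => ?_⟩
  · choose τ hτ hτσ using fun l => hext x (σ l) (hσ l)
    refine (((hμ τ hτ) (i x)).comp x (hi x)).congr_of_eventuallyEq ?_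
    filter_upwards [Filter.eventually_all.2 hτσ] with y hy
    change μ (i y) (fun l => j y (σ l y)) = μ (i y) fun l => τ l (i y)
    simp only [hy]
  · choose τ' hτ' hτσ using fun l => hext x (σ l) (hσ l)
    have hx : ∀ l, τ' l (i x) = j x (σ l x) := fun l => (hτσ l).self_of_nhds
    -- The given `τ` match the `σ` only at the one point `i x`. Tensoriality allows replacing them
    -- by sections that match along `i` near `x`, whose pairings with `μ` can be differentiated
    -- along `i`.
    rw [hA.extDiff_congr hμ hτ hτ' fun l => (h l).trans (hx l).symm]
    refine congr_arg₂ (· + ·) (Finset.sum_congr rfl fun l _ => congr_arg _ ?_) ?_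
    · have h1 : ∀ᶠ y in 𝓝 x, pullback i j μ y (fun t => σ (l.succAbove t) y) =
          μ (i y) (fun t => τ' (l.succAbove t) (i y)) := by
        filter_upwards [Filter.eventually_all.2 hτσ] with y hy
        change μ (i y) (fun t => j y (σ (l.succAbove t) y)) = _
        simp only [hy]
      have h2 : MDifferentiableAt IM 𝓘(ℝ, ℝ) (fun y => μ y (fun t => τ' (l.succAbove t) y)) (i x) :=
        (hμ (fun t => τ' (l.succAbove t)) (fun t => hτ' _) (i x)).mdifferentiableAt (by simp)
      refine (DFunLike.congr_fun (Filter.EventuallyEq.mvfderiv_eq h1)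
        (B.anchor x (σ l x))).trans ?_
      rw [AlgebroidData.deriv_eq, hx, ← hanchor]
      exact mvfderiv_comp' h2 ((hi x).mdifferentiableAt (by simp)) _
    · cases k with
      | zero => rfl
      | succ k =>
        refine Finset.sum_congr rfl fun l _ => Finset.sum_congr rfl fun t _ => ?_
        split_ifs
        · refine congr_arg _ ?_
          change μ (i x) (fun u => j x (Matrix.vecCons _ _ u)) = _
          congr 1
          funext u
          refine Fin.cases ?_ (fun u => ?_) u
          · exact (hbr x _ _ _ _ (hσ _) (hσ _) (hτ' _) (hτ' _) (hτσ _) (hτσ _)).symm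
          · exact (hx _).symm
        · rfl

end Morphisms

/-! ### Sections of the prolongation over `E* × ℝ` with prescribed coordinates. -/

section PhaseSections

variable {EB : Type*} [NormedAddCommGroup EB] [NormedSpace ℝ EB] [FiniteDimensional ℝ EB]
  {Q : Type*} [TopologicalSpace Q] [ChartedSpace EB Q] [IsManifold 𝓘(ℝ, EB) ∞ Q] [T2Space Q]
  {F : Type*} [NormedAddCommGroup F] [NormedSpace ℝ F] [FiniteDimensional ℝ F]
  {E : Q → Type*} [TopologicalSpace (TotalSpace F E)]
  [∀ q, AddCommGroup (E q)] [∀ q, Module ℝ (E q)] [∀ q, TopologicalSpace (E q)]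
  [FiberBundle F E] [VectorBundle ℝ F E] [ContMDiffVectorBundle ∞ F E 𝓘(ℝ, EB)]
  {ρ : ∀ q, E q →L[ℝ] TangentSpace 𝓘(ℝ, EB) q}
  {br : (∀ q, E q) → (∀ q, E q) → ∀ q, E q} {m : ℕ}

variable (ρ) in
/-- Linear coordinates on the fibres of the prolongation over the phase space. -/
abbrev hamTriv (q₀ : Q) (p : Phase F E) : HamFibre F ρ p →ₗ[ℝ] F × ((F →L[ℝ] ℝ) × ℝ) :=
  prolongTriv F q₀ (phaseCoord F E q₀) p

lemma hamTriv_injective {q₀ : Q} {p : Phase F E} (hp : p ∈ phaseDomain (EB := EB) F E q₀) :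
    Function.Injective (hamTriv ρ q₀ p) :=
  (prolongTriv_bijective (isFibreCoord_phaseCoord q₀) hp hp.1).1

/-- Smooth sections with prescribed local coordinates. -/
lemma exists_isSmooth_hamTriv_eq (hm : Module.finrank ℝ F = m)
    (hE : (ofBundle F ρ br).IsLieAlgebroid m) (p : Phase F E)
    {h : Phase F E → F × ((F →L[ℝ] ℝ) × ℝ)}
    (hh : ∀ᶠ y in 𝓝 p, ContMDiffAt (phaseModel EB F) 𝓘(ℝ, F × ((F →L[ℝ] ℝ) × ℝ)) ∞ h y) :
    ∃ τ, (hamProlongation F ρ br).IsSmooth τ ∧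
      ∀ᶠ y in 𝓝 p, hamTriv ρ p.1.proj y (τ y) = h y := by
  obtain ⟨O, R, C, hq, hO⟩ := exists_isLocalForm hE p.1.proj
  have hκ := isFibreCoord_phaseCoord (EB := EB) (F := F) (E := E) p.1.proj
  have hev : ∀ᶠ y in 𝓝 p, y ∈ phaseDomain (EB := EB) F E p.1.proj :=
    (isOpen_phaseDomain p.1.proj).mem_nhds (mem_phaseDomain p)
  have hevO : ∀ᶠ y in 𝓝 p, phaseProj F E y ∈ O :=
    (contMDiff_phaseProj (EB := EB) p).continuousAt.eventually (hO.isOpen.mem_nhds hq)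
  have hex : ∀ y, ∃ z : HamFibre F ρ y, y ∈ phaseDomain (EB := EB) F E p.1.proj →
      hamTriv ρ p.1.proj y z = h y := by
    intro y
    by_cases hy : y ∈ phaseDomain (EB := EB) F E p.1.proj
    · obtain ⟨z, hz⟩ := (prolongTriv_bijective hκ hy hy.1).2 (h y)
      exact ⟨z, fun _ => hz⟩
    · exact ⟨0, fun h => absurd h hy⟩
  choose τ₀ hτ₀ using hex
  obtain ⟨τ, hτ, hτe⟩ := (hamProlongation_isLieAlgebroid hm hE).bundle.exists_isSmooth_eventuallyEq
    (σ := τ₀) (x := p) (by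
      filter_upwards [hev, hevO, hh] with y hy hyO hyh
      refine (prolongation_smoothAt_iff hO contMDiff_phaseProj hκ hy hyO τ₀).2 ?_
      refine hyh.congr_of_eventuallyEq ?_
      filter_upwards [(isOpen_phaseDomain p.1.proj).mem_nhds hy] with z hz using hτ₀ z hz)
  refine ⟨τ, hτ, ?_⟩
  filter_upwards [hev, hτe] with y hy hye
  rw [hye, hτ₀ y hy]

end PhaseSections

/-! ### Vector fields depending on a parameter. -/

section VerticalAlgebroid

variable {G : Type*} [NormedAddCommGroup G] [NormedSpace ℝ G] [FiniteDimensional ℝ G]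
  {HD : Type*} [TopologicalSpace HD] {ID : ModelWithCorners ℝ G HD} [ID.Boundaryless]
  {D : Type*} [TopologicalSpace D] [ChartedSpace HD D] [IsManifold ID ∞ D]

variable (ID D) in
/-- The Lie algebroid `T D × ℝ → D × ℝ` of vector fields on `D` depending on a parameter. -/
def paramTangent : AlgebroidData (ID.prod 𝓘(ℝ, ℝ)) (fun x : D × ℝ => TangentSpace ID x.1) where
  smoothAt v x := ContMDiffAt (ID.prod 𝓘(ℝ, ℝ)) ID.tangent ∞
    (fun y => (⟨y.1, v y⟩ : TangentBundle ID D)) x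
  anchor x := (mfderiv ID (ID.prod 𝓘(ℝ, ℝ)) (fun b : D => (b, x.2)) x.1).toLinearMap
  bracket v w x := VectorField.mlieBracket ID (fun b : D => v (b, x.2)) (fun b => w (b, x.2)) x.1

namespace paramTangent

variable {σ τ : ∀ x : D × ℝ, TangentSpace ID x.1}

lemma isSmoothBundle : (paramTangent ID D).IsSmoothBundle (Module.finrank ℝ G) := by
  refine AlgebroidData.isSmoothBundle_of_coords (G := G) rfl fun x₀ =>
    ⟨Prod.fst ⁻¹' (extChartAt ID x₀.1).source,
      continuousAt_fst.preimage_mem_nhds (extChartAt_source_mem_nhds x₀.1),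
      fun x => (mvfderiv ID (extChartAt ID x₀.1) x.1).toLinearMap, fun x hx => ?_⟩
  exact ⟨mvfderiv_extChartAt_bijective hx, fun σ =>
    contMDiffAt_vectorField_iff (g := fun y : D × ℝ => y.1) contMDiffAt_fst hx⟩

lemma contMDiff_slice (s : ℝ) :
    ContMDiff ID (ID.prod 𝓘(ℝ, ℝ)) ∞ (fun b : D => (b, s)) :=
  contMDiff_id.prodMk contMDiff_const

lemma anchor_apply (x : D × ℝ) (v : TangentSpace ID x.1) :
    (paramTangent ID D).anchor x v = (v, (0 : ℝ)) := by
  have h := mfderiv_prod_left (I := ID) (I' := 𝓘(ℝ, ℝ)) (x₀ := x.1) (y₀ := x.2)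
  exact DFunLike.congr_fun h v

lemma contMDiffAt_slice (hσ : (paramTangent ID D).IsSmooth σ) (s : ℝ) (b : D) :
    ContMDiffAt ID ID.tangent ∞ (fun b => (⟨b, σ (b, s)⟩ : TangentBundle ID D)) b := by
  have h : ContMDiffAt (ID.prod 𝓘(ℝ, ℝ)) ID.tangent ∞
    (fun y : D × ℝ => (⟨y.1, σ y⟩ : TangentBundle ID D)) ((fun b : D => (b, s)) b) := hσ (b, s)
  exact h.comp b (contMDiff_slice s b)

lemma anchor_smooth (hσ : (paramTangent ID D).IsSmooth σ) :
    ContMDiff (ID.prod 𝓘(ℝ, ℝ)) (ID.prod 𝓘(ℝ, ℝ)).tangent ∞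
      (fun x => (⟨x, (paramTangent ID D).anchor x (σ x)⟩ :
        TangentBundle (ID.prod 𝓘(ℝ, ℝ)) (D × ℝ))) := by
  intro x
  have : IsManifold ID 1 D := IsManifold.of_le (n := ∞) (by simp)
  have h0 : ContMDiffAt (ID.prod 𝓘(ℝ, ℝ)) 𝓘(ℝ, ℝ).tangent ∞
      (fun x : D × ℝ => (⟨x.2, 0⟩ : TangentBundle 𝓘(ℝ, ℝ) ℝ)) x :=
    ((Bundle.contMDiff_zeroSection ℝ (TangentSpace 𝓘(ℝ, ℝ) : ℝ → Type _)) x.2).comp x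
      contMDiffAt_snd
  have h1 := ContMDiffAt.comp x (contMDiff_equivTangentBundleProd_symm (n := ∞) (I := ID)
    (M := D) (I' := 𝓘(ℝ, ℝ)) (M' := ℝ)).contMDiffAt ((hσ x).prodMk h0)
  refine h1.congr_of_eventuallyEq (Filter.Eventually.of_forall fun y => ?_)
  exact congr_arg (TotalSpace.mk y) (anchor_apply y (σ y))

/-- The field `(v, 0)` is tangent to the slices of constant parameter, and related to the slice of
`v` by the inclusion of each of them. -/
lemma anchor_bracket (hσ : (paramTangent ID D).IsSmooth σ) (hτ : (paramTangent ID D).IsSmooth τ)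
    (x : D × ℝ) :
    (paramTangent ID D).anchor x ((paramTangent ID D).bracket σ τ x) =
      VectorField.mlieBracket (ID.prod 𝓘(ℝ, ℝ)) (fun x => (paramTangent ID D).anchor x (σ x))
        (fun x => (paramTangent ID D).anchor x (τ x)) x :=
  (mlieBracket_of_related (g := fun b => (b, x.2)) (contMDiff_slice x.2 x.1)
    (anchor_smooth hσ (x.1, x.2)) (anchor_smooth hτ (x.1, x.2))
    ((contMDiffAt_slice hσ x.2 x.1).mdifferentiableAt (by simp))
    ((contMDiffAt_slice hτ x.2 x.1).mdifferentiableAt (by simp))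
    (Filter.Eventually.of_forall fun _ => rfl) (Filter.Eventually.of_forall fun _ => rfl)).symm

/-- Brackets taken slice by slice are not visibly smooth in the parameter. They are, however, the
`D`-component of the bracket of two smooth fields on `D × ℝ`. -/
lemma bracket_smooth (hσ : (paramTangent ID D).IsSmooth σ) (hτ : (paramTangent ID D).IsSmooth τ) :
    (paramTangent ID D).IsSmooth ((paramTangent ID D).bracket σ τ) := by
  intro x
  have h1 := ContMDiffAt.mlieBracket (anchor_smooth hσ x) (anchor_smooth hτ x)
  have h2 := ContMDiffAt.mfderiv_vectorField (f := Prod.fst) (g := fun x => x)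
    (contMDiffAt_fst (n := ∞)) h1
  refine h2.congr_of_eventuallyEq (Filter.Eventually.of_forall fun y => ?_)
  have h3 := anchor_bracket hσ hτ y
  rw [anchor_apply] at h3
  have h4 := DFunLike.congr_fun (mfderiv_fst (I := ID) (I' := 𝓘(ℝ, ℝ)) (x := y))
    ((paramTangent ID D).bracket σ τ y, (0 : ℝ))
  exact congr_arg (TotalSpace.mk y.1) (h4.symm.trans
    (congr_arg (mfderiv (ID.prod 𝓘(ℝ, ℝ)) ID Prod.fst y) h3))

lemma leibniz {f : D × ℝ → ℝ} (hf : ContMDiff (ID.prod 𝓘(ℝ, ℝ)) 𝓘(ℝ, ℝ) ∞ f)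
    (hτ : (paramTangent ID D).IsSmooth τ) :
    (paramTangent ID D).bracket σ (fun x => f x • τ x) =
      fun x => f x • (paramTangent ID D).bracket σ τ x +
        (paramTangent ID D).deriv f x (σ x) • τ x := by
  funext x
  have h1 : ContMDiffAt ID 𝓘(ℝ, ℝ) ∞ (fun b : D => f (b, x.2)) x.1 :=
    (hf (x.1, x.2)).comp x.1 (contMDiff_slice x.2 x.1)
  have h2 := VectorField.mlieBracket_smul_right (V := fun b : D => σ (b, x.2))
    (h1.mdifferentiableAt (by simp))
    ((contMDiffAt_slice hτ x.2 x.1).mdifferentiableAt (by simp))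
  have h3 := mvfderiv_comp' (f := fun b : D => (b, x.2)) (g := f) (x := x.1)
    ((hf (x.1, x.2)).mdifferentiableAt (by simp))
    ((contMDiff_slice (ID := ID) x.2 x.1).mdifferentiableAt (n := ∞) (by simp)) (σ x)
  refine h2.trans ?_
  rw [add_comm]
  exact congr_arg₂ (· + ·) rfl (congr_arg (· • τ x) h3)

theorem isLieAlgebroid : (paramTangent ID D).IsLieAlgebroid (Module.finrank ℝ G) where
  bundle := isSmoothBundle
  anchor_smooth _ hσ := anchor_smooth hσ
  bracket_smooth _ _ hσ hτ := bracket_smooth hσ hτ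
  bracket_add σ τ₁ τ₂ hσ h₁ h₂ := by
    funext x
    exact VectorField.mlieBracket_add_right
      ((contMDiffAt_slice h₁ x.2 x.1).mdifferentiableAt (by simp))
      ((contMDiffAt_slice h₂ x.2 x.1).mdifferentiableAt (by simp))
  bracket_smul c σ τ hσ hτ := by
    funext x
    exact VectorField.mlieBracket_const_smul_right
      ((contMDiffAt_slice hτ x.2 x.1).mdifferentiableAt (by simp))
  bracket_antisymm σ τ hσ hτ := by
    funext x
    exact VectorField.mlieBracket_swap_apply
  jacobi σ τ υ hσ hτ hυ := by
    funext ⟨b, s⟩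
    exact mlieBracket_jacobi (X := fun b => σ (b, s)) (Y := fun b => τ (b, s))
      (Z := fun b => υ (b, s)) (contMDiffAt_slice hσ s b) (contMDiffAt_slice hτ s b)
      (contMDiffAt_slice hυ s b)
  leibniz f σ τ hf hσ hτ := leibniz hf hτ

end paramTangent

end VerticalAlgebroid

/-! ### The linear chart of `E*_q` and the Lie algebroid `TE*_q × ℝ`. -/

section FibreAlgebroid

variable {EB : Type*} [NormedAddCommGroup EB] [NormedSpace ℝ EB] [FiniteDimensional ℝ EB]
  {Q : Type*} [TopologicalSpace Q] [ChartedSpace EB Q] [IsManifold 𝓘(ℝ, EB) ∞ Q] [T2Space Q]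
  {F : Type*} [NormedAddCommGroup F] [NormedSpace ℝ F] [FiniteDimensional ℝ F]
  {E : Q → Type*} [TopologicalSpace (TotalSpace F E)]
  [∀ q, AddCommGroup (E q)] [∀ q, Module ℝ (E q)] [∀ q, TopologicalSpace (E q)]
  [FiberBundle F E] [VectorBundle ℝ F E] [ContMDiffVectorBundle ∞ F E 𝓘(ℝ, EB)]
  {ρ : ∀ q, E q →L[ℝ] TangentSpace 𝓘(ℝ, EB) q}
  {br : (∀ q, E q) → (∀ q, E q) → ∀ q, E q} {m : ℕ} {q : Q}

lemma mem_extChartAt_dualFibre_source (b₀ b : DualFibre F (E := E) q) :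
    b ∈ (extChartAt 𝓘(ℝ, F →L[ℝ] ℝ) b₀).source := by
  rw [extChartAt_source]
  exact mem_chart_source (F →L[ℝ] ℝ) b

lemma extChartAt_dualFibre (b₀ b : DualFibre F (E := E) q) :
    extChartAt 𝓘(ℝ, F →L[ℝ] ℝ) b₀ b = dualCoord F E q q b :=
  (coord_apply (F := F →L[ℝ] ℝ) (E := Dual E)
    (mem_baseSet_dual (mem_baseSet_trivializationAt F E q)) b).symm

variable (F E q) in
/-- The linear chart of the fibre of the dual bundle. -/
def fibreChart (b : DualFibre F (E := E) q) : F →L[ℝ] ℝ := dualCoord F E q q b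

lemma coe_extChartAt_dualFibre (b₀ : DualFibre F (E := E) q) :
    extChartAt 𝓘(ℝ, F →L[ℝ] ℝ) b₀ = fibreChart F E q :=
  funext (extChartAt_dualFibre b₀)

lemma contMDiff_fibreChart :
    ContMDiff 𝓘(ℝ, F →L[ℝ] ℝ) 𝓘(ℝ, F →L[ℝ] ℝ) ∞ (fibreChart F E q) := fun b => by
  rw [← coe_extChartAt_dualFibre b]
  exact contMDiffAt_extChartAt

lemma exists_fibreChart_symm : ∃ g : (F →L[ℝ] ℝ) → DualFibre F (E := E) q,
    ContMDiff 𝓘(ℝ, F →L[ℝ] ℝ) 𝓘(ℝ, F →L[ℝ] ℝ) ∞ g ∧ ∀ b, g (fibreChart F E q b) = b := by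
  let b₀ : DualFibre F (E := E) q := (0 : Dual E q)
  refine ⟨(extChartAt 𝓘(ℝ, F →L[ℝ] ℝ) b₀).symm, ?_, fun b => ?_⟩
  · rw [← contMDiffOn_univ]
    have h : (extChartAt 𝓘(ℝ, F →L[ℝ] ℝ) b₀).target = univ := by
      rw [extChartAt_target]
      simp only [modelWithCornersSelf_coe, modelWithCornersSelf_coe_symm, range_id, preimage_id,
        inter_univ]
      rfl
    rw [← h]
    exact contMDiffOn_extChartAt_symm b₀
  · rw [← coe_extChartAt_dualFibre b₀]
    exact (extChartAt 𝓘(ℝ, F →L[ℝ] ℝ) b₀).left_inv (mem_extChartAt_dualFibre_source b₀ b)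

lemma mvfderiv_fibreChart_bijective (b : DualFibre F (E := E) q) :
    Function.Bijective (mvfderiv 𝓘(ℝ, F →L[ℝ] ℝ) (fibreChart F E q) b) := by
  rw [← coe_extChartAt_dualFibre b]
  exact mvfderiv_extChartAt_bijective (mem_extChartAt_dualFibre_source b b)

lemma finrank_dual (hm : Module.finrank ℝ F = m) : Module.finrank ℝ (F →L[ℝ] ℝ) = m := by
  rw [← hm, ← (LinearMap.toContinuousLinearMap (E := F) (F' := ℝ) (𝕜 := ℝ)).finrank_eq]
  exact Subspace.dual_finrank_eq

lemma fibreAlgebroid_eq : fibreAlgebroid F E q =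
    paramTangent 𝓘(ℝ, F →L[ℝ] ℝ) (DualFibre F (E := E) q) := rfl

theorem fibreAlgebroid_isLieAlgebroid (hm : Module.finrank ℝ F = m) :
    (fibreAlgebroid F E q).IsLieAlgebroid m := by
  have h := paramTangent.isLieAlgebroid (ID := 𝓘(ℝ, F →L[ℝ] ℝ)) (D := DualFibre F (E := E) q)
  rw [finrank_dual hm] at h
  exact h

end FibreAlgebroid

/-! ### The fibres are Legendrian. -/

section FibreLegendrian

variable {EB : Type*} [NormedAddCommGroup EB] [NormedSpace ℝ EB] [FiniteDimensional ℝ EB]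
  {Q : Type*} [TopologicalSpace Q] [ChartedSpace EB Q] [IsManifold 𝓘(ℝ, EB) ∞ Q] [T2Space Q]
  {F : Type*} [NormedAddCommGroup F] [NormedSpace ℝ F] [FiniteDimensional ℝ F]
  {E : Q → Type*} [TopologicalSpace (TotalSpace F E)]
  [∀ q, AddCommGroup (E q)] [∀ q, Module ℝ (E q)] [∀ q, TopologicalSpace (E q)]
  [FiberBundle F E] [VectorBundle ℝ F E] [ContMDiffVectorBundle ∞ F E 𝓘(ℝ, EB)]
  {ρ : ∀ q, E q →L[ℝ] TangentSpace 𝓘(ℝ, EB) q}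
  {br : (∀ q, E q) → (∀ q, E q) → ∀ q, E q} {m : ℕ} {q : Q}

lemma contMDiff_fibreIncl :
    ContMDiff (𝓘(ℝ, F →L[ℝ] ℝ).prod 𝓘(ℝ, ℝ)) (phaseModel EB F) ∞ (fibreIncl F (E := E) q) := by
  intro x
  refine ContMDiffAt.prodMk ?_ contMDiffAt_snd
  refine (contMDiffAt_iff_coord (F := F →L[ℝ] ℝ) (E := Dual E) (f := fun _ => q)
    (s := fun x : DualFibre F (E := E) q × ℝ => x.1) contMDiffAt_const
    (mem_baseSet_dual (mem_baseSet_trivializationAt F E q))).2 ?_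
  exact (contMDiff_fibreChart x.1).comp x contMDiffAt_fst

lemma fibreIncl_mem_phaseDomain (x : DualFibre F (E := E) q × ℝ) :
    fibreIncl F q x ∈ phaseDomain (EB := EB) F E q :=
  mem_phaseDomain (fibreIncl F q x)

/-- In fibre coordinates the inclusion is the linear chart times the identity of `ℝ`; injectivity of
its tangent map and vanishing of the contact form are read off from this. -/
lemma mvfderiv_phaseCoord_fibreIncl (x : DualFibre F (E := E) q × ℝ)
    (v : TangentSpace (𝓘(ℝ, F →L[ℝ] ℝ).prod 𝓘(ℝ, ℝ)) x) :
    mvfderiv (phaseModel EB F) (phaseCoord F E q) (fibreIncl F q x)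
      (mfderiv (𝓘(ℝ, F →L[ℝ] ℝ).prod 𝓘(ℝ, ℝ)) (phaseModel EB F) (fibreIncl F q) x v) =
      (mvfderiv 𝓘(ℝ, F →L[ℝ] ℝ) (fibreChart F E q) x.1 v.1, v.2) := by
  have hc : ContMDiffAt (𝓘(ℝ, F →L[ℝ] ℝ).prod 𝓘(ℝ, ℝ)) 𝓘(ℝ, (F →L[ℝ] ℝ) × ℝ) ∞
      (fun y : DualFibre F (E := E) q × ℝ => phaseCoord F E q (fibreIncl F q y)) x :=
    (contMDiffAt_phaseCoord (fibreIncl_mem_phaseDomain (EB := EB) x)).comp x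
      (contMDiff_fibreIncl (EB := EB) x)
  have hd := hc.mdifferentiableAt (n := ∞) (by simp)
  rw [← mvfderiv_comp' (f := fibreIncl F q) (g := phaseCoord F E q)
    ((contMDiffAt_phaseCoord (fibreIncl_mem_phaseDomain x)).mdifferentiableAt (n := ∞) (by simp))
    ((contMDiff_fibreIncl x).mdifferentiableAt (n := ∞) (by simp))]
  refine Prod.ext ?_ ?_
  · refine (mvfderiv_clm_comp (ContinuousLinearMap.fst ℝ (F →L[ℝ] ℝ) ℝ) hd v).symm.trans ?_
    refine (mvfderiv_comp' (f := fun y : DualFibre F (E := E) q × ℝ => y.1)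
      (g := fibreChart F E q) ((contMDiff_fibreChart x.1).mdifferentiableAt (n := ∞) (by simp))
      mdifferentiableAt_fst v).trans ?_
    exact congr_arg (mvfderiv 𝓘(ℝ, F →L[ℝ] ℝ) (fibreChart F E q) x.1)
      (DFunLike.congr_fun (mfderiv_fst (x := x)) v)
  · refine (mvfderiv_clm_comp (ContinuousLinearMap.snd ℝ (F →L[ℝ] ℝ) ℝ) hd v).symm.trans ?_
    exact DFunLike.congr_fun (mfderiv_snd (x := x)) v

lemma fibreInclBundle_fst (x : DualFibre F (E := E) q × ℝ)
    (v : TangentSpace 𝓘(ℝ, F →L[ℝ] ℝ) x.1) : (fibreInclBundle F ρ q x v).1.1 = 0 := rfl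

lemma fibreInclBundle_snd (x : DualFibre F (E := E) q × ℝ)
    (v : TangentSpace 𝓘(ℝ, F →L[ℝ] ℝ) x.1) :
    (fibreInclBundle F ρ q x v).1.2 =
      mfderiv (𝓘(ℝ, F →L[ℝ] ℝ).prod 𝓘(ℝ, ℝ)) (phaseModel EB F) (fibreIncl F q) x
        ((fibreAlgebroid F E q).anchor x v) :=
  mfderiv_comp_apply x.1 (g := fibreIncl F q) (f := fun b => (b, x.2))
    ((contMDiff_fibreIncl x).mdifferentiableAt (n := ∞) (by simp))
    ((paramTangent.contMDiff_slice x.2 x.1).mdifferentiableAt (n := ∞) (by simp)) v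

lemma hamTriv_fibreInclBundle (x : DualFibre F (E := E) q × ℝ)
    (v : TangentSpace 𝓘(ℝ, F →L[ℝ] ℝ) x.1) :
    hamTriv ρ q (fibreIncl F q x) (fibreInclBundle F ρ q x v) =
      (0, (mvfderiv 𝓘(ℝ, F →L[ℝ] ℝ) (fibreChart F E q) x.1 v, 0)) := by
  rw [prolongTriv_apply, fibreInclBundle_fst, fibreInclBundle_snd, map_zero,
    mvfderiv_phaseCoord_fibreIncl, fibreAlgebroid_eq, paramTangent.anchor_apply]

lemma fibreInclBundle_injective (x : DualFibre F (E := E) q × ℝ) :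
    Function.Injective (fibreInclBundle F ρ q x) := by
  intro v w h
  have h1 := congr_arg (hamTriv ρ q (fibreIncl F q x)) h
  rw [hamTriv_fibreInclBundle, hamTriv_fibreInclBundle] at h1
  exact (mvfderiv_fibreChart_bijective x.1).1 (Prod.ext_iff.1 (Prod.ext_iff.1 h1).2).1

lemma fibreIncl_injective : Function.Injective (fibreIncl F (E := E) q) := by
  rintro ⟨b, s⟩ ⟨b', s'⟩ h
  cases h
  rfl

lemma mfderiv_fibreIncl_injective (x : DualFibre F (E := E) q × ℝ) :
    Function.Injective
      (mfderiv (𝓘(ℝ, F →L[ℝ] ℝ).prod 𝓘(ℝ, ℝ)) (phaseModel EB F) (fibreIncl F q) x) := by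
  intro v w h
  have h1 := congr_arg (mvfderiv (phaseModel EB F) (phaseCoord F E q) (fibreIncl F q x)) h
  rw [mvfderiv_phaseCoord_fibreIncl, mvfderiv_phaseCoord_fibreIncl] at h1
  exact Prod.ext ((mvfderiv_fibreChart_bijective x.1).1 (Prod.ext_iff.1 h1).1)
    (Prod.ext_iff.1 h1).2

lemma contactForm_fibreInclBundle (x : DualFibre F (E := E) q × ℝ)
    (v : TangentSpace 𝓘(ℝ, F →L[ℝ] ℝ) x.1) :
    contactForm F ρ (fibreIncl F q x) (fibreInclBundle F ρ q x v) = 0 := by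
  rw [contactForm_apply, fibreInclBundle_fst, map_zero, sub_zero,
    mvfderiv_phaseCoord_snd (fibreIncl_mem_phaseDomain x), fibreInclBundle_snd,
    mvfderiv_phaseCoord_fibreIncl, fibreAlgebroid_eq, paramTangent.anchor_apply]

/-- In the linear chart a section of `TE*_q × ℝ` is a function `k` of `b` and `s`. It extends to
nearby fibres by evaluating `k` at the fibre coordinates of the point, with zero `E`- and
`s`-components. -/
lemma exists_isSmooth_fibreIncl_eq (hm : Module.finrank ℝ F = m)
    (hE : (ofBundle F ρ br).IsLieAlgebroid m) (x : DualFibre F (E := E) q × ℝ)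
    {σ : ∀ x : DualFibre F (E := E) q × ℝ, TangentSpace 𝓘(ℝ, F →L[ℝ] ℝ) x.1}
    (hσ : (fibreAlgebroid F E q).IsSmooth σ) :
    ∃ τ, (hamProlongation F ρ br).IsSmooth τ ∧
      ∀ᶠ y in 𝓝 x, τ (fibreIncl F q y) = fibreInclBundle F ρ q y (σ y) := by
  obtain ⟨g, hg, hgb⟩ := exists_fibreChart_symm (F := F) (E := E) (q := q)
  let k : DualFibre F (E := E) q × ℝ → F →L[ℝ] ℝ := fun y =>
    mvfderiv 𝓘(ℝ, F →L[ℝ] ℝ) (fibreChart F E q) y.1 (σ y)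
  have hk : ContMDiff (𝓘(ℝ, F →L[ℝ] ℝ).prod 𝓘(ℝ, ℝ)) 𝓘(ℝ, F →L[ℝ] ℝ) ∞ k := by
    intro y
    have h := (contMDiffAt_vectorField_iff (g := fun y : DualFibre F (E := E) q × ℝ => y.1)
      contMDiffAt_fst (mem_extChartAt_dualFibre_source y.1 y.1)).1 (hσ y)
    rw [coe_extChartAt_dualFibre] at h
    exact h
  let h : Phase F E → F × ((F →L[ℝ] ℝ) × ℝ) := fun p =>
    (0, (k (g (phaseCoord F E q p).1, p.2), 0))
  have hx := fibreIncl_mem_phaseDomain (EB := EB) x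
  have hh : ∀ᶠ p in 𝓝 (fibreIncl F q x),
      ContMDiffAt (phaseModel EB F) 𝓘(ℝ, F × ((F →L[ℝ] ℝ) × ℝ)) ∞ h p := by
    filter_upwards [(isOpen_phaseDomain q).mem_nhds hx] with p hp
    rw [contMDiffAt_prod_module_iff, contMDiffAt_prod_module_iff]
    refine ⟨contMDiffAt_const, ?_, contMDiffAt_const⟩
    exact ContMDiffAt.comp (f := fun p : Phase F E => (g (phaseCoord F E q p).1, p.2)) (g := k) p
      (hk (g (phaseCoord F E q p).1, p.2))
      (((hg _).comp p (contMDiffAt_phaseCoord_fst hp)).prodMk contMDiffAt_snd)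
  obtain ⟨τ, hτ, hτh⟩ := exists_isSmooth_hamTriv_eq hm hE (fibreIncl F q x) hh
  refine ⟨τ, hτ, ?_⟩
  filter_upwards [(contMDiff_fibreIncl (EB := EB) x).continuousAt.eventually hτh] with y hy
  refine hamTriv_injective (fibreIncl_mem_phaseDomain y) (hy.trans ?_)
  rw [hamTriv_fibreInclBundle]
  change (0, (k (g (fibreChart F E q y.1), y.2), 0)) = _
  rw [hgb]

/-- The `E`-coordinates vanish along `E*_q × ℝ`, and hence so do their derivatives in tangent
directions; the coordinate formula then gives zero. The tangent components are related by the slice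
of constant `s`. -/
lemma bracket_fibreInclBundle (hm : Module.finrank ℝ F = m)
    (hE : (ofBundle F ρ br).IsLieAlgebroid m) (x : DualFibre F (E := E) q × ℝ)
    {σ σ' : ∀ x : DualFibre F (E := E) q × ℝ, TangentSpace 𝓘(ℝ, F →L[ℝ] ℝ) x.1}
    {τ τ' : ∀ p, HamFibre F ρ p} (hσ : (fibreAlgebroid F E q).IsSmooth σ)
    (hσ' : (fibreAlgebroid F E q).IsSmooth σ') (hτ : (hamProlongation F ρ br).IsSmooth τ)
    (hτ' : (hamProlongation F ρ br).IsSmooth τ')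
    (h : ∀ᶠ y in 𝓝 x, τ (fibreIncl F q y) = fibreInclBundle F ρ q y (σ y))
    (h' : ∀ᶠ y in 𝓝 x, τ' (fibreIncl F q y) = fibreInclBundle F ρ q y (σ' y)) :
    (hamProlongation F ρ br).bracket τ τ' (fibreIncl F q x) =
      fibreInclBundle F ρ q x ((fibreAlgebroid F E q).bracket σ σ' x) := by
  have hx := fibreIncl_mem_phaseDomain (EB := EB) x
  obtain ⟨O, R, C, hq, hO⟩ := exists_isLocalForm hE q
  have hi := (contMDiff_fibreIncl (EB := EB) (E := E) (q := q) x).mdifferentiableAt (n := ∞)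
    (by simp)
  have hcoord : ∀ {σ : ∀ x : DualFibre F (E := E) q × ℝ, TangentSpace 𝓘(ℝ, F →L[ℝ] ℝ) x.1}
      {τ : ∀ p, HamFibre F ρ p}, (hamProlongation F ρ br).IsSmooth τ →
      (∀ᶠ y in 𝓝 x, τ (fibreIncl F q y) = fibreInclBundle F ρ q y (σ y)) →
      prolongCoord F q τ (fibreIncl F q x) = 0 ∧
      ∀ v, mvfderiv (phaseModel EB F) (prolongCoord F q τ) (fibreIncl F q x)
        (mfderiv (𝓘(ℝ, F →L[ℝ] ℝ).prod 𝓘(ℝ, ℝ)) (phaseModel EB F) (fibreIncl F q) x v) = 0 := by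
    intro σ τ hτ h
    have h0 : ∀ᶠ y in 𝓝 x, prolongCoord F q τ (fibreIncl F q y) = 0 := by
      filter_upwards [h] with y hy
      rw [prolongCoord, hy, fibreInclBundle_fst, map_zero]
    refine ⟨h0.self_of_nhds, fun v => ?_⟩
    rw [← mvfderiv_comp' (f := fibreIncl F q) (g := prolongCoord F q τ)
      ((contMDiffAt_prolongCoord contMDiff_phaseProj hx.1 (hτ _)).mdifferentiableAt (n := ∞)
        (by simp)) hi]
    rw [Filter.EventuallyEq.mvfderiv_eq (g := fun _ => (0 : F)) h0, mvfderiv_const]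
    rfl
  obtain ⟨hc1, hc2⟩ := hcoord hτ h
  obtain ⟨hd1, hd2⟩ := hcoord hτ' h'
  refine prolongFibre_ext (q₀ := q) hx.1 ?_ ?_
  · refine (prolongCoord_bracket hm hE hO contMDiff_phaseProj (p := fibreIncl F q x) hq (hτ _)
      (hτ' _)).trans ?_
    rw [hc1, h.self_of_nhds, h'.self_of_nhds, fibreInclBundle_snd, fibreInclBundle_snd, hc2, hd2,
      fibreInclBundle_fst, map_zero, map_zero]
    simp
  · refine (prolongation_bracket_snd hm hE contMDiff_phaseProj (hτ _) (hτ' _)).trans ?_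
    have hs : ContMDiffAt 𝓘(ℝ, F →L[ℝ] ℝ) (phaseModel EB F) ∞
        (fun b : DualFibre F (E := E) q => fibreIncl F q (b, x.2)) x.1 :=
      (contMDiff_fibreIncl x).comp x.1 (paramTangent.contMDiff_slice x.2 x.1)
    have hl : Filter.Tendsto (fun b : DualFibre F (E := E) q => (b, x.2)) (𝓝 x.1) (𝓝 x) :=
      (paramTangent.contMDiff_slice (ID := 𝓘(ℝ, F →L[ℝ] ℝ)) x.2).continuous.tendsto x.1
    refine mlieBracket_of_related (g := fun b => fibreIncl F q (b, x.2)) (b := x.1) hs (hτ _).2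
      (hτ' _).2 ((paramTangent.contMDiffAt_slice hσ x.2 x.1).mdifferentiableAt (n := ∞) (by simp))
      ((paramTangent.contMDiffAt_slice hσ' x.2 x.1).mdifferentiableAt (n := ∞) (by simp)) ?_ ?_
    · filter_upwards [hl.eventually h] with b hb
      rw [hb]
      rfl
    · filter_upwards [hl.eventually h'] with b hb
      rw [hb]
      rfl

theorem fibreAlgebroid_isLegendrian (hm : Module.finrank ℝ F = m)
    (hE : (ofBundle F ρ br).IsLieAlgebroid m) :
    IsLegendrian m (fibreAlgebroid F E q) (hamProlongation F ρ br) (contactForm F ρ)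
      (fibreIncl F q) (fibreInclBundle F ρ q) where
  contact := hamProlongation_isContact hm hE
  subalgebroid := ⟨m, {
    source := fibreAlgebroid_isLieAlgebroid hm
    target := hamProlongation_isLieAlgebroid hm hE
    morphism := isMorphism_of_related (hamProlongation_isLieAlgebroid hm hE) contMDiff_fibreIncl
      (fun x v => (fibreInclBundle_snd (ρ := ρ) x v).symm)
      (fun x _ hσ => exists_isSmooth_fibreIncl_eq hm hE x hσ)
      (fun x _ _ _ _ hσ hσ' hτ hτ' h h' => bracket_fibreInclBundle hm hE x hσ hσ' hτ hτ' h h')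
    fibre_injective := fibreInclBundle_injective
    base_injective := fibreIncl_injective
    base_immersion := mfderiv_fibreIncl_injective }⟩
  dim_fibre _ := finrank_dual hm
  vanishing := contactForm_fibreInclBundle

end FibreLegendrian

/-! ### The Lie algebroid `F_γ`. -/

namespace PhaseSection

variable {EB : Type*} [NormedAddCommGroup EB] [NormedSpace ℝ EB] [FiniteDimensional ℝ EB]
  {Q : Type*} [TopologicalSpace Q] [ChartedSpace EB Q] [IsManifold 𝓘(ℝ, EB) ∞ Q] [T2Space Q]
  {F : Type*} [NormedAddCommGroup F] [NormedSpace ℝ F] [FiniteDimensional ℝ F]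
  {E : Q → Type*} [TopologicalSpace (TotalSpace F E)]
  [∀ q, AddCommGroup (E q)] [∀ q, Module ℝ (E q)] [∀ q, TopologicalSpace (E q)]
  [FiberBundle F E] [VectorBundle ℝ F E] [ContMDiffVectorBundle ∞ F E 𝓘(ℝ, EB)]
  {ρ : ∀ q, E q →L[ℝ] TangentSpace 𝓘(ℝ, EB) q}
  {br : (∀ q, E q) → (∀ q, E q) → ∀ q, E q} {m : ℕ} {γ : PhaseSection EB F E}

lemma exists_toImage_eq (x : γ.Image) : ∃ q, γ.toImage q = x := by
  obtain ⟨_, q, rfl⟩ := x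
  exact ⟨q, rfl⟩

/-- The charts of `γ(Q)` are those of `Q` composed with the homeomorphism, so the coordinate
expression is that of the identity of `Q`. -/
lemma contMDiff_base : ContMDiff 𝓘(ℝ, EB) 𝓘(ℝ, EB) ∞ γ.base := fun x =>
  contMDiffAt_iff.2 ⟨γ.imageHomeo.continuous.continuousAt,
    (contMDiffAt_iff.1 (contMDiffAt_id (I := 𝓘(ℝ, EB)) (n := ∞) (x := γ.base x))).2⟩

lemma contMDiff_toImage : ContMDiff 𝓘(ℝ, EB) 𝓘(ℝ, EB) ∞ γ.toImage := fun q =>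
  contMDiffAt_iff.2 ⟨γ.imageHomeo.symm.continuous.continuousAt,
    (contMDiffAt_iff.1 (contMDiffAt_id (I := 𝓘(ℝ, EB)) (n := ∞) (x := q))).2⟩

lemma map_base (x : γ.Image) : γ.map (γ.base x) = γ.incl x := by
  obtain ⟨q, rfl⟩ := exists_toImage_eq x
  rfl

lemma contMDiff_map : ContMDiff 𝓘(ℝ, EB) (phaseModel EB F) ∞ γ.map := γ.smooth

lemma contMDiff_incl : ContMDiff 𝓘(ℝ, EB) (phaseModel EB F) ∞ γ.incl := by
  have h : γ.incl = γ.map ∘ γ.base := funext fun x => (map_base x).symm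
  rw [h]
  exact contMDiff_map.comp contMDiff_base

lemma fibre_ext {x : γ.Image} {z w : γ.fibre ρ x} (h : z.1.1 = w.1.1) : z = w := by
  have h2 : z.1.2 = w.1.2 := by
    rw [show z.1.2 = γ.tangent x (ρ _ z.1.1) from z.2, h]
    exact w.2.symm
  exact Subtype.ext (Prod.ext h h2)

/-- The section of `E` which corresponds to a section of `F_γ`. -/
def pull (σ : ∀ x : γ.Image, γ.fibre ρ x) (q : Q) : E q := (σ (γ.toImage q)).1.1

variable (ρ γ) in
/-- The coordinates of `F_γ` induced by coordinates of `E`. -/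
def fibreCoord (q₀ : Q) (x : γ.Image) : γ.fibre ρ x →ₗ[ℝ] F :=
  (coord F E q₀ (γ.base x)).comp ((LinearMap.fst ℝ _ _).comp (γ.fibre ρ x).subtype)

lemma fibreCoord_bijective {q₀ : Q} {x : γ.Image}
    (hx : γ.base x ∈ (trivializationAt F E q₀).baseSet) :
    Function.Bijective (fibreCoord ρ γ q₀ x) := by
  refine ⟨fun z w h => fibre_ext ((coord_bijective hx).1 h), fun a => ?_⟩
  obtain ⟨c, hc⟩ := (coord_bijective hx).2 a
  exact ⟨⟨(c, γ.tangent x (ρ _ c)), rfl⟩, hc⟩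

lemma finrank_fibre (hm : Module.finrank ℝ F = m) (x : γ.Image) :
    Module.finrank ℝ (γ.fibre ρ x) = m := by
  rw [← hm]
  exact (LinearEquiv.ofBijective _
    (fibreCoord_bijective (ρ := ρ) (mem_baseSet_trivializationAt F E (γ.base x)))).finrank_eq

lemma contMDiffAt_anchor (hE : (ofBundle F ρ br).IsLieAlgebroid m) {s : ∀ x : γ.Image, E (γ.base x)}
    {x : γ.Image} (hs : ContMDiffAt 𝓘(ℝ, EB) (𝓘(ℝ, EB).prod 𝓘(ℝ, F)) ∞
      (fun x => (⟨γ.base x, s x⟩ : TotalSpace F E)) x) :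
    ContMDiffAt 𝓘(ℝ, EB) 𝓘(ℝ, EB).tangent ∞
      (fun x => (⟨γ.base x, ρ _ (s x)⟩ : TangentBundle 𝓘(ℝ, EB) Q)) x := by
  obtain ⟨O, R, C, hq, hO⟩ := exists_isLocalForm hE (γ.base x)
  have hb := contMDiff_base x
  rw [contMDiffAt_vectorField_iff hb (hO.subset_source hq)]
  have h1 := (contMDiffAt_iff_coord hb (hO.subset_baseSet hq)).1 hs
  refine (((hO.smooth_R _ hq).comp x hb).clm_apply h1).congr_of_eventuallyEq ?_
  filter_upwards [hb.continuousAt.eventually (hO.isOpen.mem_nhds hq)] with y hy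
  exact (hO.anchor _ hy _).symm

/-- The second component is the image of the first under the anchor and the tangent map of `γ`, both
smooth. -/
lemma algebroid_smoothAt_iff (hE : (ofBundle F ρ br).IsLieAlgebroid m)
    {σ : ∀ x : γ.Image, γ.fibre ρ x} {x : γ.Image} :
    (γ.algebroid ρ br).smoothAt σ x ↔
      ContMDiffAt 𝓘(ℝ, EB) (𝓘(ℝ, EB).prod 𝓘(ℝ, F)) ∞
        (fun x => (⟨γ.base x, (σ x).1.1⟩ : TotalSpace F E)) x := by
  refine ⟨fun h => h.1, fun h => ⟨h, ?_⟩⟩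
  refine (ContMDiffAt.mfderiv_vectorField (g := γ.base) (contMDiff_map (γ := γ) (γ.base x))
    (contMDiffAt_anchor hE h)).congr_of_eventuallyEq (Filter.Eventually.of_forall fun y => ?_)
  obtain ⟨q, rfl⟩ := exists_toImage_eq y
  exact congr_arg (TotalSpace.mk (γ.map q)) (σ (γ.toImage q)).2

lemma isSmooth_pull {σ : ∀ x : γ.Image, γ.fibre ρ x} (hσ : (γ.algebroid ρ br).IsSmooth σ) :
    (ofBundle F ρ br).IsSmooth (pull σ) := fun q =>
  ContMDiffAt.comp (f := γ.toImage) (g := fun x => (⟨γ.base x, (σ x).1.1⟩ : TotalSpace F E)) q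
    (hσ (γ.toImage q)).1 (contMDiff_toImage q)

lemma algebroid_isSmoothBundle (hm : Module.finrank ℝ F = m)
    (hE : (ofBundle F ρ br).IsLieAlgebroid m) : (γ.algebroid ρ br).IsSmoothBundle m := by
  refine AlgebroidData.isSmoothBundle_of_coords hm fun x₀ =>
    ⟨γ.base ⁻¹' (trivializationAt F E (γ.base x₀)).baseSet,
      eventually_mem_baseSet contMDiff_base.continuous.continuousAt
        (mem_baseSet_trivializationAt F E (γ.base x₀)),
      fibreCoord ρ γ (γ.base x₀), fun x hx => ⟨fibreCoord_bijective hx, fun σ => ?_⟩⟩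
  rw [algebroid_smoothAt_iff hE]
  exact contMDiffAt_iff_coord (contMDiff_base x) hx

lemma algebroid_anchor_smooth (hE : (ofBundle F ρ br).IsLieAlgebroid m)
    {σ : ∀ x : γ.Image, γ.fibre ρ x} (hσ : (γ.algebroid ρ br).IsSmooth σ) :
    ContMDiff 𝓘(ℝ, EB) 𝓘(ℝ, EB).tangent ∞
      (fun x => (⟨x, (γ.algebroid ρ br).anchor x (σ x)⟩ : TangentBundle 𝓘(ℝ, EB) γ.Image)) := by
  intro x
  refine (ContMDiffAt.mfderiv_vectorField (g := γ.base) (contMDiff_toImage (γ := γ) (γ.base x))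
    (contMDiffAt_anchor hE (hσ x).1)).congr_of_eventuallyEq
      (Filter.Eventually.of_forall fun y => ?_)
  obtain ⟨q, rfl⟩ := exists_toImage_eq y
  rfl

lemma algebroid_bracket_smooth (hE : (ofBundle F ρ br).IsLieAlgebroid m)
    {σ τ : ∀ x : γ.Image, γ.fibre ρ x} (hσ : (γ.algebroid ρ br).IsSmooth σ)
    (hτ : (γ.algebroid ρ br).IsSmooth τ) :
    (γ.algebroid ρ br).IsSmooth ((γ.algebroid ρ br).bracket σ τ) := fun x => by
  rw [algebroid_smoothAt_iff hE]
  exact ContMDiffAt.comp (f := γ.base)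
    (g := fun q => (⟨q, br (pull σ) (pull τ) q⟩ : TotalSpace F E)) x
    (hE.bracket_smooth _ _ (isSmooth_pull hσ) (isSmooth_pull hτ) (γ.base x)) (contMDiff_base x)

/-- Transfers bracket identities from `E`: the bracket of `F_γ` pulls back by definition to that of
`E`. -/
lemma ext_pull {σ τ : ∀ x : γ.Image, γ.fibre ρ x} (h : pull σ = pull τ) : σ = τ := by
  funext x
  obtain ⟨q, rfl⟩ := exists_toImage_eq x
  exact fibre_ext (congr_fun h q)

lemma algebroid_deriv {f : γ.Image → ℝ} (hf : ContMDiff 𝓘(ℝ, EB) 𝓘(ℝ, ℝ) ∞ f) (q : Q)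
    (z : γ.fibre ρ (γ.toImage q)) :
    (γ.algebroid ρ br).deriv f (γ.toImage q) z =
      (ofBundle F ρ br).deriv (fun q => f (γ.toImage q)) q z.1.1 :=
  (mvfderiv_comp' (f := γ.toImage) (g := f) ((hf _).mdifferentiableAt (by simp))
    ((contMDiff_toImage q).mdifferentiableAt (by simp)) (ρ q z.1.1)).symm

theorem algebroid_isLieAlgebroid (hm : Module.finrank ℝ F = m)
    (hE : (ofBundle F ρ br).IsLieAlgebroid m) : (γ.algebroid ρ br).IsLieAlgebroid m where
  bundle := algebroid_isSmoothBundle hm hE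
  anchor_smooth _ hσ := algebroid_anchor_smooth hE hσ
  bracket_smooth _ _ hσ hτ := algebroid_bracket_smooth hE hσ hτ
  bracket_add _ _ _ hσ h₁ h₂ := ext_pull
    (hE.bracket_add _ _ _ (isSmooth_pull hσ) (isSmooth_pull h₁) (isSmooth_pull h₂))
  bracket_smul c _ _ hσ hτ := ext_pull
    (hE.bracket_smul c _ _ (isSmooth_pull hσ) (isSmooth_pull hτ))
  bracket_antisymm _ _ hσ hτ := ext_pull
    (hE.bracket_antisymm _ _ (isSmooth_pull hσ) (isSmooth_pull hτ))
  jacobi _ _ _ hσ hτ hυ := ext_pull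
    (hE.jacobi _ _ _ (isSmooth_pull hσ) (isSmooth_pull hτ) (isSmooth_pull hυ))
  leibniz f σ τ hf hσ hτ := ext_pull <| by
    refine (hE.leibniz (fun q => f (γ.toImage q)) (pull σ) (pull τ) (hf.comp contMDiff_toImage)
      (isSmooth_pull hσ) (isSmooth_pull hτ)).trans (funext fun q => ?_)
    exact congr_arg (fun c : ℝ => f (γ.toImage q) • br (pull σ) (pull τ) q + c • pull τ q)
      (algebroid_deriv hf q (σ (γ.toImage q))).symm

end PhaseSection

/-! ### `F_γ` as a subalgebroid, and the Legendrian condition. -/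

namespace PhaseSection

variable {EB : Type*} [NormedAddCommGroup EB] [NormedSpace ℝ EB] [FiniteDimensional ℝ EB]
  {Q : Type*} [TopologicalSpace Q] [ChartedSpace EB Q] [IsManifold 𝓘(ℝ, EB) ∞ Q] [T2Space Q]
  {F : Type*} [NormedAddCommGroup F] [NormedSpace ℝ F] [FiniteDimensional ℝ F]
  {E : Q → Type*} [TopologicalSpace (TotalSpace F E)]
  [∀ q, AddCommGroup (E q)] [∀ q, Module ℝ (E q)] [∀ q, TopologicalSpace (E q)]
  [FiberBundle F E] [VectorBundle ℝ F E] [ContMDiffVectorBundle ∞ F E 𝓘(ℝ, EB)]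
  {ρ : ∀ q, E q →L[ℝ] TangentSpace 𝓘(ℝ, EB) q}
  {br : (∀ q, E q) → (∀ q, E q) → ∀ q, E q} {m : ℕ} {γ : PhaseSection EB F E}

/-- The projection to `Q` followed by `γ : Q → γ(Q)` is a smooth left inverse of the inclusion. -/
lemma mfderiv_incl_injective (x : γ.Image) :
    Function.Injective (mfderiv 𝓘(ℝ, EB) (phaseModel EB F) γ.incl x) := by
  obtain ⟨q, rfl⟩ := exists_toImage_eq x
  have h1 : ∀ v, mfderiv (phaseModel EB F) 𝓘(ℝ, EB) (phaseProj F E) (γ.map q)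
      (mfderiv 𝓘(ℝ, EB) (phaseModel EB F) γ.incl (γ.toImage q) v) =
      mfderiv 𝓘(ℝ, EB) 𝓘(ℝ, EB) γ.base (γ.toImage q) v := fun v =>
    (mfderiv_comp_apply (γ.toImage q) (g := phaseProj F E) (f := γ.incl)
      (phaseProj_mdifferentiable (EB := EB) F E _)
      ((contMDiff_incl _).mdifferentiableAt (n := ∞) (by simp)) v).symm
  have h2 : ∀ v, mfderiv 𝓘(ℝ, EB) 𝓘(ℝ, EB) γ.toImage q
      (mfderiv 𝓘(ℝ, EB) 𝓘(ℝ, EB) γ.base (γ.toImage q) v) = v := by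
    intro v
    have h3 := mfderiv_comp_apply (I := 𝓘(ℝ, EB)) (I' := 𝓘(ℝ, EB)) (I'' := 𝓘(ℝ, EB))
      (γ.toImage q) (g := γ.toImage) (f := γ.base)
      ((contMDiff_toImage _).mdifferentiableAt (n := ∞) (by simp))
      ((contMDiff_base _).mdifferentiableAt (n := ∞) (by simp)) v
    have h4 : γ.toImage ∘ γ.base = id := funext γ.imageHomeo.left_inv
    rw [h4, mfderiv_id] at h3
    exact h3.symm
  intro v w h
  rw [← h2 v, ← h2 w]
  exact congr_arg _ ((h1 v).symm.trans ((congr_arg _ h).trans (h1 w)))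

lemma mfderiv_incl_anchor (x : γ.Image) (z : γ.fibre ρ x) :
    mfderiv 𝓘(ℝ, EB) (phaseModel EB F) γ.incl x ((γ.algebroid ρ br).anchor x z) =
      (hamProlongation F ρ br).anchor (γ.incl x) (γ.inclBundle ρ x z) := by
  obtain ⟨q, rfl⟩ := exists_toImage_eq x
  refine Eq.trans ?_ z.2.symm
  exact (mfderiv_comp_apply q (g := γ.incl) (f := γ.toImage)
      ((contMDiff_incl _).mdifferentiableAt (n := ∞) (by simp))
      ((contMDiff_toImage _).mdifferentiableAt (n := ∞) (by simp)) (ρ q z.1.1)).symm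

lemma inclBundle_snd (q : Q) (z : γ.fibre ρ (γ.toImage q)) :
    (γ.inclBundle ρ (γ.toImage q) z).1.2 =
      mfderiv 𝓘(ℝ, EB) (phaseModel EB F) γ.map q (ρ q z.1.1) := z.2

/-- The extension has coordinates constant along the fibres of `π`: those of the section at the
point of `γ(Q)` over the same base point. On `γ(Q)` the chain rule identifies them with the
coordinates of the inclusion. -/
lemma exists_isSmooth_incl_eq (hm : Module.finrank ℝ F = m)
    (hE : (ofBundle F ρ br).IsLieAlgebroid m) (q₀ : Q)
    {σ : ∀ x : γ.Image, γ.fibre ρ x} (hσ : (γ.algebroid ρ br).IsSmooth σ) :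
    ∃ τ, (hamProlongation F ρ br).IsSmooth τ ∧
      ∀ᶠ x in 𝓝 (γ.toImage q₀), τ (γ.incl x) = γ.inclBundle ρ x (σ x) := by
  have hs := isSmooth_pull hσ
  let h : Phase F E → F × ((F →L[ℝ] ℝ) × ℝ) := fun p =>
    (coord F E q₀ p.1.proj (pull σ p.1.proj),
      mvfderiv 𝓘(ℝ, EB) (fun q => phaseCoord F E q₀ (γ.map q)) p.1.proj
        (ρ p.1.proj (pull σ p.1.proj)))
  have hκ : ∀ q ∈ (trivializationAt F E q₀).baseSet ∩ (extChartAt 𝓘(ℝ, EB) q₀).source,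
      ContMDiffAt 𝓘(ℝ, EB) 𝓘(ℝ, (F →L[ℝ] ℝ) × ℝ) ∞ (fun q => phaseCoord F E q₀ (γ.map q)) q :=
    fun q hq => (contMDiffAt_phaseCoord (p := γ.map q) hq).comp q (contMDiff_map q)
  have hp : γ.map q₀ ∈ phaseDomain (EB := EB) F E q₀ := mem_phaseDomain (γ.map q₀)
  have hd := (isOpen_phaseDomain (EB := EB) (F := F) (E := E) q₀).mem_nhds hp
  have hh : ∀ᶠ p in 𝓝 (γ.map q₀),
      ContMDiffAt (phaseModel EB F) 𝓘(ℝ, F × ((F →L[ℝ] ℝ) × ℝ)) ∞ h p := by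
    filter_upwards [hd] with p hp
    have h1 : ContMDiffAt 𝓘(ℝ, EB) 𝓘(ℝ, (F →L[ℝ] ℝ) × ℝ) ∞
        (fun q => mvfderiv 𝓘(ℝ, EB) (fun q => phaseCoord F E q₀ (γ.map q)) q (ρ q (pull σ q)))
        (phaseProj F E p) :=
      contMDiffAt_mvfderiv_apply (g := fun q => q) (hκ _ hp) (hE.anchor_smooth _ hs _)
    exact (contMDiffAt_prod_module_iff _).2 ⟨(contMDiffAt_coord hs hp.1).comp p
      (contMDiff_phaseProj p), h1.comp p (contMDiff_phaseProj p)⟩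
  obtain ⟨τ, hτ, hτh⟩ := exists_isSmooth_hamTriv_eq hm hE (γ.map q₀) hh
  refine ⟨τ, hτ, ?_⟩
  have hc : Filter.Tendsto γ.incl (𝓝 (γ.toImage q₀)) (𝓝 (γ.map q₀)) :=
    contMDiff_incl.continuous.tendsto _
  filter_upwards [hc.eventually hτh, hc.eventually hd] with x hx hxd
  obtain ⟨q, rfl⟩ := exists_toImage_eq x
  refine hamTriv_injective hxd (hx.trans ?_)
  refine Prod.ext rfl ?_
  refine Eq.trans ?_ (congr_arg (mvfderiv (phaseModel EB F) (phaseCoord F E q₀) (γ.map q))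
    (inclBundle_snd q (σ (γ.toImage q))).symm)
  exact mvfderiv_comp' (f := γ.map) (g := phaseCoord F E q₀)
    ((contMDiffAt_phaseCoord hxd).mdifferentiableAt (n := ∞) (by simp))
    ((contMDiff_map q).mdifferentiableAt (n := ∞) (by simp)) (ρ q (pull σ q))

/-- Along `γ` the tangent components are `Tγ` of the anchors. Derivatives of the `E`-coordinates are
then derivatives on `Q`, and the formula for the prolongation becomes the local formula for `E`. The
tangent components of the bracket agree because related fields have related brackets and the anchor
of `E` preserves brackets. -/
lemma bracket_inclBundle (hm : Module.finrank ℝ F = m)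
    (hE : (ofBundle F ρ br).IsLieAlgebroid m) (q : Q)
    {σ σ' : ∀ x : γ.Image, γ.fibre ρ x} {τ τ' : ∀ p, HamFibre F ρ p}
    (hσ : (γ.algebroid ρ br).IsSmooth σ) (hσ' : (γ.algebroid ρ br).IsSmooth σ')
    (hτ : (hamProlongation F ρ br).IsSmooth τ) (hτ' : (hamProlongation F ρ br).IsSmooth τ')
    (h : ∀ᶠ x in 𝓝 (γ.toImage q), τ (γ.incl x) = γ.inclBundle ρ x (σ x))
    (h' : ∀ᶠ x in 𝓝 (γ.toImage q), τ' (γ.incl x) = γ.inclBundle ρ x (σ' x)) :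
    (hamProlongation F ρ br).bracket τ τ' (γ.map q) =
      γ.inclBundle ρ (γ.toImage q) ((γ.algebroid ρ br).bracket σ σ' (γ.toImage q)) := by
  have hs := isSmooth_pull hσ
  have hs' := isSmooth_pull hσ'
  have hp := mem_phaseDomain (EB := EB) (γ.map q)
  obtain ⟨O, R, C, hq, hO⟩ := exists_isLocalForm hE q
  have hi := (contMDiff_map (γ := γ) q).mdifferentiableAt (n := ∞) (by simp)
  have hc : Filter.Tendsto γ.toImage (𝓝 q) (𝓝 (γ.toImage q)) :=
    contMDiff_toImage.continuous.tendsto q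
  have hfst : ∀ {σ : ∀ x : γ.Image, γ.fibre ρ x} {τ : ∀ p, HamFibre F ρ p},
      (∀ᶠ x in 𝓝 (γ.toImage q), τ (γ.incl x) = γ.inclBundle ρ x (σ x)) →
      ∀ᶠ y in 𝓝 q, prolongCoord F q τ (γ.map y) = coord F E q y (pull σ y) := by
    intro σ τ h
    filter_upwards [hc.eventually h] with y hy
    exact congr_arg (fun z : HamFibre F ρ (γ.map y) => coord F E q y z.1.1) hy
  have hsnd : ∀ {σ : ∀ x : γ.Image, γ.fibre ρ x} {τ : ∀ p, HamFibre F ρ p},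
      (∀ᶠ x in 𝓝 (γ.toImage q), τ (γ.incl x) = γ.inclBundle ρ x (σ x)) →
      ∀ᶠ y in 𝓝 q, (τ (γ.map y)).1.2 =
        mfderiv 𝓘(ℝ, EB) (phaseModel EB F) γ.map y (ρ y (pull σ y)) := by
    intro σ τ h
    filter_upwards [hc.eventually h] with y hy
    exact (congr_arg (fun z : HamFibre F ρ (γ.map y) => z.1.2) hy).trans
      (inclBundle_snd y (σ (γ.toImage y)))
  have hder : ∀ {σ : ∀ x : γ.Image, γ.fibre ρ x} {τ : ∀ p, HamFibre F ρ p},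
      (hamProlongation F ρ br).IsSmooth τ →
      (∀ᶠ x in 𝓝 (γ.toImage q), τ (γ.incl x) = γ.inclBundle ρ x (σ x)) → ∀ v,
      mvfderiv (phaseModel EB F) (prolongCoord F q τ) (γ.map q)
        (mfderiv 𝓘(ℝ, EB) (phaseModel EB F) γ.map q v) =
      mvfderiv 𝓘(ℝ, EB) (fun y => coord F E q y (pull σ y)) q v := by
    intro σ τ hτ h v
    rw [← mvfderiv_comp' (f := γ.map) (g := prolongCoord F q τ)
      ((contMDiffAt_prolongCoord contMDiff_phaseProj hp.1 (hτ _)).mdifferentiableAt (n := ∞)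
        (by simp)) hi, Filter.EventuallyEq.mvfderiv_eq (hfst h)]
  refine prolongFibre_ext (q₀ := q) hp.1 ?_ ?_
  · refine (prolongCoord_bracket hm hE hO contMDiff_phaseProj (p := γ.map q) hq (hτ _)
      (hτ' _)).trans ?_
    rw [(hsnd h).self_of_nhds, (hsnd h').self_of_nhds, hder hτ h, hder hτ' h',
      (hfst h).self_of_nhds, (hfst h').self_of_nhds]
    exact (hO.bracket q hq _ _ hs hs').symm
  · refine (prolongation_bracket_snd hm hE contMDiff_phaseProj (hτ _) (hτ' _)).trans ?_
    refine (mlieBracket_of_related (g := γ.map) (b := q) (contMDiff_map q) (hτ _).2 (hτ' _).2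
      ((hE.anchor_smooth _ hs q).mdifferentiableAt (n := ∞) (by simp))
      ((hE.anchor_smooth _ hs' q).mdifferentiableAt (n := ∞) (by simp)) (hsnd h) (hsnd h')).trans ?_
    exact congr_arg (mfderiv 𝓘(ℝ, EB) (phaseModel EB F) γ.map q) (hE.anchor_bracket hs hs' q).symm

theorem algebroid_isLieSubalgebroid (hm : Module.finrank ℝ F = m)
    (hE : (ofBundle F ρ br).IsLieAlgebroid m) :
    IsLieSubalgebroid m (2 * m + 1) (γ.algebroid ρ br) (hamProlongation F ρ br)
      γ.incl (γ.inclBundle ρ) where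
  source := algebroid_isLieAlgebroid hm hE
  target := hamProlongation_isLieAlgebroid hm hE
  morphism := by
    refine isMorphism_of_related (hamProlongation_isLieAlgebroid hm hE) contMDiff_incl
      mfderiv_incl_anchor (fun x σ hσ => ?_) (fun x σ σ' τ τ' hσ hσ' hτ hτ' h h' => ?_)
    · obtain ⟨q, rfl⟩ := exists_toImage_eq x
      exact exists_isSmooth_incl_eq hm hE q hσ
    · obtain ⟨q, rfl⟩ := exists_toImage_eq x
      exact bracket_inclBundle hm hE q hσ hσ' hτ hτ' h h'
  fibre_injective x := Submodule.inclusion_injective _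
  base_injective := Subtype.val_injective
  base_immersion := mfderiv_incl_injective

lemma smooth_snd : ContMDiff 𝓘(ℝ, EB) 𝓘(ℝ, ℝ) ∞ γ.snd :=
  contMDiff_snd.comp γ.smooth

lemma contactForm_inclBundle (q : Q) (z : γ.fibre ρ (γ.toImage q)) :
    contactForm F ρ (γ.incl (γ.toImage q)) (γ.inclBundle ρ (γ.toImage q) z) =
      dE ρ γ.snd q z.1.1 - γ.fst q z.1.1 := by
  refine congr_arg (· - γ.fst q z.1.1) ((congr_arg (mvfderiv (phaseModel EB F)
    (fun p : Phase F E => p.2) (γ.map q)) (inclBundle_snd q z)).trans ?_)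
  exact (mvfderiv_comp' (f := γ.map) (g := fun p : Phase F E => p.2) mdifferentiableAt_snd
    ((contMDiff_map q).mdifferentiableAt (n := ∞) (by simp)) (ρ q z.1.1)).symm

lemma contactForm_inclBundle_eq_zero_iff :
    (∀ x (z : γ.fibre ρ x), contactForm F ρ (γ.incl x) (γ.inclBundle ρ x z) = 0) ↔
      ∀ q, γ.fst q = dE ρ γ.snd q := by
  constructor
  · intro h q
    ext a
    -- Every `a` occurs as the first component of a vector of the fibre, so vanishing on the fibre
    -- is an equality of functionals on `E q`.
    have h1 := h (γ.toImage q) ⟨(a, γ.tangent (γ.toImage q) (ρ q a)), rfl⟩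
    exact (sub_eq_zero.1 ((contactForm_inclBundle q _).symm.trans h1)).symm
  · intro h x z
    obtain ⟨q, rfl⟩ := exists_toImage_eq x
    exact (contactForm_inclBundle q z).trans
      (sub_eq_zero.2 (DFunLike.congr_fun (h q) z.1.1).symm)

/-- The `ℝ`-component of the jet forces `f = γ.snd` on `U`, so their differentials agree there.
Conversely `γ.snd` itself serves as `f`, on all of `Q`. -/
lemma isLocallyJet_iff : γ.IsLocallyJet ρ ↔ ∀ q, γ.fst q = dE ρ γ.snd q := by
  constructor
  · intro h q
    obtain ⟨U, hU, hq, f, -, hf⟩ := h q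
    have h1 : ∀ y ∈ U, γ.fst y = dE ρ f y ∧ γ.snd y = f y := by
      intro y hy
      have h2 := Prod.ext_iff.1 (hf y hy)
      exact ⟨TotalSpace.mk_injective y h2.1, h2.2⟩
    have h3 : γ.snd =ᶠ[𝓝 q] f := by
      filter_upwards [hU.mem_nhds hq] with y hy
      exact (h1 y hy).2
    rw [(h1 q hq).1, dE, dE, h3.mfderiv_eq]
  · intro h q
    refine ⟨univ, isOpen_univ, mem_univ q, γ.snd, smooth_snd.contMDiffOn, fun y _ => ?_⟩
    rw [map, h y]

theorem isLegendrian_iff_isLocallyJet (hm : Module.finrank ℝ F = m)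
    (hE : (ofBundle F ρ br).IsLieAlgebroid m) :
    IsLegendrian m (γ.algebroid ρ br) (hamProlongation F ρ br) (contactForm F ρ)
      γ.incl (γ.inclBundle ρ) ↔ γ.IsLocallyJet ρ := by
  rw [isLocallyJet_iff, ← contactForm_inclBundle_eq_zero_iff]
  exact ⟨fun h => h.vanishing, fun h => ⟨hamProlongation_isContact hm hE,
    ⟨m, algebroid_isLieSubalgebroid hm hE⟩, finrank_fibre hm, h⟩⟩

end PhaseSection

end LieAlg

end

/-- Let `(E, [[·,·]], ρ)` be a Lie algebroid of rank `m` over a manifold `Q`.  Then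
`𝒯^E (E* × ℝ)` is a contact Lie algebroid; for `q : Q` the pair `(j_q, i_q)` is a Legendrian Lie
subalgebroid of it; for a section `γ` of `E* × ℝ` the pair `(j_γ, i_γ)` is a Lie subalgebroid of it,
which is Legendrian if and only if `γ` is locally the `1`-jet of a function. -/
theorem mainTheorem6
    {EB : Type*} [NormedAddCommGroup EB] [NormedSpace ℝ EB] [FiniteDimensional ℝ EB]
    {Q : Type*} [TopologicalSpace Q] [T2Space Q] [SecondCountableTopology Q]
    [ChartedSpace EB Q] [IsManifold 𝓘(ℝ, EB) ∞ Q]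
    {F : Type*} [NormedAddCommGroup F] [NormedSpace ℝ F] [FiniteDimensional ℝ F]
    {E : Q → Type*} [TopologicalSpace (TotalSpace F E)]
    [∀ q, AddCommGroup (E q)] [∀ q, Module ℝ (E q)] [∀ q, TopologicalSpace (E q)]
    [FiberBundle F E] [VectorBundle ℝ F E] [ContMDiffVectorBundle ∞ F E 𝓘(ℝ, EB)]
    (m : ℕ) (hm : Module.finrank ℝ F = m)
    (ρ : ∀ q, E q →L[ℝ] TangentSpace 𝓘(ℝ, EB) q)
    (br : (∀ q, E q) → (∀ q, E q) → ∀ q, E q)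
    (hE : (LieAlg.ofBundle F ρ br).IsLieAlgebroid m) :
    (LieAlg.hamProlongation F ρ br).IsContact m (LieAlg.contactForm F ρ) ∧
    (∀ q : Q,
      LieAlg.IsLegendrian m (LieAlg.fibreAlgebroid F E q) (LieAlg.hamProlongation F ρ br)
        (LieAlg.contactForm F ρ) (LieAlg.fibreIncl F q) (LieAlg.fibreInclBundle F ρ q)) ∧
    (∀ γ : LieAlg.PhaseSection EB F E,
      LieAlg.IsLieSubalgebroid m (2 * m + 1) (γ.algebroid ρ br) (LieAlg.hamProlongation F ρ br)
        γ.incl (γ.inclBundle ρ) ∧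
      (LieAlg.IsLegendrian m (γ.algebroid ρ br) (LieAlg.hamProlongation F ρ br)
        (LieAlg.contactForm F ρ) γ.incl (γ.inclBundle ρ) ↔ γ.IsLocallyJet ρ)) := by
  have hA := LieAlg.hamProlongation_isContact hm hE
  exact ⟨hA, fun _ => LieAlg.fibreAlgebroid_isLegendrian hm hE, fun _ =>
    ⟨LieAlg.PhaseSection.algebroid_isLieSubalgebroid hm hE,
      LieAlg.PhaseSection.isLegendrian_iff_isLocallyJet hm hE⟩⟩
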